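/- An instance consists of agents $N=[n]$ with monotone valuations $v_i:2^M\to\mathbb{R}_{\ge 0}$ and budgets $b_i\ge 0$, and of projects $M=[m]$ with costs $C_j\ge 0$. For $W\subseteq M$ let $$\operatorname{PE}(W)=\sum_{i\in N}\min(b_i,v_i(W))-\sum_{j\in W}C_j .$$ The problem $\operatorname{MaxPE}$ asks for $\max_{W\subseteq M}\operatorname{PE}(W)$; a set attaining the maximum is a MaxPE set. The instance is single-minded if for each $i$ there are $D_i\subseteq M$ and $z_i\ge 0$ with $v_i(W)=z_i$ if $D_i\subseteq W$ and $v_i(W)=0$ otherwise. 1. In the single-minded setting, $\operatorname{MaxPE}$ can be solved in polynomial time: there is one algorithm (a program of a random access machine with logarithmic cost) that, given the sets $D_i$ and non-negative rational numbers $z_i,b_i,C_j$ in binary, outputs a MaxPE set and the value $\operatorname{MaxPE}$ (as a fraction) in time polynomial in the length of the input. Moreover, for every single-minded instance (with real data), put $w_i=\min(b_i,z_i)$. 2. $\operatorname{MaxPE}$ is described by the integer program that maximizes $\sum_{i}w_ix_i-\sum_jC_jy_j$ subject to $x_i\le y_j$ for all $i\in N$, $j\in D_i$, and $x_i,y_j\in\{0,1\}$.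 That is, for each $W\subseteq M$ the vector with $x_i=1$ iff $D_i\subseteq W$ and $y_j=1$ iff $j\in W$ is feasible with objective value $\operatorname{PE}(W)$, and it is optimal iff $W$ is a MaxPE set; and if $(x,y)$ is any optimal solution, then $\{j: y_j=1\}$ is a MaxPE set and its $\operatorname{PE}$ is the optimal value. 3. The linear relaxation of this program (with $0\le x_i,y_j\le 1$), written as one system of inequalities $Au\le\beta$ in $u=(x,y)$ with a row for each constraint $x_i-y_j\le 0$, each upper bound and each lower bound, has a totally unimodular matrix $A$. 4. $\operatorname{MaxPE}$ is the maximum-weight closure problem in the digraph on $N\sqcup M$ with an arc from $i$ to each $j\in D_i$, where $i\in N$ has weight $w_i$ and $j\in M$ has weight $-C_j$: $W$ is a MaxPE set iff $\{i:D_i\subseteq W\}\cup W$ is a closed set (a set that no arc leaves) of maximum weight, and if $S$ is any closed set of maximum weight, then $S\cap M$ is a MaxPE set and its $\operatorname{PE}$ is the weight of $S$. 5. $\operatorname{MaxPE}$ is the minimum $s$-$t$ cut problem in the network with arcs $s\to i$ of capacity $w_i$ ($i\in N$), $i\to j$ of infinite capacity ($j\in D_i$) and $j\to t$ of capacity $C_j$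 ($j\in M$): $W$ is a MaxPE set iff $\{s\}\cup\{i:D_i\subseteq W\}\cup W$ is the source side of a minimum cut, and if $S$ is the source side of any minimum cut, then its capacity is finite, $S\cap M$ is a MaxPE set, and $\operatorname{PE}(S\cap M)=\sum_iw_i-\operatorname{cap}(S)$. -/

import Mathlib

/-! ### Participatory budgeting with resource pooling -/

/-- An instance with agents `Fin n` and projects `Fin m`: monotone non-negative valuations `v`,
budgets `b` and project costs `C`. -/
structure PBInstance (n m : ℕ) where
  v : Fin n → Finset (Fin m) → ℝ
  b : Fin n → ℝ
  C : Fin m → ℝ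
  v_nonneg : ∀ i W, 0 ≤ v i W
  v_mono : ∀ i, Monotone (v i)
  b_nonneg : ∀ i, 0 ≤ b i
  C_nonneg : ∀ j, 0 ≤ C j

namespace PBInstance

variable {n m : ℕ}

/-- The excess payment that can be extracted when the bundle `W` is funded. -/
noncomputable def PE (I : PBInstance n m) (W : Finset (Fin m)) : ℝ :=
  ∑ i, min (I.b i) (I.v i W) - ∑ j ∈ W, I.C j

/-- `W` maximizes the excess payment. -/
def IsMaxPESet (I : PBInstance n m) (W : Finset (Fin m)) : Prop :=
  ∀ W' : Finset (Fin m), I.PE W' ≤ I.PE W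

/-- The valuations are single-minded with demand sets `D` and values `z`. -/
def IsSingleMindedWith (I : PBInstance n m) (D : Fin n → Finset (Fin m)) (z : Fin n → ℝ) : Prop :=
  ∀ i, 0 ≤ z i ∧ ∀ W, I.v i W = if D i ⊆ W then z i else 0

/-! ### The integer program

A variable vector is `u : Fin n ⊕ Fin m → ℝ`, where `u (inl i)` is `x i` and `u (inr j)` is `y j`. -/

/-- The coefficient `min (b i) (z i)` of `x i` and `- C j` of `y j`. -/
noncomputable def weight (I : PBInstance n m) (z : Fin n → ℝ) : Fin n ⊕ Fin m → ℝ :=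
  Sum.elim (fun i => min (I.b i) (z i)) (fun j => -I.C j)

/-- `∑ i, min (b i) (z i) * x i - ∑ j, C j * y j`. -/
noncomputable def objective (I : PBInstance n m) (z : Fin n → ℝ) (u : Fin n ⊕ Fin m → ℝ) : ℝ :=
  ∑ k, I.weight z k * u k

/-- `x i ≤ y j` for all `i` and `j ∈ D i`, and all variables are `0` or `1`. -/
def ILPFeasible (D : Fin n → Finset (Fin m)) (u : Fin n ⊕ Fin m → ℝ) : Prop :=
  (∀ i, ∀ j ∈ D i, u (Sum.inl i) ≤ u (Sum.inr j)) ∧ ∀ k, u k = 0 ∨ u k = 1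

/-- The linear relaxation: all variables lie between `0` and `1`. -/
def LPFeasible (D : Fin n → Finset (Fin m)) (u : Fin n ⊕ Fin m → ℝ) : Prop :=
  (∀ i, ∀ j ∈ D i, u (Sum.inl i) ≤ u (Sum.inr j)) ∧ ∀ k, 0 ≤ u k ∧ u k ≤ 1

/-- `u` is an optimal solution of the integer program. -/
def IsILPOptimal (I : PBInstance n m) (D : Fin n → Finset (Fin m)) (z : Fin n → ℝ)
    (u : Fin n ⊕ Fin m → ℝ) : Prop :=
  ILPFeasible D u ∧ ∀ u', ILPFeasible D u' → I.objective z u' ≤ I.objective z u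

/-- The vector of a bundle: `x i = 1` iff `D i ⊆ W`, and `y j = 1` iff `j ∈ W`. -/
def bundleVector (D : Fin n → Finset (Fin m)) (W : Finset (Fin m)) : Fin n ⊕ Fin m → ℝ :=
  Sum.elim (fun i => if D i ⊆ W then 1 else 0) (fun j => if j ∈ W then 1 else 0)

/-- The rows of the relaxation: one for each `x i - y j ≤ 0` with `j ∈ D i`, one for each upper
bound `u k ≤ 1`, and one for each lower bound `- u k ≤ 0`. -/
abbrev LPRow (D : Fin n → Finset (Fin m)) : Type :=
  {p : Fin n × Fin m // p.2 ∈ D p.1} ⊕ ((Fin n ⊕ Fin m) ⊕ (Fin n ⊕ Fin m))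

/-- The constraint matrix of the relaxation. -/
def lpMatrix (D : Fin n → Finset (Fin m)) : Matrix (LPRow D) (Fin n ⊕ Fin m) ℝ :=
  Matrix.fromRows
    (Matrix.of fun p k =>
      (if k = Sum.inl p.1.1 then 1 else 0) - (if k = Sum.inr p.1.2 then 1 else 0))
    (Matrix.fromRows 1 (-1))

/-- The right-hand side of the relaxation. -/
def lpRhs (D : Fin n → Finset (Fin m)) : LPRow D → ℝ :=
  Sum.elim (fun _ => 0) (Sum.elim (fun _ => 1) (fun _ => 0))

/-! ### The closure problem and the cut problem -/

/-- `S` is closed under successors in the digraph with an arc from agent `i` to each project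
in `D i`. -/
def IsClosure (D : Fin n → Finset (Fin m)) (S : Finset (Fin n ⊕ Fin m)) : Prop :=
  ∀ i, Sum.inl i ∈ S → ∀ j ∈ D i, Sum.inr j ∈ S

/-- `S` is a closed set of maximum weight. -/
def IsMaxClosure (I : PBInstance n m) (D : Fin n → Finset (Fin m)) (z : Fin n → ℝ)
    (S : Finset (Fin n ⊕ Fin m)) : Prop :=
  IsClosure D S ∧
    ∀ S', IsClosure D S' → ∑ k ∈ S', I.weight z k ≤ ∑ k ∈ S, I.weight z k

/-- The agents whose demand sets lie in `W`, together with the projects in `W`. -/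
def bundleClosure (D : Fin n → Finset (Fin m)) (W : Finset (Fin m)) : Finset (Fin n ⊕ Fin m) :=
  (Finset.univ.filter fun i => D i ⊆ W).disjSum W

/-- The vertices of the network: a source, the agents and projects, and a sink. -/
abbrev Vertex (n m : ℕ) : Type := Unit ⊕ ((Fin n ⊕ Fin m) ⊕ Unit)

/-- The source. -/
abbrev source : Vertex n m := Sum.inl ()

/-- An agent or a project as a vertex of the network. -/
abbrev inner (k : Fin n ⊕ Fin m) : Vertex n m := Sum.inr (Sum.inl k)

/-- The sink. -/
abbrev sink : Vertex n m := Sum.inr (Sum.inr ())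

/-- The capacities: `min (b i) (z i)` from the source to agent `i`, infinite from agent `i` to each
project in `D i`, `C j` from project `j` to the sink, and no other arcs. -/
noncomputable def capacity (I : PBInstance n m) (D : Fin n → Finset (Fin m)) (z : Fin n → ℝ) :
    Vertex n m → Vertex n m → ENNReal
  | Sum.inl _, Sum.inr (Sum.inl (Sum.inl i)) => ENNReal.ofReal (min (I.b i) (z i))
  | Sum.inr (Sum.inl (Sum.inl i)), Sum.inr (Sum.inl (Sum.inr j)) => if j ∈ D i then ⊤ else 0
  | Sum.inr (Sum.inl (Sum.inr j)), Sum.inr (Sum.inr _) => ENNReal.ofReal (I.C j)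
  | _, _ => 0

/-- The total capacity of the arcs that leave `S`. -/
noncomputable def cutCapacity (I : PBInstance n m) (D : Fin n → Finset (Fin m)) (z : Fin n → ℝ)
    (S : Finset (Vertex n m)) : ENNReal :=
  ∑ p ∈ S, ∑ q ∈ Sᶜ, I.capacity D z p q

/-- `S` is the source side of a cut of minimum capacity between source and sink. -/
def IsMinCut (I : PBInstance n m) (D : Fin n → Finset (Fin m)) (z : Fin n → ℝ)
    (S : Finset (Vertex n m)) : Prop :=
  (source ∈ S ∧ sink ∉ S) ∧
    ∀ S' : Finset (Vertex n m), source ∈ S' → sink ∉ S' →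
      I.cutCapacity D z S ≤ I.cutCapacity D z S'

end PBInstance

/-! ### Random access machines with logarithmic cost

Programs act on finitely many registers and finitely many unbounded arrays, all holding natural
numbers. Every elementary command is charged for the bit lengths of the numbers, including array
indices, that it handles. Running time in this model is polynomially related to the running time
of multitape Turing machines. -/

namespace RAM

/-- Arithmetic operations; subtraction is truncated at `0`. -/
inductive Op where
  | add
  | sub
  | mul

/-- The value of an operation. -/
def Op.eval : Op → ℕ → ℕ → ℕ
  | .add, a, b => a + b
  | .sub, a, b => a - b
  | .mul, a, b => a * b

/-- Programs. Registers and arrays are named by natural numbers. -/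
inductive Prog where
  /-- do nothing -/
  | skip : Prog
  /-- `x := c` -/
  | const (x c : ℕ) : Prog
  /-- `x := y` -/
  | copy (x y : ℕ) : Prog
  /-- `x := y o w` -/
  | arith (o : Op) (x y w : ℕ) : Prog
  /-- `x := a[y]` -/
  | load (x a y : ℕ) : Prog
  /-- `a[y] := x` -/
  | store (a y x : ℕ) : Prog
  /-- first `p`, then `q` -/
  | seq (p q : Prog) : Prog
  /-- `p` if register `x` is non-zero, otherwise `q` -/
  | cond (x : ℕ) (p q : Prog) : Prog
  /-- `p` again and again as long as register `x` is non-zero -/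
  | loop (x : ℕ) (p : Prog) : Prog

/-- The contents of the registers and of the arrays. -/
@[ext] structure State where
  reg : ℕ → ℕ
  arr : ℕ → ℕ → ℕ

/-- Overwrite register `x`. -/
def State.setReg (s : State) (x a : ℕ) : State :=
  { s with reg := Function.update s.reg x a }

/-- Overwrite entry `i` of array `a`. -/
def State.setArr (s : State) (a i c : ℕ) : State :=
  { s with arr := Function.update s.arr a (Function.update (s.arr a) i c) }

/-- `Exec p s t s'`: started in state `s`, the program `p` terminates in state `s'` at total
cost `t`. The bit length of a number `c` is `Nat.size c`. -/
inductive Exec : Prog → State → ℕ → State → Prop where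
  | skip (s : State) : Exec .skip s 1 s
  | const (s : State) (x c : ℕ) : Exec (.const x c) s (1 + Nat.size c) (s.setReg x c)
  | copy (s : State) (x y : ℕ) :
      Exec (.copy x y) s (1 + Nat.size (s.reg y)) (s.setReg x (s.reg y))
  | arith (s : State) (o : Op) (x y w : ℕ) :
      Exec (.arith o x y w) s (1 + Nat.size (s.reg y) + Nat.size (s.reg w))
        (s.setReg x (o.eval (s.reg y) (s.reg w)))
  | load (s : State) (x a y : ℕ) :
      Exec (.load x a y) s (1 + Nat.size (s.reg y) + Nat.size (s.arr a (s.reg y)))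
        (s.setReg x (s.arr a (s.reg y)))
  | store (s : State) (a y x : ℕ) :
      Exec (.store a y x) s (1 + Nat.size (s.reg y) + Nat.size (s.reg x))
        (s.setArr a (s.reg y) (s.reg x))
  | seq {p q : Prog} {s₁ s₂ s₃ : State} {t₁ t₂ : ℕ} :
      Exec p s₁ t₁ s₂ → Exec q s₂ t₂ s₃ → Exec (.seq p q) s₁ (t₁ + t₂) s₃
  | cond_true {x : ℕ} {p q : Prog} {s s' : State} {t : ℕ} :
      s.reg x ≠ 0 → Exec p s t s' → Exec (.cond x p q) s (1 + Nat.size (s.reg x) + t) s'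
  | cond_false {x : ℕ} {p q : Prog} {s s' : State} {t : ℕ} :
      s.reg x = 0 → Exec q s t s' → Exec (.cond x p q) s (1 + t) s'
  | loop_true {x : ℕ} {p : Prog} {s₁ s₂ s₃ : State} {t₁ t₂ : ℕ} :
      s₁.reg x ≠ 0 → Exec p s₁ t₁ s₂ → Exec (.loop x p) s₂ t₂ s₃ →
        Exec (.loop x p) s₁ (1 + Nat.size (s₁.reg x) + t₁ + t₂) s₃
  | loop_false {x : ℕ} {p : Prog} {s : State} :
      s.reg x = 0 → Exec (.loop x p) s 1 s

/-- The state in which array `0` holds the list `l`, register `0` holds its length, and everything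
else is `0`. -/
def inputState (l : List ℕ) : State where
  reg x := if x = 0 then l.length else 0
  arr a i := if a = 0 then l.getD i 0 else 0

/-- The list in array `1` whose length is held by register `0`. -/
def outputList (s : State) : List ℕ :=
  (List.range (s.reg 0)).map (s.arr 1)

/-- The length of a list of numbers in binary notation, with one separator for each number. -/
def bitLength (l : List ℕ) : ℕ :=
  (l.map fun c => Nat.size c + 1).sum

/-- The search problem `R`, with inputs encoded by `enc`, is solvable in polynomial time: one
program halts on every input `a` within a number of steps that is polynomial in the length of the
encoding, and its output `l` satisfies `R a l`. -/
def SolvableInPolyTime {α : Type} (enc : α → List ℕ) (R : α → List ℕ → Prop) : Prop :=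
  ∃ (p : Prog) (T : Polynomial ℕ), ∀ a : α, ∃ (t : ℕ) (s : State),
    Exec p (inputState (enc a)) t s ∧ t ≤ T.eval (bitLength (enc a)) ∧ R a (outputList s)

end RAM

/-! ### The computational problem -/

/-- The input data of a single-minded instance with rational numbers: demand sets `D`, values `z`,
budgets `b` and costs `C`. -/
structure SMInput where
  n : ℕ
  m : ℕ
  D : Fin n → Finset (Fin m)
  z : Fin n → ℚ≥0
  b : Fin n → ℚ≥0
  C : Fin m → ℚ≥0

namespace SMInput

/-- The instance given by the data. -/
noncomputable def toPB (I : SMInput) : PBInstance I.n I.m where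
  v i W := if I.D i ⊆ W then ((I.z i : ℚ≥0) : ℝ) else 0
  b i := ((I.b i : ℚ≥0) : ℝ)
  C j := ((I.C j : ℚ≥0) : ℝ)
  v_nonneg i W := by split_ifs <;> positivity
  v_mono i W W' h := by
    by_cases h₁ : I.D i ⊆ W
    · simp [h₁, h₁.trans h]
    · simp only [h₁, if_false]; split_ifs <;> positivity
  b_nonneg i := by positivity
  C_nonneg j := by positivity

/-- The indicator list of a set of projects. -/
def indicatorList {m : ℕ} (W : Finset (Fin m)) : List ℕ :=
  List.ofFn fun j : Fin m => if j ∈ W then 1 else 0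

/-- The encoding: the numbers of agents and of projects; for each agent numerator and denominator
of the value, numerator and denominator of the budget, and the indicator list of the demand set;
for each project numerator and denominator of the cost. -/
def encode (I : SMInput) : List ℕ :=
  [I.n, I.m] ++
    (List.ofFn fun i : Fin I.n =>
      [(I.z i).num, (I.z i).den, (I.b i).num, (I.b i).den] ++ indicatorList (I.D i)).flatten ++
    (List.ofFn fun j : Fin I.m => [(I.C j).num, (I.C j).den]).flatten

/-- The list `l` solves the maximization problem: it consists of numerator and denominator of the
maximum excess payment and the indicator list of a bundle that attains it. -/
def IsSolution (I : SMInput) (l : List ℕ) : Prop :=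
  ∃ (W : Finset (Fin I.m)) (num den : ℕ), l = num :: den :: indicatorList W ∧
    I.toPB.IsMaxPESet W ∧ den ≠ 0 ∧ I.toPB.PE W = (num : ℝ) / (den : ℝ)

end SMInput

/-! The structural parts rest on one observation. A closed set `S` contains an agent only together
with the agent's whole demand set, and adding every agent whose demand lies in the projects of `S`
adds non-negative weights only. So the weight of `S` is at most `PE` of its projects
(`IsClosure.sum_weight_le`), with equality for the closures of bundles (`sum_weight_bundleClosure`).
Feasible 0-1 vectors are exactly the indicators of closed sets, and source sides of finite cuts are
exactly closed sets with the source added, of capacity the total agent weight minus the weight of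
the set (`cutCapacity_of_isClosure`). Hence all three reformulations reduce to maximum closures.
Total unimodularity holds because every row of the matrix is a unit vector, its negative, or a
difference of two unit vectors (`IsDifferenceMatrix.det_mem`).

For the algorithm, all weights are multiplied by a common denominator, and a push-relabel method
runs on the network without its source: each agent starts with its scaled weight as excess, a
project is joined to the sink by its scaled cost, and a demand arc gets a capacity exceeding all
scaled weights in place of infinity. The surplus of a vertex set, its excess minus the residual
capacity leaving it, is invariant under pushes (`surplus_push`). Initially it equals the scaled `PE`
on closures of bundles, and for any set without the sink it is at most the scaled `PE` of the set's
projects (`surplus_bundleVertices`, `surplus_le_PE`).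

The method stops when every vertex with excess, other than the sink, has label at least the number
of vertices. By pigeonhole some positive label `g` up to that number is missing. No residual arc
leaves the set of vertices labelled at least `g`, so its surplus is the whole excess outside the
sink (`surplus_eq_of_gap`), an upper bound for the surplus of every set without the sink
(`surplus_le`). Its projects are therefore optimal, and the remaining excess is the scaled optimum.
An integer potential, polynomial at the start, drops with each productive sweep (`potential_push`,
`potential_relabel`).

To transfer this to the machine, structured programs are verified with step counts and compiled. A
step lengthens numbers by at most one bit as long as products stay short, so polynomially many steps
together with a polynomial bound on the bit lengths of products (`fits_of_size_le`) give polynomial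
logarithmic cost. -/

/-! ### Matrices with at most one `1` and at most one `-1` in each row -/

namespace Matrix

/-- Every row is a difference of two vectors each of which is zero or a unit vector. -/
def IsDifferenceMatrix {α β : Type*} (A : Matrix α β ℝ) : Prop :=
  ∀ i, ∃ p q : β → Prop, (∀ a b, p a → p b → a = b) ∧ (∀ a b, q a → q b → a = b) ∧
    ∀ j, (p j ∧ ¬ q j ∧ A i j = 1) ∨ (¬ p j ∧ q j ∧ A i j = -1) ∨ (¬ p j ∧ ¬ q j ∧ A i j = 0)

/-- Rows may be repeated, columns may not: a repeated column could put two entries `1` into one row.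
-/
theorem IsDifferenceMatrix.submatrix {α β α' β' : Type*} {A : Matrix α β ℝ}
    (hA : A.IsDifferenceMatrix) (f : α' → α) {g : β' → β} (hg : Function.Injective g) :
    (A.submatrix f g).IsDifferenceMatrix := by
  intro i
  obtain ⟨p, q, hp, hq, h⟩ := hA (f i)
  exact ⟨p ∘ g, q ∘ g, fun a b ha hb => hg (hp _ _ ha hb), fun a b ha hb => hg (hq _ _ ha hb),
    fun j => h (g j)⟩

/-- If some row has exactly one non-zero entry, Laplace expansion along it reduces the size.
Otherwise each row is zero or consists of one `1` and one `-1`, so the all-ones vector lies in the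
kernel and the determinant vanishes. -/
theorem IsDifferenceMatrix.det_mem : ∀ {k : ℕ} {A : Matrix (Fin k) (Fin k) ℝ},
    A.IsDifferenceMatrix → A.det ∈ Set.range SignType.cast := by
  intro k
  induction k with
  | zero => exact fun _ => ⟨1, by simp⟩
  | succ k ih =>
    intro A hA
    by_cases hone : ∃ i j, A i j ≠ 0 ∧ ∀ j', j' ≠ j → A i j' = 0
    · obtain ⟨i, j, hij, hj⟩ := hone
      have hdet := det_succ_row A i
      rw [Finset.sum_eq_single j (fun j' _ hj' => by rw [hj j' hj']; simp) (by simp)] at hdet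
      obtain ⟨t, ht⟩ := ih (hA.submatrix i.succAbove j.succAbove_right_injective)
      have hsgn : A i j ∈ Set.range (SignType.cast : SignType → ℝ) := by
        obtain ⟨p, q, -, -, h⟩ := hA i
        rcases h j with ⟨-, -, h⟩ | ⟨-, -, h⟩ | ⟨-, -, h⟩
        · exact ⟨1, by simp [h]⟩
        · exact ⟨-1, by simp [h]⟩
        · exact ⟨0, by simp [h]⟩
      obtain ⟨s, hs⟩ := hsgn
      rw [hdet, ← ht, ← hs]
      exact ⟨(-1) ^ (i + j : ℕ) * s * t, by simp⟩
    · push Not at hone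
      refine ⟨0, ?_⟩
      rw [SignType.coe_zero, eq_comm]
      refine exists_mulVec_eq_zero_iff.1 ⟨fun _ => 1, fun h => one_ne_zero (congrFun h 0), ?_⟩
      ext i
      obtain ⟨p, q, hp, hq, h⟩ := hA i
      simp only [mulVec, dotProduct, mul_one, Pi.zero_apply]
      by_cases hz : ∀ j, A i j = 0
      · simp [hz]
      push Not at hz
      obtain ⟨j, hj⟩ := hz
      obtain ⟨j', hne, hj'⟩ := hone i j hj
      -- Among three non-zero entries two would have the same sign.
      have hrest : ∀ l, l ≠ j → l ≠ j' → A i l = 0 := by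
        intro l h₁ h₂
        rcases h l with ⟨c, -, -⟩ | ⟨-, c, -⟩ | ⟨-, -, c⟩
        · rcases h j with ⟨d, -, -⟩ | ⟨-, d, -⟩ | ⟨-, -, d⟩
          · exact absurd (hp _ _ c d) h₁
          · rcases h j' with ⟨f, -, -⟩ | ⟨-, f, -⟩ | ⟨-, -, f⟩
            · exact absurd (hp _ _ c f) h₂
            · exact absurd (hq _ _ f d) hne
            · exact absurd f hj'
          · exact absurd d hj
        · rcases h j with ⟨d, -, -⟩ | ⟨-, d, -⟩ | ⟨-, -, d⟩
          · rcases h j' with ⟨f, -, -⟩ | ⟨-, f, -⟩ | ⟨-, -, f⟩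
            · exact absurd (hp _ _ f d) hne
            · exact absurd (hq _ _ c f) h₂
            · exact absurd f hj'
          · exact absurd (hq _ _ c d) h₁
          · exact absurd d hj
        · exact c
      rw [Finset.sum_eq_add_of_mem j j' (Finset.mem_univ _) (Finset.mem_univ _) hne.symm
        fun l _ hl => hrest l hl.1 hl.2]
      rcases h j with ⟨c, -, e⟩ | ⟨-, c, e⟩ | ⟨-, -, e⟩
      · rcases h j' with ⟨f, -, -⟩ | ⟨-, -, g⟩ | ⟨-, -, f⟩
        · exact absurd (hp _ _ f c) hne
        · rw [e, g]
          norm_num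
        · exact absurd f hj'
      · rcases h j' with ⟨-, -, g⟩ | ⟨-, f, -⟩ | ⟨-, -, f⟩
        · rw [e, g]
          norm_num
        · exact absurd (hq _ _ f c) hne
        · exact absurd f hj'
      · exact absurd e hj

theorem IsDifferenceMatrix.isTotallyUnimodular {α β : Type*} {A : Matrix α β ℝ}
    (hA : A.IsDifferenceMatrix) : A.IsTotallyUnimodular :=
  fun _ f _ _ hg => (hA.submatrix f hg).det_mem

end Matrix

namespace PBInstance

variable {n m : ℕ} {I : PBInstance n m} {D : Fin n → Finset (Fin m)} {z : Fin n → ℝ}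

/-! ### The linear relaxation -/

theorem lpFeasible_iff (D : Fin n → Finset (Fin m)) (u : Fin n ⊕ Fin m → ℝ) :
    LPFeasible D u ↔ Matrix.mulVec (lpMatrix D) u ≤ lpRhs D := by
  have h₁ : ∀ p : {p : Fin n × Fin m // p.2 ∈ D p.1},
      Matrix.mulVec (lpMatrix D) u (Sum.inl p) = u (Sum.inl p.1.1) - u (Sum.inr p.1.2) := by
    intro p
    simp only [Matrix.mulVec, dotProduct, lpMatrix, Matrix.fromRows_apply_inl, Matrix.of_apply,
      sub_mul, ite_mul, one_mul, zero_mul, Finset.sum_sub_distrib, Finset.sum_ite_eq',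
      Finset.mem_univ, if_true]
  have h₂ : ∀ k, Matrix.mulVec (lpMatrix D) u (Sum.inr (Sum.inl k)) = u k := by
    intro k
    simp [Matrix.mulVec, dotProduct, lpMatrix, Matrix.one_apply]
  have h₃ : ∀ k, Matrix.mulVec (lpMatrix D) u (Sum.inr (Sum.inr k)) = -u k := by
    intro k
    simp [Matrix.mulVec, dotProduct, lpMatrix, Matrix.one_apply]
  constructor
  · rintro ⟨ha, hb⟩ (p | k | k)
    · rw [h₁]
      exact sub_nonpos.2 (ha _ _ p.2)
    · rw [h₂]
      exact (hb k).2
    · rw [h₃]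
      exact neg_nonpos.2 (hb k).1
  · refine fun h => ⟨fun i j hj => ?_, fun k => ⟨?_, ?_⟩⟩
    · have := h (Sum.inl ⟨(i, j), hj⟩)
      rw [h₁] at this
      exact sub_nonpos.1 this
    · have := h (Sum.inr (Sum.inr k))
      rw [h₃] at this
      exact neg_nonpos.1 this
    · have := h (Sum.inr (Sum.inl k))
      rwa [h₂] at this

theorem lpMatrix_isTotallyUnimodular (D : Fin n → Finset (Fin m)) :
    (lpMatrix D).IsTotallyUnimodular := by
  refine Matrix.IsDifferenceMatrix.isTotallyUnimodular ?_
  rintro (p | k | k)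
  · refine ⟨(· = Sum.inl p.1.1), (· = Sum.inr p.1.2), fun a b ha hb => ha.trans hb.symm,
      fun a b ha hb => ha.trans hb.symm, fun l => ?_⟩
    by_cases h₁ : l = Sum.inl p.1.1
    · subst h₁
      simp [lpMatrix]
    · by_cases h₂ : l = Sum.inr p.1.2
      · subst h₂
        simp [lpMatrix]
      · simp [lpMatrix, h₁, h₂]
  · refine ⟨(k = ·), fun _ => False, fun a b ha hb => ha.symm.trans hb, nofun, fun l => ?_⟩
    by_cases h : k = l <;> simp [lpMatrix, h]
  · refine ⟨fun _ => False, (k = ·), nofun, fun a b ha hb => ha.symm.trans hb, fun l => ?_⟩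
    by_cases h : k = l <;> simp [lpMatrix, h]

/-! ### Bundles and closed sets -/

/-- The projects in a set of agents and projects. -/
abbrev projects (S : Finset (Fin n ⊕ Fin m)) : Finset (Fin m) :=
  Finset.univ.filter fun j => Sum.inr j ∈ S

theorem IsSingleMindedWith.PE_eq (h : I.IsSingleMindedWith D z) (W : Finset (Fin m)) :
    I.PE W = ∑ i, (if D i ⊆ W then min (I.b i) (z i) else 0) - ∑ j ∈ W, I.C j := by
  rw [PE]
  congr 1
  refine Finset.sum_congr rfl fun i _ => ?_
  rw [(h i).2]
  split_ifs
  · rfl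
  · exact min_eq_right (I.b_nonneg i)

theorem IsSingleMindedWith.weight_nonneg (h : I.IsSingleMindedWith D z) (i : Fin n) :
    0 ≤ min (I.b i) (z i) :=
  le_min (I.b_nonneg i) (h i).1

theorem sum_weight (S : Finset (Fin n ⊕ Fin m)) :
    ∑ k ∈ S, I.weight z k =
      ∑ i, (if Sum.inl i ∈ S then min (I.b i) (z i) else 0) - ∑ j ∈ projects S, I.C j := by
  rw [Finset.sum_filter, sub_eq_add_neg, ← Finset.sum_neg_distrib]
  have : ∑ k ∈ S, I.weight z k = ∑ k, if k ∈ S then I.weight z k else 0 := by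
    rw [Finset.sum_ite_mem, Finset.univ_inter]
  rw [this, Fintype.sum_sum_type]
  congr 1
  refine Finset.sum_congr rfl fun j _ => ?_
  split_ifs <;> simp [weight]

theorem isClosure_bundleClosure (D : Fin n → Finset (Fin m)) (W : Finset (Fin m)) :
    IsClosure D (bundleClosure D W) := by
  intro i hi j hj
  simp only [bundleClosure, Finset.inl_mem_disjSum, Finset.inr_mem_disjSum, Finset.mem_filter,
    Finset.mem_univ, true_and] at hi ⊢
  exact hi hj

theorem projects_bundleClosure (D : Fin n → Finset (Fin m)) (W : Finset (Fin m)) :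
    projects (bundleClosure D W) = W := by
  ext j
  simp [projects, bundleClosure]

theorem sum_weight_bundleClosure (h : I.IsSingleMindedWith D z) (W : Finset (Fin m)) :
    ∑ k ∈ bundleClosure D W, I.weight z k = I.PE W := by
  rw [sum_weight, projects_bundleClosure, h.PE_eq]
  simp [bundleClosure]

/-- Closedness makes every agent of `S` count in `PE`; further agents whose demand happens to be
covered contribute non-negatively. -/
theorem IsClosure.sum_weight_le (h : I.IsSingleMindedWith D z) {S : Finset (Fin n ⊕ Fin m)}
    (hS : IsClosure D S) : ∑ k ∈ S, I.weight z k ≤ I.PE (projects S) := by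
  rw [sum_weight, h.PE_eq]
  refine sub_le_sub_right (Finset.sum_le_sum fun i _ => ?_) _
  by_cases hi : Sum.inl i ∈ S
  · rw [if_pos hi, if_pos]
    intro j hj
    simpa using hS i hi j hj
  · rw [if_neg hi]
    split_ifs
    · exact h.weight_nonneg i
    · exact le_rfl

theorem isMaxPESet_iff_isMaxClosure (h : I.IsSingleMindedWith D z) (W : Finset (Fin m)) :
    I.IsMaxPESet W ↔ I.IsMaxClosure D z (bundleClosure D W) := by
  constructor
  · refine fun hW => ⟨isClosure_bundleClosure D W, fun S hS => ?_⟩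
    rw [sum_weight_bundleClosure h]
    exact (hS.sum_weight_le h).trans (hW _)
  · intro hW W'
    have := hW.2 _ (isClosure_bundleClosure D W')
    rwa [sum_weight_bundleClosure h, sum_weight_bundleClosure h] at this

theorem IsMaxClosure.isMaxPESet (h : I.IsSingleMindedWith D z) {S : Finset (Fin n ⊕ Fin m)}
    (hS : I.IsMaxClosure D z S) :
    I.IsMaxPESet (projects S) ∧ I.PE (projects S) = ∑ k ∈ S, I.weight z k := by
  have hle := hS.1.sum_weight_le h
  have hge : ∀ W, I.PE W ≤ ∑ k ∈ S, I.weight z k := by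
    intro W
    rw [← sum_weight_bundleClosure h]
    exact hS.2 _ (isClosure_bundleClosure D W)
  exact ⟨fun W => (hge W).trans hle, le_antisymm (hge _) hle⟩

/-! ### The integer program -/

/-- The indicator vector of a set of agents and projects. -/
def indicatorVector (S : Finset (Fin n ⊕ Fin m)) (k : Fin n ⊕ Fin m) : ℝ :=
  if k ∈ S then 1 else 0

theorem bundleVector_eq (D : Fin n → Finset (Fin m)) (W : Finset (Fin m)) :
    bundleVector D W = indicatorVector (bundleClosure D W) := by
  ext (i | j) <;> simp [bundleVector, indicatorVector, bundleClosure]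

theorem objective_indicatorVector (S : Finset (Fin n ⊕ Fin m)) :
    I.objective z (indicatorVector S) = ∑ k ∈ S, I.weight z k := by
  simp [objective, indicatorVector]

theorem ilpFeasible_indicatorVector (S : Finset (Fin n ⊕ Fin m)) :
    ILPFeasible D (indicatorVector S) ↔ IsClosure D S := by
  constructor
  · intro h i hi j hj
    have := h.1 i j hj
    by_contra hj'
    simp only [indicatorVector, hi, hj', if_true, if_false] at this
    exact absurd this (by norm_num)
  · refine fun h => ⟨fun i j hj => ?_, fun k => ?_⟩
    · by_cases hi : Sum.inl i ∈ S
      · simp [indicatorVector, hi, h i hi j hj]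
      · simp only [indicatorVector, hi, if_false]
        split_ifs <;> norm_num
    · by_cases hk : k ∈ S <;> simp [indicatorVector, hk]

theorem ILPFeasible.eq_indicatorVector {u : Fin n ⊕ Fin m → ℝ} (h : ILPFeasible D u) :
    u = indicatorVector (Finset.univ.filter fun k => u k = 1) := by
  ext k
  rcases h.2 k with hk | hk <;> simp [indicatorVector, hk]

theorem isILPOptimal_indicatorVector (S : Finset (Fin n ⊕ Fin m)) :
    I.IsILPOptimal D z (indicatorVector S) ↔ I.IsMaxClosure D z S := by
  rw [IsILPOptimal, IsMaxClosure, ilpFeasible_indicatorVector, objective_indicatorVector]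
  refine and_congr_right fun _ => ⟨fun h S' hS' => ?_, fun h u hu => ?_⟩
  · rw [← objective_indicatorVector]
    exact h _ ((ilpFeasible_indicatorVector S').2 hS')
  · rw [hu.eq_indicatorVector, objective_indicatorVector]
    rw [hu.eq_indicatorVector, ilpFeasible_indicatorVector] at hu
    exact h _ hu

theorem IsILPOptimal.isMaxPESet (h : I.IsSingleMindedWith D z) {u : Fin n ⊕ Fin m → ℝ}
    (hu : I.IsILPOptimal D z u) :
    I.IsMaxPESet (Finset.univ.filter fun j => u (Sum.inr j) = 1) ∧
      I.PE (Finset.univ.filter fun j => u (Sum.inr j) = 1) = I.objective z u := by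
  set S := Finset.univ.filter fun k => u k = 1 with hS
  have hp : projects S = Finset.univ.filter fun j => u (Sum.inr j) = 1 := by
    ext j
    simp [hS]
  have hobj : I.objective z u = ∑ k ∈ S, I.weight z k := by
    conv_lhs => rw [hu.1.eq_indicatorVector]
    exact objective_indicatorVector S
  rw [hu.1.eq_indicatorVector, ← hS, isILPOptimal_indicatorVector] at hu
  rw [hobj, ← hp]
  exact hu.isMaxPESet h

/-! ### Cuts -/

/-- The source side of the cut of a set of agents and projects. -/
abbrev sourceSide (S : Finset (Fin n ⊕ Fin m)) : Finset (Vertex n m) :=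
  insert source (S.image inner)

theorem inner_mem_sourceSide {S : Finset (Fin n ⊕ Fin m)} {k : Fin n ⊕ Fin m} :
    inner k ∈ sourceSide S ↔ k ∈ S := by
  simp

theorem source_mem_sourceSide (S : Finset (Fin n ⊕ Fin m)) : source ∈ sourceSide S := by
  simp

theorem sink_notMem_sourceSide (S : Finset (Fin n ⊕ Fin m)) : sink ∉ sourceSide S := by
  simp

/-- The agents and projects on the source side of a cut. -/
def innerPart (X : Finset (Vertex n m)) : Finset (Fin n ⊕ Fin m) :=
  Finset.univ.filter fun k => inner k ∈ X

theorem eq_sourceSide {X : Finset (Vertex n m)} (h₁ : source ∈ X) (h₂ : sink ∉ X) :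
    X = sourceSide (innerPart X) := by
  ext (⟨⟩ | k | ⟨⟩)
  · simpa using h₁
  · simp [innerPart]
  · simpa using h₂

/-- Sums over all pairs of vertices can be split along the sum type of vertices, unlike sums over
`X` and its complement. -/
theorem cutCapacity_eq_sum (X : Finset (Vertex n m)) :
    I.cutCapacity D z X = ∑ p, ∑ q, if p ∈ X ∧ q ∉ X then I.capacity D z p q else 0 := by
  have : ∀ p, (∑ q, if p ∈ X ∧ q ∉ X then I.capacity D z p q else 0) =
      if p ∈ X then ∑ q ∈ Xᶜ, I.capacity D z p q else 0 := by
    intro p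
    by_cases hp : p ∈ X
    · simp only [hp, true_and, if_true]
      rw [← Finset.sum_filter]
      congr 1
      ext q
      simp
    · simp [hp]
  simp only [this, cutCapacity, Finset.sum_ite_mem, Finset.univ_inter]

theorem cutCapacity_sourceSide (S : Finset (Fin n ⊕ Fin m)) :
    I.cutCapacity D z (sourceSide S) =
      ∑ i, (if Sum.inl i ∈ S then 0 else ENNReal.ofReal (min (I.b i) (z i))) +
      (∑ i, ∑ j, (if Sum.inl i ∈ S ∧ Sum.inr j ∉ S ∧ j ∈ D i then ⊤ else 0) +
        ∑ j ∈ projects S, ENNReal.ofReal (I.C j)) := by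
  rw [cutCapacity_eq_sum, Fintype.sum_sum_type]
  simp only [Fintype.sum_sum_type, Finset.univ_unique, Finset.sum_singleton, source_mem_sourceSide,
    inner_mem_sourceSide, sink_notMem_sourceSide, PUnit.default_eq_unit, capacity, ite_self,
    Finset.sum_const_zero, true_and, add_zero, zero_add, not_false_iff, and_true]
  congr 1
  · refine Finset.sum_congr rfl fun i _ => ?_
    by_cases hi : Sum.inl i ∈ S <;> simp [hi]
  · congr 1
    · refine Finset.sum_congr rfl fun i _ => Finset.sum_congr rfl fun j _ => ?_
      by_cases h₁ : Sum.inl i ∈ S <;> by_cases h₂ : Sum.inr j ∈ S <;> simp [h₁, h₂]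
    · rw [Finset.sum_filter]

/-- No infinite arc is cut, so the cut consists of the weights of the agents outside `S` and the
costs of the projects inside. -/
theorem cutCapacity_of_isClosure (h : I.IsSingleMindedWith D z) {S : Finset (Fin n ⊕ Fin m)}
    (hS : IsClosure D S) : I.cutCapacity D z (sourceSide S) =
      ENNReal.ofReal (∑ i, min (I.b i) (z i) - ∑ k ∈ S, I.weight z k) := by
  have h₀ : ∑ i, ∑ j, (if Sum.inl i ∈ S ∧ Sum.inr j ∉ S ∧ j ∈ D i then (⊤ : ENNReal) else 0) = 0 :=
    Finset.sum_eq_zero fun i _ => Finset.sum_eq_zero fun j _ =>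
      if_neg fun hij => hij.2.1 (hS i hij.1 j hij.2.2)
  have h₁ : ∀ i, (if Sum.inl i ∈ S then 0 else ENNReal.ofReal (min (I.b i) (z i))) =
      ENNReal.ofReal (min (I.b i) (z i) - if Sum.inl i ∈ S then min (I.b i) (z i) else 0) := by
    intro i
    split_ifs <;> simp
  have h₂ : ∑ i, min (I.b i) (z i) - ∑ k ∈ S, I.weight z k =
      ∑ i, (min (I.b i) (z i) - if Sum.inl i ∈ S then min (I.b i) (z i) else 0) +
        ∑ j ∈ projects S, I.C j := by
    rw [sum_weight, Finset.sum_sub_distrib]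
    ring
  have h₃ : ∀ i, 0 ≤ min (I.b i) (z i) - if Sum.inl i ∈ S then min (I.b i) (z i) else 0 := by
    intro i
    have := h.weight_nonneg i
    split_ifs <;> simp [this]
  rw [cutCapacity_sourceSide, h₀, zero_add, h₂, ENNReal.ofReal_add
    (Finset.sum_nonneg fun i _ => h₃ i) (Finset.sum_nonneg fun j _ => I.C_nonneg j),
    ENNReal.ofReal_sum_of_nonneg fun i _ => h₃ i,
    ENNReal.ofReal_sum_of_nonneg fun j _ => I.C_nonneg j]
  simp only [h₁]

theorem isClosure_of_cutCapacity_ne_top {S : Finset (Fin n ⊕ Fin m)}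
    (hS : I.cutCapacity D z (sourceSide S) ≠ ⊤) : IsClosure D S := by
  intro i hi j hj
  by_contra hj'
  refine hS (top_le_iff.1 ?_)
  rw [cutCapacity_sourceSide]
  refine le_trans ?_ (le_add_left (le_add_right (Finset.single_le_sum (fun _ _ => zero_le)
    (Finset.mem_univ i))))
  refine le_trans ?_ (Finset.single_le_sum (fun _ _ => zero_le) (Finset.mem_univ j))
  rw [if_pos ⟨hi, hj', hj⟩]

/-- Keeps the argument of `ENNReal.ofReal` in `cutCapacity_of_isClosure` non-negative, so that
nothing is truncated. -/
theorem sum_weight_le_total (h : I.IsSingleMindedWith D z) (S : Finset (Fin n ⊕ Fin m)) :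
    ∑ k ∈ S, I.weight z k ≤ ∑ i, min (I.b i) (z i) := by
  rw [sum_weight]
  have h₁ : ∑ i, (if Sum.inl i ∈ S then min (I.b i) (z i) else 0) ≤ ∑ i, min (I.b i) (z i) :=
    Finset.sum_le_sum fun i _ => by
      have := h.weight_nonneg i
      split_ifs
      · exact le_rfl
      · exact this
  have h₂ : 0 ≤ ∑ j ∈ projects S, I.C j := Finset.sum_nonneg fun j _ => I.C_nonneg j
  linarith

theorem isMinCut_sourceSide (h : I.IsSingleMindedWith D z) (S : Finset (Fin n ⊕ Fin m)) :
    I.IsMinCut D z (sourceSide S) ↔ I.IsMaxClosure D z S := by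
  constructor
  · rintro ⟨-, hmin⟩
    have hne : I.cutCapacity D z (sourceSide S) ≠ ⊤ := by
      -- The closure of the empty bundle witnesses that a finite cut exists.
      refine ne_top_of_le_ne_top ?_ (hmin _ (source_mem_sourceSide (bundleClosure D ∅))
        (sink_notMem_sourceSide _))
      rw [cutCapacity_of_isClosure h (isClosure_bundleClosure D ∅)]
      exact ENNReal.ofReal_ne_top
    have hS := isClosure_of_cutCapacity_ne_top hne
    refine ⟨hS, fun S' hS' => ?_⟩
    have := hmin _ (source_mem_sourceSide S') (sink_notMem_sourceSide S')
    rw [cutCapacity_of_isClosure h hS, cutCapacity_of_isClosure h hS',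
      ENNReal.ofReal_le_ofReal_iff (sub_nonneg.2 (sum_weight_le_total h S'))] at this
    linarith
  · rintro ⟨hS, hmax⟩
    refine ⟨⟨source_mem_sourceSide S, sink_notMem_sourceSide S⟩, fun X h₁ h₂ => ?_⟩
    by_cases htop : I.cutCapacity D z X = ⊤
    · rw [htop]
      exact le_top
    rw [eq_sourceSide h₁ h₂] at htop ⊢
    have hX := isClosure_of_cutCapacity_ne_top htop
    rw [cutCapacity_of_isClosure h hS, cutCapacity_of_isClosure h hX]
    exact ENNReal.ofReal_le_ofReal (sub_le_sub_left (hmax _ hX) _)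

theorem IsMinCut.isMaxPESet (h : I.IsSingleMindedWith D z) {X : Finset (Vertex n m)}
    (hX : I.IsMinCut D z X) :
    I.IsMaxPESet (Finset.univ.filter fun j => inner (Sum.inr j) ∈ X) ∧
      I.cutCapacity D z X ≠ ⊤ ∧
      I.PE (Finset.univ.filter fun j => inner (Sum.inr j) ∈ X) =
        ∑ i, min (I.b i) (z i) - (I.cutCapacity D z X).toReal := by
  have hp : (Finset.univ.filter fun j : Fin m => inner (Sum.inr j) ∈ X) =
      projects (innerPart X) := by
    ext j
    simp [innerPart]
  have hXS := eq_sourceSide hX.1.1 hX.1.2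
  rw [hp]
  generalize innerPart X = S at hXS
  subst hXS
  rw [isMinCut_sourceSide h] at hX
  obtain ⟨h₁, h₂⟩ := hX.isMaxPESet h
  rw [cutCapacity_of_isClosure h hX.1]
  refine ⟨h₁, ENNReal.ofReal_ne_top, ?_⟩
  rw [ENNReal.toReal_ofReal (sub_nonneg.2 (sum_weight_le_total h S)), h₂]
  ring

end PBInstance

namespace RAM

/-! ### Runs with a bound on the number of steps

As long as products stay below `2 ^ B`, bit lengths grow by at most one with every step, so that a
bound on the number of steps yields a bound on the logarithmic cost. -/

/-- All numbers stored in `s` have at most `K` bits. -/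
def State.Bounded (s : State) (K : ℕ) : Prop :=
  (∀ x, Nat.size (s.reg x) ≤ K) ∧ ∀ a i, Nat.size (s.arr a i) ≤ K

theorem State.Bounded.mono {s : State} {K K' : ℕ} (h : s.Bounded K) (hK : K ≤ K') :
    s.Bounded K' :=
  ⟨fun x => (h.1 x).trans hK, fun a i => (h.2 a i).trans hK⟩

theorem State.Bounded.setReg {s : State} {K x c : ℕ} (h : s.Bounded K) (hc : Nat.size c ≤ K) :
    (s.setReg x c).Bounded K := by
  refine ⟨fun y => ?_, h.2⟩
  by_cases hy : y = x
  · simpa [State.setReg, hy] using hc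
  · simpa [State.setReg, hy] using h.1 y

theorem State.Bounded.setArr {s : State} {K a i c : ℕ} (h : s.Bounded K) (hc : Nat.size c ≤ K) :
    (s.setArr a i c).Bounded K := by
  refine ⟨h.1, fun b j => ?_⟩
  by_cases hb : b = a
  · subst hb
    by_cases hj : j = i
    · simpa [State.setArr, hj] using hc
    · simpa [State.setArr, hj] using h.2 b j
  · simpa [State.setArr, hb] using h.2 b j

/-- `p` leads from `s` to `s'` in at most `k` steps, provided that products with at most `B` bits
are accounted as one step. -/
def Runs (B : ℕ) (p : Prog) (s : State) (k : ℕ) (s' : State) : Prop :=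
  ∃ t, Exec p s t s' ∧
    ∀ K, B ≤ K → s.Bounded K → s'.Bounded (K + k) ∧ t ≤ k * (1 + 2 * (K + k))

theorem size_add_le {a b K : ℕ} (ha : Nat.size a ≤ K) (hb : Nat.size b ≤ K) :
    Nat.size (a + b) ≤ K + 1 := by
  rw [Nat.size_le] at *
  rw [pow_succ]
  omega

theorem size_le_self (c : ℕ) : Nat.size c ≤ c :=
  Nat.size_le.2 Nat.lt_two_pow_self

section Runs

variable {B : ℕ}

theorem Runs.skip (s : State) : Runs B .skip s 1 s :=
  ⟨1, .skip s, fun K _ h => ⟨h.mono (by omega), by omega⟩⟩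

/-- A constant may be longer than all stored numbers, so it is charged `c + 1` steps, which covers
its bit length. Constants are fixed in the program and do not affect polynomiality. -/
theorem Runs.const (s : State) (x c : ℕ) : Runs B (.const x c) s (c + 1) (s.setReg x c) := by
  refine ⟨_, .const s x c, fun K _ h => ⟨(h.mono (by omega)).setReg ?_, ?_⟩⟩
  · have := size_le_self c
    omega
  · have := size_le_self c
    nlinarith

theorem Runs.copy (s : State) (x y : ℕ) : Runs B (.copy x y) s 1 (s.setReg x (s.reg y)) := by
  refine ⟨_, .copy s x y, fun K _ h => ⟨(h.mono (by omega)).setReg ?_, ?_⟩⟩ <;>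
  · have := h.1 y
    omega

theorem Runs.load (s : State) (x a y : ℕ) :
    Runs B (.load x a y) s 1 (s.setReg x (s.arr a (s.reg y))) := by
  refine ⟨_, .load s x a y, fun K _ h => ⟨(h.mono (by omega)).setReg ?_, ?_⟩⟩ <;>
  · have := h.1 y
    have := h.2 a (s.reg y)
    omega

theorem Runs.store (s : State) (a y x : ℕ) :
    Runs B (.store a y x) s 1 (s.setArr a (s.reg y) (s.reg x)) := by
  refine ⟨_, .store s a y x, fun K _ h => ⟨(h.mono (by omega)).setArr ?_, ?_⟩⟩ <;>
  · have := h.1 y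
    have := h.1 x
    omega

theorem Runs.arith (s : State) (o : Op) (x y w : ℕ)
    (ho : o = .mul → Nat.size (s.reg y * s.reg w) ≤ B) :
    Runs B (.arith o x y w) s 1 (s.setReg x (o.eval (s.reg y) (s.reg w))) := by
  refine ⟨_, .arith s o x y w, fun K hK h => ⟨(h.mono (by omega)).setReg ?_, ?_⟩⟩
  · have hy := h.1 y
    have hw := h.1 w
    cases o with
    | add => exact size_add_le hy hw
    | sub => exact (Nat.size_le_size (Nat.sub_le _ _)).trans (hy.trans (Nat.le_succ K))
    | mul => exact (ho rfl).trans (hK.trans (Nat.le_succ K))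
  · have := h.1 y
    have := h.1 w
    omega

theorem Runs.seq {p q : Prog} {s₁ s₂ s₃ : State} {k₁ k₂ : ℕ} (h₁ : Runs B p s₁ k₁ s₂)
    (h₂ : Runs B q s₂ k₂ s₃) : Runs B (.seq p q) s₁ (k₁ + k₂) s₃ := by
  obtain ⟨t₁, e₁, b₁⟩ := h₁
  obtain ⟨t₂, e₂, b₂⟩ := h₂
  refine ⟨_, .seq e₁ e₂, fun K hK h => ?_⟩
  obtain ⟨h₂, c₁⟩ := b₁ K hK h
  obtain ⟨h₃, c₂⟩ := b₂ (K + k₁) (by omega) h₂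
  refine ⟨by rwa [← add_assoc], ?_⟩
  -- The cost bound `k * (1 + 2 * (K + k))` is superadditive along a sequence; the slack is `2 * k₁
  -- * k₂`.
  nlinarith [Nat.zero_le (k₁ * k₂)]

theorem Runs.cond_true {x : ℕ} {p q : Prog} {s s' : State} {k : ℕ} (hx : s.reg x ≠ 0)
    (h : Runs B p s k s') : Runs B (.cond x p q) s (k + 1) s' := by
  obtain ⟨t, e, b⟩ := h
  refine ⟨_, .cond_true hx e, fun K hK h => ?_⟩
  obtain ⟨h', c⟩ := b K hK h
  have := h.1 x
  exact ⟨h'.mono (by omega), by nlinarith⟩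

theorem Runs.cond_false {x : ℕ} {p q : Prog} {s s' : State} {k : ℕ} (hx : s.reg x = 0)
    (h : Runs B q s k s') : Runs B (.cond x p q) s (k + 1) s' := by
  obtain ⟨t, e, b⟩ := h
  refine ⟨_, .cond_false hx e, fun K hK h => ?_⟩
  obtain ⟨h', c⟩ := b K hK h
  exact ⟨h'.mono (by omega), by nlinarith⟩

end Runs

/-! ### Expressions -/

/-- Arithmetic expressions over registers and arrays. -/
inductive Expr where
  | var (x : ℕ) : Expr
  | const (c : ℕ) : Expr
  | op (o : Op) (e₁ e₂ : Expr) : Expr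
  | load (a : ℕ) (e : Expr) : Expr

namespace Expr

instance : Add Expr := ⟨op .add⟩
instance : Sub Expr := ⟨op .sub⟩
instance : Mul Expr := ⟨op .mul⟩
instance (c : ℕ) : OfNat Expr c := ⟨const c⟩

/-- The value of an expression. -/
def eval (s : State) : Expr → ℕ
  | var x => s.reg x
  | const c => c
  | op o e₁ e₂ => o.eval (e₁.eval s) (e₂.eval s)
  | load a e => s.arr a (e.eval s)

/-- All products that occur in the evaluation have at most `B` bits. -/
def Ok (B : ℕ) (s : State) : Expr → Prop
  | var _ => True
  | const _ => True
  | op .mul e₁ e₂ => e₁.Ok B s ∧ e₂.Ok B s ∧ Nat.size (e₁.eval s * e₂.eval s) ≤ B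
  | op _ e₁ e₂ => e₁.Ok B s ∧ e₂.Ok B s
  | load _ e => e.Ok B s

/-- The number of steps of the evaluation. -/
def steps : Expr → ℕ
  | var _ => 1
  | const c => c + 1
  | op _ e₁ e₂ => e₁.steps + e₂.steps + 1
  | load _ e => e.steps + 1

/-- Only registers below `T` occur. -/
def Below (T : ℕ) : Expr → Prop
  | var x => x < T
  | const _ => True
  | op _ e₁ e₂ => e₁.Below T ∧ e₂.Below T
  | load _ e => e.Below T

/-- The program that evaluates an expression into register `t`, using the registers above `t`. -/
def compile : Expr → ℕ → Prog
  | var x, t => .copy t x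
  | const c, t => .const t c
  | op o e₁ e₂, t => .seq (e₁.compile t) (.seq (e₂.compile (t + 1)) (.arith o t t (t + 1)))
  | load a e, t => .seq (e.compile t) (.load t a t)

variable {B T : ℕ}

theorem Below.mono {T' : ℕ} (hT : T ≤ T') : ∀ {e : Expr}, e.Below T → e.Below T'
  | .var _, h => Nat.lt_of_lt_of_le h hT
  | .const _, _ => trivial
  | .op _ _ _, h => ⟨Below.mono hT h.1, Below.mono hT h.2⟩
  | .load _ e, h => Below.mono (e := e) hT h

theorem eval_congr {s σ : State} (hr : ∀ x < T, s.reg x = σ.reg x) (ha : s.arr = σ.arr) :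
    ∀ e : Expr, e.Below T → e.eval s = e.eval σ
  | var x, h => hr x h
  | const _, _ => rfl
  | op o e₁ e₂, h => by
    simp only [eval, eval_congr hr ha e₁ h.1, eval_congr hr ha e₂ h.2]
  | load a e, h => by simp only [eval, eval_congr hr ha e h, ha]

theorem ok_congr {s σ : State} (hr : ∀ x < T, s.reg x = σ.reg x) (ha : s.arr = σ.arr) :
    ∀ e : Expr, e.Below T → e.Ok B s → e.Ok B σ
  | var x, _, _ => trivial
  | const _, _, _ => trivial
  | op .mul e₁ e₂, h, hk => by
    refine ⟨ok_congr hr ha e₁ h.1 hk.1, ok_congr hr ha e₂ h.2 hk.2.1, ?_⟩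
    rw [← eval_congr hr ha e₁ h.1, ← eval_congr hr ha e₂ h.2]
    exact hk.2.2
  | op .add e₁ e₂, h, hk => ⟨ok_congr hr ha e₁ h.1 hk.1, ok_congr hr ha e₂ h.2 hk.2⟩
  | op .sub e₁ e₂, h, hk => ⟨ok_congr hr ha e₁ h.1 hk.1, ok_congr hr ha e₂ h.2 hk.2⟩
  | load _ e, h, hk => ok_congr hr ha e h hk

theorem ok_op {s : State} {o : Op} {e₁ e₂ : Expr} (h : (op o e₁ e₂).Ok B s) :
    e₁.Ok B s ∧ e₂.Ok B s ∧ (o = .mul → Nat.size (e₁.eval s * e₂.eval s) ≤ B) := by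
  cases o with
  | mul => exact ⟨h.1, h.2.1, fun _ => h.2.2⟩
  | add => exact ⟨h.1, h.2, nofun⟩
  | sub => exact ⟨h.1, h.2, nofun⟩

/-- Registers from `t` on serve as an evaluation stack: the first operand in `t` survives because
the second one is evaluated from `t + 1` on. -/
theorem compile_runs (e : Expr) : ∀ (t : ℕ) (s : State), e.Below t → e.Ok B s →
    ∃ s', Runs B (e.compile t) s e.steps s' ∧ s'.reg t = e.eval s ∧
      (∀ x < t, s'.reg x = s.reg x) ∧ s'.arr = s.arr := by
  induction e with
  | var x =>
    exact fun t s _ _ => ⟨_, .copy s t x, by simp [State.setReg, eval],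
      fun y hy => by simp [State.setReg, hy.ne], rfl⟩
  | const c =>
    exact fun t s _ _ => ⟨_, .const s t c, by simp [State.setReg, eval],
      fun y hy => by simp [State.setReg, hy.ne], rfl⟩
  | op o e₁ e₂ ih₁ ih₂ =>
    intro t s hb hk
    obtain ⟨hk₁, hk₂, hm⟩ := ok_op hk
    obtain ⟨s₁, r₁, v₁, f₁, a₁⟩ := ih₁ t s hb.1 hk₁
    have c₁ : ∀ x < t, s.reg x = s₁.reg x := fun x hx => (f₁ x hx).symm
    obtain ⟨s₂, r₂, v₂, f₂, a₂⟩ := ih₂ (t + 1) s₁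
      (hb.2.mono (Nat.le_succ t)) (ok_congr c₁ a₁.symm e₂ hb.2 hk₂)
    have w₁ : s₂.reg t = e₁.eval s := (f₂ t (Nat.lt_succ_self t)).trans v₁
    have w₂ : s₂.reg (t + 1) = e₂.eval s := v₂.trans (eval_congr c₁ a₁.symm e₂ hb.2).symm
    refine ⟨s₂.setReg t (o.eval (s₂.reg t) (s₂.reg (t + 1))), ?_, ?_, ?_, ?_⟩
    · have r₃ := Runs.arith (B := B) s₂ o t t (t + 1) (by rw [w₁, w₂]; exact hm)
      have := r₁.seq (r₂.seq r₃)
      rwa [← add_assoc] at this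
    · simp [State.setReg, eval, w₁, w₂]
    · intro x hx
      simp [State.setReg, hx.ne, f₂ x (Nat.lt_succ_of_lt hx), f₁ x hx]
    · simp [State.setReg, a₂, a₁]
  | load a e ih =>
    intro t s hb hk
    obtain ⟨s₁, r₁, v₁, f₁, a₁⟩ := ih t s hb hk
    refine ⟨_, r₁.seq (.load s₁ t a t), ?_, ?_, ?_⟩
    · simp [State.setReg, eval, v₁, a₁]
    · intro x hx
      simp [State.setReg, hx.ne, f₁ x hx]
    · simp [State.setReg, a₁]

end Expr

/-! ### Structured programs -/

/-- Structured programs over expressions. -/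
inductive Stmt where
  | skip : Stmt
  | assign (x : ℕ) (e : Expr) : Stmt
  | store (a : ℕ) (e₁ e₂ : Expr) : Stmt
  | seq (c₁ c₂ : Stmt) : Stmt
  | ite (e : Expr) (c₁ c₂ : Stmt) : Stmt
  | whileLoop (e : Expr) (c : Stmt) : Stmt

namespace Stmt

/-- Only registers below `T` occur. -/
def Below (T : ℕ) : Stmt → Prop
  | skip => True
  | assign x e => x < T ∧ e.Below T
  | store _ e₁ e₂ => e₁.Below T ∧ e₂.Below T
  | seq c₁ c₂ => c₁.Below T ∧ c₂.Below T
  | ite e c₁ c₂ => e.Below T ∧ c₁.Below T ∧ c₂.Below T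
  | whileLoop e c => e.Below T ∧ c.Below T

/-- The program for a structured program; the registers from `T` on hold intermediate results. -/
def compile (T : ℕ) : Stmt → Prog
  | skip => .skip
  | assign x e => .seq (e.compile T) (.copy x T)
  | store a e₁ e₂ => .seq (e₁.compile T) (.seq (e₂.compile (T + 1)) (.store a T (T + 1)))
  | seq c₁ c₂ => .seq (c₁.compile T) (c₂.compile T)
  | ite e c₁ c₂ => .seq (e.compile T) (.cond T (c₁.compile T) (c₂.compile T))
  | whileLoop e c => .seq (e.compile T) (.loop T (.seq (c.compile T) (e.compile T)))

end Stmt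

/-- Execution of structured programs in a given number of steps. -/
inductive SExec (B : ℕ) : Stmt → State → ℕ → State → Prop where
  | skip (s : State) : SExec B .skip s 1 s
  | assign {s : State} {x : ℕ} {e : Expr} :
      e.Ok B s → SExec B (.assign x e) s (e.steps + 1) (s.setReg x (e.eval s))
  | store {s : State} {a : ℕ} {e₁ e₂ : Expr} : e₁.Ok B s → e₂.Ok B s →
      SExec B (.store a e₁ e₂) s (e₁.steps + (e₂.steps + 1)) (s.setArr a (e₁.eval s) (e₂.eval s))
  | seq {c₁ c₂ : Stmt} {s₁ s₂ s₃ : State} {k₁ k₂ : ℕ} :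
      SExec B c₁ s₁ k₁ s₂ → SExec B c₂ s₂ k₂ s₃ → SExec B (.seq c₁ c₂) s₁ (k₁ + k₂) s₃
  | ite_true {e : Expr} {c₁ c₂ : Stmt} {s s' : State} {k : ℕ} :
      e.Ok B s → e.eval s ≠ 0 → SExec B c₁ s k s' →
        SExec B (.ite e c₁ c₂) s (e.steps + (k + 1)) s'
  | ite_false {e : Expr} {c₁ c₂ : Stmt} {s s' : State} {k : ℕ} :
      e.Ok B s → e.eval s = 0 → SExec B c₂ s k s' →
        SExec B (.ite e c₁ c₂) s (e.steps + (k + 1)) s'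
  | while_true {e : Expr} {c : Stmt} {s₁ s₂ s₃ : State} {k₁ k₂ : ℕ} :
      e.Ok B s₁ → e.eval s₁ ≠ 0 → SExec B c s₁ k₁ s₂ → SExec B (.whileLoop e c) s₂ k₂ s₃ →
        SExec B (.whileLoop e c) s₁ (e.steps + (1 + k₁ + k₂)) s₃
  | while_false {e : Expr} {c : Stmt} {s : State} :
      e.Ok B s → e.eval s = 0 → SExec B (.whileLoop e c) s (e.steps + 1) s

/-- The states agree on the registers below `T` and on the arrays. -/
def State.Agree (T : ℕ) (s σ : State) : Prop :=
  (∀ x < T, s.reg x = σ.reg x) ∧ s.arr = σ.arr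

theorem Expr.compile_agree {B T : ℕ} {e : Expr} {s σ : State} (hb : e.Below T) (hk : e.Ok B s)
    (h : s.Agree T σ) : ∃ σ', Runs B (e.compile T) σ e.steps σ' ∧ σ'.reg T = e.eval s ∧
      s.Agree T σ' := by
  obtain ⟨σ', r, v, f, a⟩ := e.compile_runs T σ hb (e.ok_congr h.1 h.2 hb hk)
  refine ⟨σ', r, v.trans (e.eval_congr h.1 h.2 hb).symm, fun x hx => ?_, h.2.trans a.symm⟩
  rw [h.1 x hx, f x hx]

/-- Correctness of the compiler. The machine's scratch registers from `T` on drift away from the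
abstract state, so only agreement below `T` is maintained. -/
theorem SExec.runs {B T : ℕ} {c : Stmt} {s s' : State} {k : ℕ} (h : SExec B c s k s') :
    ∀ σ, c.Below T → s.Agree T σ → ∃ σ', Runs B (c.compile T) σ k σ' ∧ s'.Agree T σ' := by
  induction h with
  | skip s => exact fun σ _ h => ⟨σ, .skip σ, h⟩
  | @assign s x e hk =>
    intro σ hb h
    obtain ⟨σ', r, v, h'⟩ := Expr.compile_agree hb.2 hk h
    refine ⟨_, r.seq (.copy σ' x T), fun y hy => ?_, h'.2⟩
    by_cases hxy : y = x <;> simp [State.setReg, hxy, v, h'.1 y hy]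
  | @store s a e₁ e₂ hk₁ hk₂ =>
    intro σ hb h
    obtain ⟨σ₁, r₁, v₁, h₁⟩ := Expr.compile_agree hb.1 hk₁ h
    obtain ⟨σ₂, r₂, v₂, f₂, a₂⟩ := e₂.compile_runs (B := B) (T + 1) σ₁
      (hb.2.mono (Nat.le_succ T)) (e₂.ok_congr h₁.1 h₁.2 hb.2 hk₂)
    have w₁ := (f₂ T (Nat.lt_succ_self T)).trans v₁
    have w₂ := v₂.trans (e₂.eval_congr h₁.1 h₁.2 hb.2).symm
    refine ⟨_, r₁.seq (r₂.seq (.store σ₂ a T (T + 1))), fun y hy => ?_, ?_⟩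
    · simp [State.setArr, f₂ y (Nat.lt_succ_of_lt hy), h₁.1 y hy]
    · simp [State.setArr, w₁, w₂, a₂, h₁.2]
  | seq _ _ ih₁ ih₂ =>
    intro σ hb h
    obtain ⟨σ₁, r₁, h₁⟩ := ih₁ σ hb.1 h
    obtain ⟨σ₂, r₂, h₂⟩ := ih₂ σ₁ hb.2 h₁
    exact ⟨σ₂, r₁.seq r₂, h₂⟩
  | ite_true hk hv _ ih =>
    intro σ hb h
    obtain ⟨σ₁, r₁, v₁, h₁⟩ := Expr.compile_agree hb.1 hk h
    obtain ⟨σ₂, r₂, h₂⟩ := ih σ₁ hb.2.1 h₁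
    exact ⟨σ₂, r₁.seq (r₂.cond_true (by rwa [v₁])), h₂⟩
  | ite_false hk hv _ ih =>
    intro σ hb h
    obtain ⟨σ₁, r₁, v₁, h₁⟩ := Expr.compile_agree hb.1 hk h
    obtain ⟨σ₂, r₂, h₂⟩ := ih σ₁ hb.2.2 h₁
    exact ⟨σ₂, r₁.seq (r₂.cond_false (by rwa [v₁])), h₂⟩
  | @while_true e c s₁ s₂ s₃ k₁ k₂ hk hv _ _ ih₁ ih₂ =>
    intro σ hb h
    obtain ⟨σ₁, r₁, v₁, h₁⟩ := Expr.compile_agree hb.1 hk h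
    obtain ⟨σ₂, r₂, h₂⟩ := ih₁ σ₁ hb.2 h₁
    obtain ⟨σ₃, ⟨t, ex, bd⟩, h₃⟩ := ih₂ σ₂ hb h₂
    refine ⟨σ₃, r₁.seq ?_, h₃⟩
    obtain ⟨t₂, ex₂, bd₂⟩ := r₂
    -- The run of the remaining loop begins by evaluating the guard. In the compiled loop this
    -- evaluation is the end of the body, so it is split off and attached to the round just
    -- finished.
    cases ex with
    | @seq _ _ _ σ' _ u₁ u₂ x₁ x₂ =>
      refine ⟨_, .loop_true (by rwa [v₁]) (.seq ex₂ x₁) x₂, fun K hK hs => ?_⟩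
      obtain ⟨hs₂, l₂⟩ := bd₂ K hK hs
      obtain ⟨hs₃, l₃⟩ := bd (K + k₁) (by omega) hs₂
      refine ⟨hs₃.mono (by omega), ?_⟩
      have := hs.1 T
      nlinarith [Nat.zero_le (k₁ * k₂)]
  | while_false hk hv =>
    intro σ hb h
    obtain ⟨σ₁, r₁, v₁, h₁⟩ := Expr.compile_agree hb.1 hk h
    refine ⟨σ₁, r₁.seq ⟨1, .loop_false (by rwa [v₁]), fun K _ hs => ⟨hs.mono (by omega), ?_⟩⟩, h₁⟩
    omega

/-! ### Total correctness -/

/-- Started in `s`, the program `c` terminates within `k` steps in a state that satisfies `Q`. -/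
def Achieves (B : ℕ) (c : Stmt) (s : State) (k : ℕ) (Q : State → Prop) : Prop :=
  ∃ k' ≤ k, ∃ s', SExec B c s k' s' ∧ Q s'

namespace Stmt

/-- The weakest precondition of a program without loops. -/
def wp (B : ℕ) : Stmt → (State → Prop) → State → Prop
  | skip, Q, s => Q s
  | assign x e, Q, s => e.Ok B s ∧ Q (s.setReg x (e.eval s))
  | store a e₁ e₂, Q, s => e₁.Ok B s ∧ e₂.Ok B s ∧ Q (s.setArr a (e₁.eval s) (e₂.eval s))
  | seq c₁ c₂, Q, s => c₁.wp B (c₂.wp B Q) s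
  | ite e c₁ c₂, Q, s => e.Ok B s ∧ (e.eval s ≠ 0 → c₁.wp B Q s) ∧ (e.eval s = 0 → c₂.wp B Q s)
  | whileLoop _ _, _, _ => False

/-- A bound on the number of steps of a program without loops. -/
def steps : Stmt → ℕ
  | skip => 1
  | assign _ e => e.steps + 1
  | store _ e₁ e₂ => e₁.steps + (e₂.steps + 1)
  | seq c₁ c₂ => c₁.steps + c₂.steps
  | ite e c₁ c₂ => e.steps + (c₁.steps + c₂.steps + 1)
  | whileLoop e c => e.steps + c.steps

/-- The program may change register `x`. -/
def WritesReg (x : ℕ) : Stmt → Prop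
  | assign y _ => x = y
  | seq c₁ c₂ => c₁.WritesReg x ∨ c₂.WritesReg x
  | ite _ c₁ c₂ => c₁.WritesReg x ∨ c₂.WritesReg x
  | whileLoop _ c => c.WritesReg x
  | _ => False

/-- The program may change array `a`. -/
def WritesArr (a : ℕ) : Stmt → Prop
  | store b _ _ => a = b
  | seq c₁ c₂ => c₁.WritesArr a ∨ c₂.WritesArr a
  | ite _ c₁ c₂ => c₁.WritesArr a ∨ c₂.WritesArr a
  | whileLoop _ c => c.WritesArr a
  | _ => False

/-- Run `c` with register `i` running from `lo` to `hi - 1`. -/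
def forLoop (i : ℕ) (lo hi : Expr) (c : Stmt) : Stmt :=
  seq (assign i lo) (.whileLoop (hi - .var i) (seq c (assign i (.var i + 1))))

/-- `s'` differs from `s` only in places that `c` may change. -/
def Frame (c : Stmt) (s s' : State) : Prop :=
  (∀ x, ¬ c.WritesReg x → s'.reg x = s.reg x) ∧ ∀ a, ¬ c.WritesArr a → s'.arr a = s.arr a

end Stmt

variable {B : ℕ}

/-- Spares loop invariants from recording the registers and arrays that a program does not mention
as targets. -/
theorem SExec.frame {c : Stmt} {s s' : State} {k : ℕ} (h : SExec B c s k s') : c.Frame s s' := by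
  induction h with
  | skip s => exact ⟨fun _ _ => rfl, fun _ _ => rfl⟩
  | @assign s x e _ =>
    refine ⟨fun y hy => ?_, fun _ _ => rfl⟩
    have : y ≠ x := hy
    simp [State.setReg, this]
  | @store s a e₁ e₂ _ _ =>
    refine ⟨fun _ _ => rfl, fun b hb => ?_⟩
    have : b ≠ a := hb
    simp [State.setArr, this]
  | seq _ _ ih₁ ih₂ =>
    exact ⟨fun x hx => (ih₂.1 x fun h => hx (.inr h)).trans (ih₁.1 x fun h => hx (.inl h)),
      fun x hx => (ih₂.2 x fun h => hx (.inr h)).trans (ih₁.2 x fun h => hx (.inl h))⟩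
  | ite_true _ _ _ ih => exact ⟨fun x hx => ih.1 x fun h => hx (.inl h),
      fun x hx => ih.2 x fun h => hx (.inl h)⟩
  | ite_false _ _ _ ih => exact ⟨fun x hx => ih.1 x fun h => hx (.inr h),
      fun x hx => ih.2 x fun h => hx (.inr h)⟩
  | while_true _ _ _ _ ih₁ ih₂ => exact ⟨fun x hx => (ih₂.1 x hx).trans (ih₁.1 x hx),
      fun x hx => (ih₂.2 x hx).trans (ih₁.2 x hx)⟩
  | while_false _ _ => exact ⟨fun _ _ => rfl, fun _ _ => rfl⟩

theorem Stmt.Frame.trans {c : Stmt} {s₁ s₂ s₃ : State} (h₁ : c.Frame s₁ s₂) (h₂ : c.Frame s₂ s₃) :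
    c.Frame s₁ s₃ :=
  ⟨fun x hx => (h₂.1 x hx).trans (h₁.1 x hx), fun x hx => (h₂.2 x hx).trans (h₁.2 x hx)⟩

theorem Achieves.mono {c : Stmt} {s : State} {k k' : ℕ} {Q Q' : State → Prop}
    (h : Achieves B c s k Q) (hk : k ≤ k') (hQ : ∀ s', c.Frame s s' → Q s' → Q' s') :
    Achieves B c s k' Q' := by
  obtain ⟨l, hl, s', e, q⟩ := h
  exact ⟨l, hl.trans hk, s', e, hQ s' e.frame q⟩

theorem Achieves.seq {c₁ c₂ : Stmt} {s : State} {k₁ k₂ : ℕ} {P Q : State → Prop}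
    (h₁ : Achieves B c₁ s k₁ P) (h₂ : ∀ s', c₁.Frame s s' → P s' → Achieves B c₂ s' k₂ Q) :
    Achieves B (.seq c₁ c₂) s (k₁ + k₂) Q := by
  obtain ⟨l₁, hl₁, s₁, e₁, p⟩ := h₁
  obtain ⟨l₂, hl₂, s₂, e₂, q⟩ := h₂ s₁ e₁.frame p
  exact ⟨_, Nat.add_le_add hl₁ hl₂, s₂, e₁.seq e₂, q⟩

theorem Achieves.ite {e : Expr} {c₁ c₂ : Stmt} {s : State} {k : ℕ} {Q : State → Prop}
    (he : e.Ok B s) (h₁ : e.eval s ≠ 0 → Achieves B c₁ s k Q)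
    (h₂ : e.eval s = 0 → Achieves B c₂ s k Q) :
    Achieves B (.ite e c₁ c₂) s (e.steps + (k + 1)) Q := by
  by_cases hv : e.eval s = 0
  · obtain ⟨l, hl, s', ex, q⟩ := h₂ hv
    exact ⟨_, by omega, s', .ite_false he hv ex, q⟩
  · obtain ⟨l, hl, s', ex, q⟩ := h₁ hv
    exact ⟨_, by omega, s', .ite_true he hv ex, q⟩

/-- `Stmt.steps` adds up both branches of a conditional, so the bound does not depend on the branch
taken. -/
theorem Achieves.of_wp {c : Stmt} : ∀ {s : State} {Q : State → Prop}, c.wp B Q s →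
    Achieves B c s c.steps Q := by
  induction c with
  | skip => exact fun h => ⟨_, le_rfl, _, .skip _, h⟩
  | assign x e => exact fun h => ⟨_, le_rfl, _, .assign h.1, h.2⟩
  | store a e₁ e₂ => exact fun h => ⟨_, le_rfl, _, .store h.1 h.2.1, h.2.2⟩
  | seq c₁ c₂ ih₁ ih₂ => exact fun h => (ih₁ h).seq fun s' _ h' => ih₂ h'
  | ite e c₁ c₂ ih₁ ih₂ =>
    exact fun h => Achieves.ite h.1
      (fun hv => (ih₁ (h.2.1 hv)).mono (Nat.le_add_right _ _) fun _ _ q => q)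
      (fun hv => (ih₂ (h.2.2 hv)).mono (Nat.le_add_left _ _) fun _ _ q => q)
  | whileLoop e c => exact fun h => h.elim

/-- The variant `μ` proves termination and at the same time bounds the number of rounds. -/
theorem Achieves.whileLoop {e : Expr} {c : Stmt} (I : State → Prop) (μ : State → ℕ) (k : ℕ)
    (he : ∀ s, I s → e.Ok B s)
    (hc : ∀ s, I s → e.eval s ≠ 0 → Achieves B c s k fun s' => I s' ∧ μ s' < μ s)
    {s : State} (hs : I s) :
    Achieves B (.whileLoop e c) s (μ s * (e.steps + k + 1) + (e.steps + 1))
      fun s' => I s' ∧ e.eval s' = 0 := by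
  induction hn : μ s using Nat.strong_induction_on generalizing s with
  | _ n ih =>
    by_cases hv : e.eval s = 0
    · exact ⟨_, Nat.le_add_left _ _, s, .while_false (he s hs) hv, hs, hv⟩
    · obtain ⟨l, hl, s₁, e₁, h₁, hμ⟩ := hc s hs hv
      obtain ⟨l₂, hl₂, s₂, e₂, h₂⟩ := ih (μ s₁) (hn ▸ hμ) h₁ rfl
      refine ⟨_, ?_, s₂, .while_true (he s hs) hv e₁ e₂, h₂⟩
      have : (μ s₁ + 1) * (e.steps + k + 1) ≤ n * (e.steps + k + 1) :=
        Nat.mul_le_mul_right _ (by omega)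
      rw [add_mul, one_mul] at this
      omega

@[simp] theorem State.setReg_arr (s : State) (x c : ℕ) : (s.setReg x c).arr = s.arr := rfl

@[simp] theorem State.setArr_reg (s : State) (a i c : ℕ) : (s.setArr a i c).reg = s.reg := rfl

theorem State.setArr_arr (s : State) (a i c b : ℕ) :
    (s.setArr a i c).arr b = if b = a then Function.update (s.arr b) i c else s.arr b := by
  by_cases h : b = a
  · subst h
    simp [State.setArr]
  · simp [State.setArr, h]

@[simp] theorem State.setReg_reg_self (s : State) (x c : ℕ) : (s.setReg x c).reg x = c := by
  simp [State.setReg]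

@[simp] theorem State.setReg_reg_ne (s : State) {x y : ℕ} (c : ℕ) (h : y ≠ x) :
    (s.setReg x c).reg y = s.reg y := by
  simp [State.setReg, h]

@[simp] theorem State.setArr_arr_self (s : State) (a i c : ℕ) :
    (s.setArr a i c).arr a = Function.update (s.arr a) i c := by
  simp [State.setArr]

@[simp] theorem State.setArr_arr_ne (s : State) {a b : ℕ} (i c : ℕ) (h : b ≠ a) :
    (s.setArr a i c).arr b = s.arr b := by
  simp [State.setArr, h]

namespace Expr

variable {s : State}

@[simp] theorem eval_var (x : ℕ) : (var x).eval s = s.reg x := rfl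
@[simp] theorem eval_ofNat (c : ℕ) : (ofNat(c) : Expr).eval s = c := rfl
@[simp] theorem eval_add (e₁ e₂ : Expr) : (e₁ + e₂).eval s = e₁.eval s + e₂.eval s := rfl
@[simp] theorem eval_sub (e₁ e₂ : Expr) : (e₁ - e₂).eval s = e₁.eval s - e₂.eval s := rfl
@[simp] theorem eval_mul (e₁ e₂ : Expr) : (e₁ * e₂).eval s = e₁.eval s * e₂.eval s := rfl
@[simp] theorem eval_load (a : ℕ) (e : Expr) : (load a e).eval s = s.arr a (e.eval s) := rfl
@[simp] theorem ok_var (x : ℕ) : (var x).Ok B s ↔ True := Iff.rfl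
@[simp] theorem ok_ofNat (c : ℕ) : (ofNat(c) : Expr).Ok B s ↔ True := Iff.rfl
@[simp] theorem ok_add (e₁ e₂ : Expr) : (e₁ + e₂).Ok B s ↔ e₁.Ok B s ∧ e₂.Ok B s := Iff.rfl
@[simp] theorem ok_sub (e₁ e₂ : Expr) : (e₁ - e₂).Ok B s ↔ e₁.Ok B s ∧ e₂.Ok B s := Iff.rfl
@[simp] theorem ok_mul (e₁ e₂ : Expr) : (e₁ * e₂).Ok B s ↔
    e₁.Ok B s ∧ e₂.Ok B s ∧ Nat.size (e₁.eval s * e₂.eval s) ≤ B := Iff.rfl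
@[simp] theorem ok_load (a : ℕ) (e : Expr) : (load a e).Ok B s ↔ e.Ok B s := Iff.rfl

end Expr

/-- A bound on the number of steps of a `for` loop with `l` rounds of at most `k` steps each. -/
def loopSteps (lo hi : Expr) (l k : ℕ) : ℕ :=
  lo.steps + 1 + (l * (hi.steps + k + 8) + (hi.steps + 3))

/-- The rule for `for` loops: `I t` holds whenever the loop variable has been set to `t`. -/
theorem Achieves.forLoop {i : ℕ} {lo hi : Expr} {c : Stmt} (I : ℕ → State → Prop) (k : ℕ)
    {s : State} {a b : ℕ} (hlo : lo.Ok B s) (ha : lo.eval s = a) (hab : a ≤ b)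
    (h₀ : I a (s.setReg i a))
    (hhi : ∀ t s', (Stmt.forLoop i lo hi c).Frame s s' → s'.reg i = t → I t s' →
      hi.Ok B s' ∧ hi.eval s' = b)
    (hc : ∀ t s', (Stmt.forLoop i lo hi c).Frame s s' → a ≤ t → t < b → s'.reg i = t → I t s' →
      Achieves B c s' k fun s'' => s''.reg i = t ∧ I (t + 1) (s''.setReg i (t + 1))) :
    Achieves B (.forLoop i lo hi c) s (loopSteps lo hi (b - a) k)
      fun s' => s'.reg i = b ∧ I b s' := by
  set F := (Stmt.forLoop i lo hi c).Frame s with hF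
  have hset : F (s.setReg i a) := by
    refine ⟨fun x hx => ?_, fun _ _ => rfl⟩
    have : x ≠ i := fun h => hx (.inl h)
    simp [this]
  refine Achieves.seq (P := fun s' => s' = s.setReg i a)
    ⟨_, le_rfl, _, .assign hlo, by rw [ha]⟩ ?_
  rintro _ - rfl
  -- By truncated subtraction the guard vanishes once the loop variable reaches `b`. The frame
  -- relation to the initial state is part of the invariant, and the extra `5` steps pay for the
  -- increment.
  have key := Achieves.whileLoop (B := B) (e := hi - .var i) (c := .seq c (.assign i (.var i + 1)))
    (fun s' => F s' ∧ ∃ t, a ≤ t ∧ t ≤ b ∧ s'.reg i = t ∧ I t s') (fun s' => b - s'.reg i) (k + 5)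
    ?_ ?_ (s := s.setReg i a) ⟨hset, a, le_rfl, hab, by simp, h₀⟩
  · refine key.mono ?_ ?_
    · have : (hi - Expr.var i).steps = hi.steps + 2 := rfl
      rw [this]
      simp
      apply Nat.mul_le_mul_left
      omega
    · rintro s' - ⟨⟨hf, t, h₁, h₂, h₃, h₄⟩, h₅⟩
      have := (hhi t s' hf h₃ h₄).2
      simp [this, h₃] at h₅
      obtain rfl : t = b := by omega
      exact ⟨h₃, h₄⟩
  · rintro s' ⟨hf, t, h₁, h₂, h₃, h₄⟩
    simp [(hhi t s' hf h₃ h₄).1]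
  · rintro s' ⟨hf, t, h₁, h₂, h₃, h₄⟩ hv
    simp [(hhi t s' hf h₃ h₄).2, h₃] at hv
    refine ((hc t s' hf h₁ (by omega) h₃ h₄).seq (k₂ := 5)
      (Q := fun s'' => (∃ t, a ≤ t ∧ t ≤ b ∧ s''.reg i = t ∧ I t s'') ∧
        b - s''.reg i < b - s'.reg i)
      ?_).mono le_rfl ?_
    · rintro s'' - ⟨h₅, h₆⟩
      refine ⟨_, le_rfl, _, .assign (B := B) (s := s'') (x := i) (e := .var i + 1) (by simp), ?_⟩
      simp only [Expr.eval_add, Expr.eval_var, Expr.eval_ofNat, h₅]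
      refine ⟨⟨t + 1, by omega, by omega, by simp, h₆⟩, ?_⟩
      simp [h₃]
      omega
    · rintro s'' hf' ⟨h₅, h₆⟩
      exact ⟨⟨hf.trans ⟨fun x hx => hf'.1 x fun h => hx (.inr h),
        fun x hx => hf'.2 x fun h => hx (.inr h)⟩, h₅⟩, h₆⟩

end RAM

/-! ### The push-relabel method -/

/-- Excesses, distance labels and residual capacities on vertices named by natural numbers. -/
@[ext] structure Preflow where
  e : ℕ → ℕ
  d : ℕ → ℕ
  r : ℕ → ℕ → ℕ

namespace Preflow

/-- Send `x` units from `u` to `v`. -/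
def push (G : Preflow) (u v x : ℕ) : Preflow where
  e w := if w = v then G.e v + x else if w = u then G.e u - x else G.e w
  d := G.d
  r a b := if a = v ∧ b = u then G.r v u + x else if a = u ∧ b = v then G.r u v - x else G.r a b

/-- Raise the label of `u`. -/
def relabel (G : Preflow) (u : ℕ) : Preflow :=
  { G with d := Function.update G.d u (G.d u + 1) }

/-- Excess in `S` minus residual capacity out of `S`. -/
def surplus (G : Preflow) (N : ℕ) (S : Finset ℕ) : ℤ :=
  ∑ u ∈ S, (G.e u : ℤ) - ∑ u ∈ S, ∑ v ∈ Finset.range N \ S, (G.r u v : ℤ)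

/-- The labels are a distance labelling with respect to the sink `0`. -/
structure Valid (G : Preflow) (N : ℕ) : Prop where
  zero : G.d 0 = 0
  le : ∀ u < N, G.d u ≤ N
  step : ∀ u < N, ∀ v < N, 0 < G.r u v → G.d u ≤ G.d v + 1

/-- The potential that bounds the number of operations. -/
def potential (G : Preflow) (N : ℕ) : ℕ :=
  ∑ u ∈ Finset.range N, (if 0 < G.e u then G.d u else 0) +
    (N * N + 2) * ∑ u ∈ Finset.range N, (N - G.d u) +
    ∑ a ∈ Finset.range N, ∑ b ∈ Finset.range N,
      (if 0 < G.r a b then 2 * N else N * (G.d b + 1 - G.d a))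

variable {G : Preflow} {N u v x : ℕ}

theorem surplus_congr {G' : Preflow} (he : ∀ u < N, G.e u = G'.e u)
    (hr : ∀ u < N, ∀ v < N, G.r u v = G'.r u v) {S : Finset ℕ} (hS : S ⊆ Finset.range N) :
    G.surplus N S = G'.surplus N S := by
  unfold surplus
  congr 1
  · exact Finset.sum_congr rfl fun u hu => by rw [he u (Finset.mem_range.1 (hS hu))]
  · refine Finset.sum_congr rfl fun u hu => Finset.sum_congr rfl fun v hv => ?_
    rw [hr u (Finset.mem_range.1 (hS hu)) v (Finset.mem_range.1 (Finset.mem_sdiff.1 hv).1)]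

/-- A push across the boundary of `S` changes the excess inside and the residual capacity out of `S`
by the same amount: the forward arc loses `x` if the push leaves `S`, the reverse arc gains `x` if
it enters. -/
theorem surplus_push {S : Finset ℕ} (hu : u < N) (hv : v < N) (huv : u ≠ v)
    (hxe : x ≤ G.e u) (hxr : x ≤ G.r u v) :
    (G.push u v x).surplus N S = G.surplus N S := by
  have he : ∀ w, ((G.push u v x).e w : ℤ) =
      G.e w + ((if w = v then (x : ℤ) else 0) - if w = u then (x : ℤ) else 0) := by
    intro w
    simp only [push]
    by_cases h₁ : w = v
    · have : w ≠ u := fun h => huv (h.symm.trans h₁)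
      simp [h₁, huv.symm]
    · by_cases h₂ : w = u
      · simp [h₂, huv, Nat.cast_sub hxe]
        ring
      · simp [h₁, h₂]
  have hr : ∀ a b, ((G.push u v x).r a b : ℤ) =
      G.r a b + ((if a = v then if b = u then (x : ℤ) else 0 else 0) -
        if a = u then if b = v then (x : ℤ) else 0 else 0) := by
    intro a b
    simp only [push]
    by_cases h₁ : a = v
    · by_cases h₂ : b = u
      · simp [h₁, h₂, huv.symm]
      · simp [h₁, h₂, huv.symm]
    · by_cases h₂ : a = u
      · by_cases h₃ : b = v
        · simp [h₂, h₃, huv, Nat.cast_sub hxr]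
          ring
        · simp [h₂, h₃, huv]
      · simp [h₁, h₂]
  simp only [surplus, he, hr, Finset.sum_add_distrib, Finset.sum_sub_distrib]
  have hc : ∀ a b : ℕ, b < N → ∑ i ∈ S, ∑ j ∈ Finset.range N \ S,
      (if i = a then if j = b then (x : ℤ) else 0 else 0) =
      if a ∈ S then if b ∈ S then 0 else (x : ℤ) else 0 := by
    intro a b hb
    have : ∀ i ∈ S, ∑ j ∈ Finset.range N \ S, (if i = a then if j = b then (x : ℤ) else 0 else 0) =
        if i = a then if b ∈ S then 0 else (x : ℤ) else 0 := by
      intro i _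
      by_cases hi : i = a
      · simp [hi, Finset.sum_ite_eq', hb]
      · simp [hi]
    rw [Finset.sum_congr rfl this, Finset.sum_ite_eq']
  rw [hc v u hu, hc u v hv, Finset.sum_ite_eq', Finset.sum_ite_eq']
  by_cases h₁ : u ∈ S <;> by_cases h₂ : v ∈ S <;> simp [h₁, h₂]

theorem Valid.push (h : G.Valid N) (huv : G.d u = G.d v + 1) : (G.push u v x).Valid N := by
  refine ⟨h.zero, h.le, fun a ha b hb hr => ?_⟩
  simp only [Preflow.push] at hr ⊢
  split_ifs at hr with h₁ h₂
  · rw [h₁.1, h₁.2]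
    omega
  · rw [h₂.1, h₂.2, huv]
  · exact h.step a ha b hb hr

theorem push_zero : G.push u v 0 = G := by
  ext a b
  · simp only [push]
    split_ifs <;> simp_all
  · rfl
  · simp only [push]
    split_ifs <;> simp_all

/-- A push does not increase the potential, and decreases it if the excess becomes zero. -/
theorem potential_push (h : G.Valid N) (hu : u < N) (hv : v < N) (huv : G.d u = G.d v + 1)
    (hx : x = min (G.e u) (G.r u v)) :
    (G.push u v x).potential N + (if 0 < G.e u ∧ (G.push u v x).e u = 0 then 1 else 0) ≤
      G.potential N := by
  rcases Nat.eq_zero_or_pos x with rfl | hx₀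
  · rw [push_zero, if_neg (by omega), add_zero]
  have hne : u ≠ v := by
    rintro rfl
    omega
  set G' := G.push u v x with hG'
  have heu : G'.e u = G.e u - x := by simp [hG', push, hne]
  have hruv : G'.r u v = G.r u v - x := by simp [hG', push, hne]
  have hd : G'.d = G.d := rfl
  -- The sum of active labels gains at most `G.d v`, and loses `G.d u` if `u` runs empty.
  have hΦ : ∀ w ∈ Finset.range N, (if 0 < G'.e w then G'.d w else 0) +
      (if w = u then if G'.e u = 0 then G.d u else 0 else 0) ≤
      (if 0 < G.e w then G.d w else 0) + (if w = v then G.d v else 0) := by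
    intro w _
    by_cases h₁ : w = u
    · subst h₁
      have : 0 < G.e w := by omega
      simp only [hd, if_true, if_pos this]
      split_ifs <;> omega
    · by_cases h₂ : w = v
      · subst h₂
        simp only [hd, h₁, if_true, if_false]
        split_ifs <;> omega
      · have : G'.e w = G.e w := by simp [hG', push, h₁, h₂]
        simp only [hd, h₁, h₂, this, if_false]
        omega
  -- The arc from `u` to `v` is worth `2 * N` while residual and nothing once saturated. The reverse
  -- arc is worth `2 * N` before and after, whether or not it was residual, because its label term
  -- is `N * 2`.
  have hQ : ∀ a ∈ Finset.range N, ∀ b ∈ Finset.range N,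
      (if 0 < G'.r a b then 2 * N else N * (G'.d b + 1 - G'.d a)) +
      (if b = v then if a = u then if G'.r u v = 0 then 2 * N else 0 else 0 else 0) ≤
      (if 0 < G.r a b then 2 * N else N * (G.d b + 1 - G.d a)) := by
    intro a _ b _
    by_cases h₁ : a = u ∧ b = v
    · obtain ⟨rfl, rfl⟩ := h₁
      have h₂ : 0 < G.r a b := by omega
      have h₃ : G'.d b + 1 - G'.d a = 0 := by
        rw [hd]
        omega
      rw [h₃, if_pos h₂]
      simp only [if_true]
      split_ifs <;> omega
    · have h₀ : (if b = v then if a = u then if G'.r u v = 0 then 2 * N else 0 else 0 else 0) =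
          0 := by
        split_ifs <;> tauto
      rw [h₀, add_zero]
      by_cases h₂ : a = v ∧ b = u
      · obtain ⟨rfl, rfl⟩ := h₂
        have h₃ : G.d b + 1 - G.d a = 2 := by omega
        rw [hd, h₃, mul_comm N 2]
        split_ifs <;> omega
      · have : G'.r a b = G.r a b := by simp [hG', push, h₁, h₂]
        rw [this, hd]
  have sΦ := Finset.sum_le_sum hΦ
  have sQ := Finset.sum_le_sum fun a ha => Finset.sum_le_sum (hQ a ha)
  simp only [Finset.sum_add_distrib, Finset.sum_ite_eq', Finset.mem_range, hu, hv, if_true] at sΦ sQ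
  have hdu := h.le u hu
  have hA : ∑ u ∈ Finset.range N, (N - G'.d u) = ∑ u ∈ Finset.range N, (N - G.d u) := rfl
  simp only [potential, hA]
  -- Sending the minimum empties `u` or saturates the arc. Emptying pays with `G.d u = G.d v + 1`;
  -- otherwise saturation pays `2 * N`, more than the possible gain `G.d v`.
  have hcase : G'.e u = 0 ∨ G'.r u v = 0 := by omega
  by_cases h₁ : G'.e u = 0
  · rw [if_pos h₁] at sΦ
    have : (if 0 < G.e u ∧ G'.e u = 0 then 1 else 0) ≤ 1 := by split_ifs <;> omega
    omega
  · rw [if_neg h₁] at sΦ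
    rw [if_pos (hcase.resolve_left h₁)] at sQ
    rw [if_neg fun h => h₁ h.2]
    omega

theorem surplus_relabel {S : Finset ℕ} : (G.relabel u).surplus N S = G.surplus N S := rfl

/-- Without admissible arcs, every residual arc out of `u` leads to a label at least `G.d u`, which
leaves room to raise `u` by one. -/
theorem Valid.relabel (h : G.Valid N) (h₀ : u ≠ 0) (hd : G.d u < N)
    (hadm : ∀ v < N, G.r u v = 0 ∨ G.d u ≠ G.d v + 1) : (G.relabel u).Valid N := by
  refine ⟨?_, fun w hw => ?_, fun a ha b hb hr => ?_⟩
  · simp [Preflow.relabel, h₀.symm, h.zero]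
  · by_cases hwu : w = u
    · simpa [Preflow.relabel, hwu] using hd
    · simpa [Preflow.relabel, hwu] using h.le w hw
  · have h₁ := h.step a ha b hb hr
    have hr : 0 < G.r a b := hr
    simp only [Preflow.relabel, Function.update_apply]
    by_cases hau : a = u
    · subst hau
      have := hadm b hb
      split_ifs <;> omega
    · rw [if_neg hau]
      split_ifs with hbu
      · subst hbu
        omega
      · exact h₁

/-- This fixes the coefficient `N * N + 2`: a relabelling costs at most `1` in the active labels and
at most `N` for each of the `N` arcs into `u`, so the middle sum must pay one more than `N * N + 1`.
-/
theorem potential_relabel (hu : u < N) (hd : G.d u < N) :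
    (G.relabel u).potential N + 1 ≤ G.potential N := by
  set G' := G.relabel u with hG'
  have hdu : G'.d u = G.d u + 1 := by simp [hG', relabel]
  have hdw : ∀ w, w ≠ u → G'.d w = G.d w := fun w hw => by simp [hG', relabel, hw]
  have he : G'.e = G.e := rfl
  have hr : G'.r = G.r := rfl
  have hΦ : ∀ w ∈ Finset.range N, (if 0 < G'.e w then G'.d w else 0) ≤
      (if 0 < G.e w then G.d w else 0) + (if w = u then 1 else 0) := by
    intro w _
    rw [he]
    by_cases hw : w = u
    · subst hw
      rw [hdu]
      split_ifs <;> omega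
    · rw [hdw w hw]
      omega
  have hA : ∀ w ∈ Finset.range N, (N - G'.d w) + (if w = u then 1 else 0) ≤ N - G.d w := by
    intro w _
    by_cases hw : w = u
    · subst hw
      rw [hdu, if_pos rfl]
      omega
    · rw [hdw w hw, if_neg hw]
      omega
  have hQ : ∀ a ∈ Finset.range N, ∀ b ∈ Finset.range N,
      (if 0 < G'.r a b then 2 * N else N * (G'.d b + 1 - G'.d a)) ≤
      (if 0 < G.r a b then 2 * N else N * (G.d b + 1 - G.d a)) + (if b = u then N else 0) := by
    intro a _ b _
    rw [hr]
    by_cases h₁ : 0 < G.r a b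
    · simp [h₁]
    rw [if_neg h₁, if_neg h₁]
    have h₂ : G'.d b + 1 - G'.d a ≤ G.d b + 1 - G.d a + (if b = u then 1 else 0) := by
      have : G.d a ≤ G'.d a := by
        by_cases hau : a = u
        · rw [hau, hdu]
          omega
        · rw [hdw a hau]
      by_cases hbu : b = u
      · rw [if_pos hbu, hbu, hdu]
        omega
      · rw [if_neg hbu, hdw b hbu]
        omega
    refine (Nat.mul_le_mul_left N h₂).trans ?_
    rw [mul_add]
    split_ifs <;> simp
  have sΦ := Finset.sum_le_sum hΦ
  have sA := Finset.sum_le_sum hA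
  have sQ := Finset.sum_le_sum fun a ha => Finset.sum_le_sum (hQ a ha)
  simp only [Finset.sum_add_distrib, Finset.sum_ite_eq', Finset.mem_range, hu, if_true,
    Finset.sum_const, Finset.card_range, smul_eq_mul] at sΦ sA sQ
  have sA' := Nat.mul_le_mul_left (N * N + 2) sA
  rw [mul_add, mul_one] at sA'
  simp only [potential]
  omega

theorem potential_le (G : Preflow) (N : ℕ) (h : ∀ u < N, G.d u = 0) :
    G.potential N ≤ N * N * (N * N + 2) + N * N * (2 * N + 1) := by
  have h₁ : ∑ u ∈ Finset.range N, (if 0 < G.e u then G.d u else 0) = 0 := by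
    refine Finset.sum_eq_zero fun u hu => ?_
    rw [h u (Finset.mem_range.1 hu), ite_self]
  have h₂ : ∑ u ∈ Finset.range N, (N - G.d u) ≤ N * N := by
    refine (Finset.sum_le_card_nsmul _ _ N fun u _ => Nat.sub_le _ _).trans ?_
    simp
  have h₃ : ∑ a ∈ Finset.range N, ∑ b ∈ Finset.range N,
      (if 0 < G.r a b then 2 * N else N * (G.d b + 1 - G.d a)) ≤ N * (N * (2 * N + 1)) := by
    refine (Finset.sum_le_card_nsmul _ _ (N * (2 * N + 1)) fun a ha => ?_).trans (by simp)
    refine (Finset.sum_le_card_nsmul _ _ (2 * N + 1) fun b hb => ?_).trans (by simp)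
    rw [h a (Finset.mem_range.1 ha), h b (Finset.mem_range.1 hb)]
    split_ifs <;> simp; omega
  have h₂' := Nat.mul_le_mul_left (N * N + 2) h₂
  rw [potential, h₁]
  nlinarith

/-- Push as much as possible from `u` to `v` if the labels allow it. -/
def pushStep (G : Preflow) (u v : ℕ) : Preflow :=
  if G.d u = G.d v + 1 then G.push u v (min (G.e u) (G.r u v)) else G

/-- A valid preflow that arises from an initial one with surplus `Q`. -/
structure Good (G : Preflow) (N : ℕ) (Q : Finset ℕ → ℤ) : Prop where
  valid : G.Valid N
  surplus : ∀ S ⊆ Finset.range N, G.surplus N S = Q S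

/-- `G` arises from `G₀` by pushing from `u` to all `v < t`. -/
structure Scanned (G : Preflow) (N : ℕ) (Q : Finset ℕ → ℤ) (G₀ : Preflow) (u t : ℕ) : Prop where
  good : G.Good N Q
  labels : G.d = G₀.d
  potential : G.potential N + (if G.e u = 0 then 1 else 0) ≤ G₀.potential N
  done : ∀ v < t, G.e u = 0 ∨ G.r u v = 0 ∨ G.d u ≠ G.d v + 1

/-- Later pushes from `u` do not reopen scanned arcs: labels stay fixed, the excess of `u` only
falls, and the residual capacities from `u` to earlier vertices are untouched. -/
theorem Scanned.step {Q : Finset ℕ → ℤ} {G₀ : Preflow} {t : ℕ} (h : G.Scanned N Q G₀ u t)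
    (hu : u < N) (ht : t < N) : (G.pushStep u t).Scanned N Q G₀ u (t + 1) := by
  by_cases hd : G.d u = G.d t + 1
  · rw [pushStep, if_pos hd]
    have hne : u ≠ t := by
      rintro rfl
      omega
    set x := min (G.e u) (G.r u t) with hx
    have heu : (G.push u t x).e u = G.e u - x := by simp [push, hne]
    have hrt : (G.push u t x).r u t = G.r u t - x := by simp [push, hne]
    have hpot := potential_push h.good.valid hu ht hd hx
    have hpot₀ := h.potential
    refine ⟨⟨h.good.valid.push hd, fun S hS => ?_⟩, h.labels, ?_, fun v hv => ?_⟩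
    · rw [surplus_push hu ht hne (min_le_left _ _) (min_le_right _ _)]
      exact h.good.surplus S hS
    · split_ifs at hpot hpot₀ ⊢ <;> omega
    · rcases Nat.lt_succ_iff_lt_or_eq.1 hv with hv | rfl
      · have hr : (G.push u t x).r u v = G.r u v := by simp [push, hne, hv.ne]
        rw [heu, hr]
        rcases h.done v hv with h₁ | h₁ | h₁
        · left
          omega
        · exact .inr (.inl h₁)
        · exact .inr (.inr h₁)
      · rw [heu, hrt]
        omega
  · rw [pushStep, if_neg hd]
    refine ⟨h.good, h.labels, h.potential, fun v hv => ?_⟩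
    rcases Nat.lt_succ_iff_lt_or_eq.1 hv with hv | rfl
    · exact h.done v hv
    · exact .inr (.inr hd)

theorem Scanned.relabel {Q : Finset ℕ → ℤ} {G₀ : Preflow} (h : G.Scanned N Q G₀ u N)
    (hu : u < N) (h₀ : u ≠ 0) (hd : G.d u < N) (he : G.e u ≠ 0) :
    (G.relabel u).Good N Q ∧ (G.relabel u).potential N + 1 ≤ G₀.potential N := by
  refine ⟨⟨h.good.valid.relabel h₀ hd fun v hv => (h.done v hv).resolve_left he,
    fun S hS => ?_⟩, ?_⟩
  · rw [surplus_relabel]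
    exact h.good.surplus S hS
  · have := h.potential
    have := potential_relabel (G := G) hu hd
    omega

/-- Pigeonhole: the sink uses up the label `0`, so the other `N - 1` vertices cannot occupy all of
`1, …, N`. -/
theorem exists_gap (d : ℕ → ℕ) (h₀ : d 0 = 0) (hN : 0 < N) :
    ∃ g, 1 ≤ g ∧ g ≤ N ∧ ∀ u < N, d u ≠ g := by
  by_contra! h
  have hsub : Finset.range (N + 1) ⊆ (Finset.range N).image d := by
    intro g hg
    rw [Finset.mem_image]
    rcases Nat.eq_zero_or_pos g with rfl | hg₀
    · exact ⟨0, Finset.mem_range.2 hN, h₀⟩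
    · obtain ⟨u, hu, hd⟩ := h g hg₀ (Nat.lt_succ_iff.1 (Finset.mem_range.1 hg))
      exact ⟨u, Finset.mem_range.2 hu, hd⟩
  have := (Finset.card_le_card hsub).trans Finset.card_image_le
  simp at this

theorem surplus_le {S : Finset ℕ} (hS : S ⊆ Finset.range N) (h₀ : 0 ∉ S) :
    G.surplus N S ≤ ∑ u ∈ (Finset.range N).erase 0, (G.e u : ℤ) := by
  have h₁ : ∑ u ∈ S, (G.e u : ℤ) ≤ ∑ u ∈ (Finset.range N).erase 0, (G.e u : ℤ) :=
    Finset.sum_le_sum_of_subset_of_nonneg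
      (fun u hu => Finset.mem_erase.2 ⟨fun h => h₀ (h ▸ hu), hS hu⟩) fun _ _ _ => by positivity
  have h₂ : 0 ≤ ∑ u ∈ S, ∑ v ∈ Finset.range N \ S, (G.r u v : ℤ) :=
    Finset.sum_nonneg fun _ _ => Finset.sum_nonneg fun _ _ => by positivity
  rw [surplus]
  linarith

/-- Labels drop by at most one along residual arcs, so no such arc crosses the missing level `g`.
All excess outside the sink sits at label at least `N`, hence above the gap. -/
theorem surplus_eq_of_gap (h : G.Valid N) (hact : ∀ u < N, u ≠ 0 → 0 < G.e u → N ≤ G.d u)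
    {g : ℕ} (h₁ : 1 ≤ g) (h₂ : g ≤ N) (hg : ∀ u < N, G.d u ≠ g) :
    G.surplus N ((Finset.range N).filter fun u => g ≤ G.d u) =
      ∑ u ∈ (Finset.range N).erase 0, (G.e u : ℤ) := by
  have hr : ∑ u ∈ (Finset.range N).filter (fun u => g ≤ G.d u),
      ∑ v ∈ Finset.range N \ (Finset.range N).filter (fun u => g ≤ G.d u), (G.r u v : ℤ) = 0 := by
    refine Finset.sum_eq_zero fun u hu => Finset.sum_eq_zero fun v hv => ?_
    simp only [Finset.mem_filter, Finset.mem_sdiff, Finset.mem_range, not_and, not_le] at hu hv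
    by_contra hne
    have := h.step u hu.1 v hv.1 (by omega)
    have := hv.2 hv.1
    have := hg u hu.1
    omega
  rw [surplus, hr, sub_zero]
  refine Finset.sum_subset (fun u hu => ?_) fun u hu hu' => ?_
  · simp only [Finset.mem_filter, Finset.mem_range, Finset.mem_erase] at hu ⊢
    refine ⟨?_, hu.1⟩
    rintro rfl
    have := h.zero
    omega
  · simp only [Finset.mem_filter, Finset.mem_range, Finset.mem_erase, not_and, not_le] at hu hu'
    have := hact u hu.2 hu.1
    have := hu' hu.2
    by_contra hne
    omega

end Preflow

namespace MaxPE

open RAM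

/-! ### The program

Vertex `0` is the sink, the vertices `1, …, m` are the projects and `m + 1, …, m + n` the agents;
there are `N = n + m + 1` of them. Register `1` holds `n`, register `2` holds `m`, register `3`
holds `N`, and register `9` holds a capacity that exceeds all others. Array `0` holds the input,
array `1` the output, arrays `2`, `3` and `4` hold excesses, labels and residual capacities, arrays
`5` and `6` hold numerators and denominators of the weights, and array `7` the weights after
multiplication by the common denominator. -/

/-- Read numerator and denominator of the weight of the vertex in register `4`. -/
def readBody : Stmt :=
  .ite (.var 4)
    (.ite (.var 4 - .var 2)
      (.seq (.assign 6 (2 + (.var 4 - (.var 2 + 1)) * (.var 2 + 4)))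
      (.seq (.assign 7 (.load 0 (.var 6) * .load 0 (.var 6 + 3)))
      (.seq (.assign 8 (.load 0 (.var 6 + 2) * .load 0 (.var 6 + 1)))
      (.seq (.store 5 (.var 4) (.var 7 - (.var 7 - .var 8)))
        (.store 6 (.var 4) (.load 0 (.var 6 + 1) * .load 0 (.var 6 + 3)))))))
      (.seq (.assign 6 (2 + .var 1 * (.var 2 + 4) + 2 * (.var 4 - 1)))
      (.seq (.store 5 (.var 4) (.load 0 (.var 6)))
        (.store 6 (.var 4) (.load 0 (.var 6 + 1))))))
    (.seq (.store 5 0 0) (.store 6 0 1))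

/-- Read numerators and denominators of all weights. -/
def readAll : Stmt := .forLoop 4 0 (.var 3) readBody

/-- The numerator of the weight of vertex `u` of an instance with input array `a`. -/
def numOf (n m : ℕ) (a : ℕ → ℕ) (u : ℕ) : ℕ :=
  if u = 0 then 0
  else if u ≤ m then a (2 + n * (m + 4) + 2 * (u - 1))
  else min (a (2 + (u - (m + 1)) * (m + 4)) * a (2 + (u - (m + 1)) * (m + 4) + 3))
    (a (2 + (u - (m + 1)) * (m + 4) + 2) * a (2 + (u - (m + 1)) * (m + 4) + 1))

/-- The denominator of the weight of vertex `u` of an instance with input array `a`. -/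
def denOf (n m : ℕ) (a : ℕ → ℕ) (u : ℕ) : ℕ :=
  if u = 0 then 1
  else if u ≤ m then a (2 + n * (m + 4) + 2 * (u - 1) + 1)
  else a (2 + (u - (m + 1)) * (m + 4) + 1) * a (2 + (u - (m + 1)) * (m + 4) + 3)

/-- The product of the numerator at `u` and all denominators at `s < t`, `s ≠ u`. -/
def scaled (n m : ℕ) (a : ℕ → ℕ) (u t : ℕ) : ℕ :=
  ∏ s ∈ Finset.range t, if s = u then numOf n m a s else denOf n m a s

/-- An upper bound for all capacities. -/
def bigOf (n m : ℕ) (a : ℕ → ℕ) (t : ℕ) : ℕ :=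
  1 + ∑ u ∈ Finset.range t, scaled n m a u (n + m + 1)

/-- All products computed by the program have at most `B` bits. -/
structure Fits (B n m : ℕ) (a : ℕ → ℕ) : Prop where
  index : Nat.size ((n + m + 5) * (n + m + 5)) ≤ B
  num₁ : ∀ i < n, Nat.size (a (2 + i * (m + 4)) * a (2 + i * (m + 4) + 3)) ≤ B
  num₂ : ∀ i < n, Nat.size (a (2 + i * (m + 4) + 2) * a (2 + i * (m + 4) + 1)) ≤ B
  den : ∀ i < n, Nat.size (a (2 + i * (m + 4) + 1) * a (2 + i * (m + 4) + 3)) ≤ B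
  scaled : ∀ u t, t ≤ n + m + 1 → Nat.size (scaled n m a u t) ≤ B
  big : Nat.size (bigOf n m a (n + m + 2)) ≤ B
  indicator : ∀ i < n, ∀ j < m, a (2 + i * (m + 4) + (4 + j)) ≤ 1

/-- The input array and the sizes of the instance are in place. -/
structure Loaded (n m : ℕ) (a : ℕ → ℕ) (s : State) : Prop where
  input : s.arr 0 = a
  agents : s.reg 1 = n
  projects : s.reg 2 = m
  vertices : s.reg 3 = n + m + 1

theorem Loaded.of_frame {n m : ℕ} {a : ℕ → ℕ} {s s' : State} {c : Stmt} (h : Loaded n m a s)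
    (hf : c.Frame s s')
    (hc : ¬ c.WritesArr 0 ∧ ¬ c.WritesReg 1 ∧ ¬ c.WritesReg 2 ∧ ¬ c.WritesReg 3) :
    Loaded n m a s' :=
  ⟨(hf.2 0 hc.1).trans h.input, (hf.1 1 hc.2.1).trans h.agents, (hf.1 2 hc.2.2.1).trans h.projects,
    (hf.1 3 hc.2.2.2).trans h.vertices⟩

variable {B n m : ℕ} {a : ℕ → ℕ} {s : State}

theorem size_le_of_index (h : Fits B n m a) {x y : ℕ} (hx : x ≤ n + m + 5) (hy : y ≤ n + m + 5) :
    Nat.size (x * y) ≤ B :=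
  (Nat.size_le_size (Nat.mul_le_mul hx hy)).trans h.index

theorem update_eq_of_le {f g : ℕ → ℕ} {t x : ℕ} (h : ∀ u < t, f u = g u) (hx : x = g t) :
    ∀ u ≤ t, Function.update f t x u = g u := by
  intro u hu
  rcases hu.lt_or_eq with hu | rfl
  · simpa [hu.ne] using h u hu
  · simpa using hx

/-- An agent's record has length `m + 4`. The smaller of value and budget is found over the product
of their denominators, with the minimum computed as `x - (x - y)`. -/
theorem readAll_spec (hB : Fits B n m a) (hs : Loaded n m a s) :
    Achieves B readAll s (loopSteps 0 (.var 3) (n + m + 1) readBody.steps) fun s' =>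
      (∀ u < n + m + 1, s'.arr 5 u = numOf n m a u) ∧
        ∀ u < n + m + 1, s'.arr 6 u = denOf n m a u := by
  refine (Achieves.forLoop (fun t s' => (∀ u < t, s'.arr 5 u = numOf n m a u) ∧
    ∀ u < t, s'.arr 6 u = denOf n m a u) readBody.steps (by simp) (a := 0) (b := n + m + 1)
    (by simp) (Nat.zero_le _) (by simp) ?_ ?_).mono le_rfl fun s' _ h => h.2
  · intro t s' hf _ _
    have := hs.of_frame hf (by simp [readBody, Stmt.forLoop, Stmt.WritesReg, Stmt.WritesArr])
    simp [this.vertices]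
  · rintro t s' hf - htN ht ⟨h₅, h₆⟩
    have hL := hs.of_frame hf (by simp [readBody, Stmt.forLoop, Stmt.WritesReg, Stmt.WritesArr])
    refine Achieves.of_wp ?_
    simp [readBody, Stmt.wp, ht, hL.agents, hL.projects, hL.input]
    refine ⟨fun h₀ => ⟨fun hm => ?_, fun hm => ?_⟩, fun h₀ => ?_⟩
    · have hm' : ¬ t ≤ m := by omega
      have hi : t - (m + 1) < n := by omega
      refine ⟨size_le_of_index hB (by omega) (by omega), hB.num₁ _ hi, hB.num₂ _ hi, hB.den _ hi,
        update_eq_of_le h₅ ?_, update_eq_of_le h₆ ?_⟩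
      · rw [numOf, if_neg h₀, if_neg hm']
        omega
      · rw [denOf, if_neg h₀, if_neg hm']
    · have hm' : t ≤ m := by omega
      refine ⟨⟨size_le_of_index hB (by omega) (by omega),
        size_le_of_index hB (by omega) (by omega)⟩,
        update_eq_of_le h₅ ?_, update_eq_of_le h₆ ?_⟩
      · rw [numOf, if_neg h₀, if_pos hm']
      · rw [denOf, if_neg h₀, if_pos hm']
    · subst h₀
      exact ⟨update_eq_of_le h₅ (by simp [numOf]), update_eq_of_le h₆ (by simp [denOf])⟩

/-- Multiply by the factor of the vertex in register `5` in the scaled weight of the vertex in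
register `4`. -/
def scaleBody : Stmt :=
  .ite (.var 4 - .var 5 + (.var 5 - .var 4))
    (.assign 8 (.var 8 * .load 6 (.var 5))) (.assign 8 (.var 8 * .load 5 (.var 5)))

/-- Compute the scaled weight of the vertex in register `4`. -/
def scaleOne : Stmt := .forLoop 5 0 (.var 3) scaleBody

/-- Store the scaled weight of the vertex in register `4`. -/
def storeScaled : Stmt := .seq (.store 7 (.var 4) (.var 8)) (.assign 9 (.var 9 + .var 8))

/-- Compute all scaled weights, the common denominator, and a bound for all of them. -/
def scaleAll : Stmt :=
  .seq (.assign 9 1)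
    (.forLoop 4 0 (.var 3 + 1) (.seq (.assign 8 1) (.seq scaleOne storeScaled)))

theorem scaleOne_spec (hB : Fits B n m a) (hs : Loaded n m a s)
    (h₅ : ∀ u < n + m + 1, s.arr 5 u = numOf n m a u)
    (h₆ : ∀ u < n + m + 1, s.arr 6 u = denOf n m a u) (h₈ : s.reg 8 = 1) :
    Achieves B scaleOne s (loopSteps 0 (.var 3) (n + m + 1) scaleBody.steps) fun s' =>
      s'.reg 8 = scaled n m a (s.reg 4) (n + m + 1) := by
  refine (Achieves.forLoop (fun t s' => s'.reg 8 = scaled n m a (s.reg 4) t) scaleBody.steps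
    (by simp) (a := 0) (b := n + m + 1) (by simp) (Nat.zero_le _) (by simp [h₈, scaled])
    ?_ ?_).mono le_rfl fun s' _ h => h.2
  · intro t s' hf _ _
    have := hs.of_frame hf (by simp [scaleBody, Stmt.forLoop, Stmt.WritesReg, Stmt.WritesArr])
    simp [this.vertices]
  · rintro t s' hf - htN ht hI
    have h₄ : s'.reg 4 = s.reg 4 :=
      hf.1 4 (by simp [scaleBody, Stmt.forLoop, Stmt.WritesReg])
    have f₅ : s'.arr 5 = s.arr 5 :=
      hf.2 5 (by simp [scaleBody, Stmt.forLoop, Stmt.WritesArr])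
    have f₆ : s'.arr 6 = s.arr 6 :=
      hf.2 6 (by simp [scaleBody, Stmt.forLoop, Stmt.WritesArr])
    have hsc := hB.scaled (s.reg 4) (t + 1) htN
    have hstep : scaled n m a (s.reg 4) (t + 1) = scaled n m a (s.reg 4) t *
        if t = s.reg 4 then numOf n m a t else denOf n m a t := Finset.prod_range_succ _ _
    rw [hstep] at hsc
    refine Achieves.of_wp ?_
    simp [scaleBody, Stmt.wp, ht, h₄, f₅, f₆, hI, h₅ t htN, h₆ t htN]
    refine ⟨fun hne => ?_, fun h₁ h₂ => ?_⟩
    · have : t ≠ s.reg 4 := by omega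
      rw [if_neg this] at hstep hsc
      exact ⟨hsc, hstep.symm⟩
    · have : t = s.reg 4 := by omega
      rw [if_pos this] at hstep hsc
      exact ⟨hsc, hstep.symm⟩

/-- The loop runs one index past the last vertex: there no factor is a numerator, and the product is
the common denominator. -/
theorem scaleAll_spec (hB : Fits B n m a) (hs : Loaded n m a s)
    (h₅ : ∀ u < n + m + 1, s.arr 5 u = numOf n m a u)
    (h₆ : ∀ u < n + m + 1, s.arr 6 u = denOf n m a u) :
    Achieves B scaleAll s ((Stmt.assign 9 1).steps + loopSteps 0 (.var 3 + 1) (n + m + 2)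
      ((Stmt.assign 8 1).steps +
        (loopSteps 0 (.var 3) (n + m + 1) scaleBody.steps + storeScaled.steps))) fun s' =>
      s'.reg 9 = bigOf n m a (n + m + 2) ∧
        ∀ u < n + m + 2, s'.arr 7 u = scaled n m a u (n + m + 1) := by
  refine Achieves.seq (P := fun s' => s' = s.setReg 9 1) (Achieves.of_wp (by simp [Stmt.wp])) ?_
  rintro _ - rfl
  refine (Achieves.forLoop (fun t s' => s'.reg 9 = bigOf n m a t ∧
    ∀ u < t, s'.arr 7 u = scaled n m a u (n + m + 1)) _
    (by simp) (a := 0) (b := n + m + 2) (by simp) (Nat.zero_le _) (by simp [bigOf])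
    ?_ ?_).mono le_rfl fun s' _ h => h.2
  · intro t s' hf _ _
    have h₃ : s'.reg 3 = s.reg 3 := (hf.1 3 (by simp [scaleOne, scaleBody, storeScaled,
      Stmt.forLoop, Stmt.WritesReg])).trans (by simp)
    simp [h₃, hs.vertices]
  · rintro t s₁ hf - htN ht ⟨h₉, h₇⟩
    have hL : Loaded n m a s₁ := Loaded.of_frame (s := s.setReg 9 1)
      ⟨hs.input, by simp [hs.agents], by simp [hs.projects], by simp [hs.vertices]⟩ hf
      (by simp [scaleOne, scaleBody, storeScaled, Stmt.forLoop, Stmt.WritesReg, Stmt.WritesArr])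
    have f₅ : s₁.arr 5 = s.arr 5 := hf.2 5 (by simp [scaleOne, scaleBody, storeScaled,
      Stmt.forLoop, Stmt.WritesArr])
    have f₆ : s₁.arr 6 = s.arr 6 := hf.2 6 (by simp [scaleOne, scaleBody, storeScaled,
      Stmt.forLoop, Stmt.WritesArr])
    refine Achieves.seq (P := fun s' => s' = s₁.setReg 8 1) (Achieves.of_wp (by simp [Stmt.wp])) ?_
    rintro _ - rfl
    refine Achieves.seq (scaleOne_spec hB
      ⟨hL.input, by simp [hL.agents], by simp [hL.projects], by simp [hL.vertices]⟩
      (by simpa [f₅] using h₅) (by simpa [f₆] using h₆) (by simp)) ?_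
    intro s₂ hf₂ h₈
    have g₄ : s₂.reg 4 = t := (hf₂.1 4 (by simp [scaleOne, scaleBody,
      Stmt.forLoop, Stmt.WritesReg])).trans (by simp [ht])
    have g₉ : s₂.reg 9 = s₁.reg 9 := (hf₂.1 9 (by simp [scaleOne, scaleBody,
      Stmt.forLoop, Stmt.WritesReg])).trans (by simp)
    have g₇ : s₂.arr 7 = s₁.arr 7 := (hf₂.2 7 (by simp [scaleOne, scaleBody,
      Stmt.forLoop, Stmt.WritesArr])).trans (by simp)
    have h₈ : s₂.reg 8 = scaled n m a t (n + m + 1) := by simpa [ht] using h₈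
    refine Achieves.of_wp ?_
    simp [storeScaled, Stmt.wp, g₄, g₉, g₇, h₈, h₉]
    refine ⟨?_, update_eq_of_le h₇ rfl⟩
    rw [bigOf, bigOf, Finset.sum_range_succ, add_assoc]

end MaxPE

namespace MaxPE

open RAM

variable {B n m : ℕ} {a : ℕ → ℕ} {s : State}

/-! ### The initial preflow -/

/-- Test for equality with `0` as the affirmative answer. -/
def distance (e₁ e₂ : Expr) : Expr := e₁ - e₂ + (e₂ - e₁)

@[simp] theorem eval_distance (e₁ e₂ : Expr) :
    (distance e₁ e₂).eval s = e₁.eval s - e₂.eval s + (e₂.eval s - e₁.eval s) := rfl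

@[simp] theorem ok_distance (e₁ e₂ : Expr) :
    (distance e₁ e₂).Ok B s ↔ (e₁.Ok B s ∧ e₂.Ok B s) ∧ e₂.Ok B s ∧ e₁.Ok B s := Iff.rfl

/-- The initial residual capacities. -/
def capOf (n m : ℕ) (a : ℕ → ℕ) (u v : ℕ) : ℕ :=
  if u = 0 then 0
  else if u ≤ m then if v = 0 then scaled n m a u (n + m + 1) else 0
  else if v = 0 then 0
  else if v ≤ m then bigOf n m a (n + m + 2) * a (2 + (u - (m + 1)) * (m + 4) + (4 + (v - 1)))
  else 0

/-- The initial excesses. -/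
def excessOf (n m : ℕ) (a : ℕ → ℕ) (u : ℕ) : ℕ :=
  if u ≤ m then 0 else scaled n m a u (n + m + 1)

/-- The entry of the residual capacity of the arc between two registers. -/
def arc (u v : ℕ) : Expr := .var u * .var 3 + .var v

@[simp] theorem eval_arc (u v : ℕ) : (arc u v).eval s = s.reg u * s.reg 3 + s.reg v := rfl

@[simp] theorem ok_arc (u v : ℕ) :
    (arc u v).Ok B s ↔ (True ∧ True ∧ Nat.size (s.reg u * s.reg 3) ≤ B) ∧ True := Iff.rfl

/-- Set the initial residual capacity of the arc between registers `4` and `5`. -/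
def initBody : Stmt :=
  .seq
    (.ite (.var 4)
      (.ite (.var 4 - .var 2)
        (.ite (.var 5)
          (.ite (.var 5 - .var 2) (.assign 6 0)
            (.assign 6 (.var 9 *
              .load 0 (2 + (.var 4 - (.var 2 + 1)) * (.var 2 + 4) + (4 + (.var 5 - 1))))))
          (.assign 6 0))
        (.ite (.var 5) (.assign 6 0) (.assign 6 (.load 7 (.var 4)))))
      (.assign 6 0))
    (.store 4 (arc 4 5) (.var 6))

/-- Set the initial residual capacities of the arcs out of register `4`. -/
def initRow : Stmt := .forLoop 5 0 (.var 3) initBody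

/-- Set the initial excess of register `4`. -/
def initExcess : Stmt :=
  .ite (.var 4 - .var 2) (.store 2 (.var 4) (.load 7 (.var 4))) (.store 2 (.var 4) 0)

/-- Set the initial excesses and residual capacities. -/
def initAll : Stmt := .forLoop 4 0 (.var 3) (.seq initRow initExcess)

theorem index_inj {N x y x' y' : ℕ} (hy : y < N) (hy' : y' < N) :
    x * N + y = x' * N + y' ↔ x = x' ∧ y = y' := by
  refine ⟨fun h => ?_, fun h => by rw [h.1, h.2]⟩
  have h₁ := congrArg (· / N) h
  have h₂ := congrArg (· % N) h
  have hN : 0 < N := by omega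
  simp only [mul_comm _ N, Nat.mul_add_div hN, Nat.mul_add_mod, Nat.div_eq_of_lt hy,
    Nat.div_eq_of_lt hy', Nat.mod_eq_of_lt hy, Nat.mod_eq_of_lt hy'] at h₁ h₂
  exact ⟨by omega, h₂⟩

theorem initRow_spec (hB : Fits B n m a) (hs : Loaded n m a s) (hu : s.reg 4 < n + m + 1)
    (h₉ : s.reg 9 = bigOf n m a (n + m + 2))
    (h₇ : ∀ u < n + m + 2, s.arr 7 u = scaled n m a u (n + m + 1))
    (h₄ : ∀ x < s.reg 4, ∀ y < n + m + 1, s.arr 4 (x * (n + m + 1) + y) = capOf n m a x y) :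
    Achieves B initRow s (loopSteps 0 (.var 3) (n + m + 1) initBody.steps) fun s' =>
      ∀ x < s.reg 4 + 1, ∀ y < n + m + 1, s'.arr 4 (x * (n + m + 1) + y) = capOf n m a x y := by
  -- The matrix is filled in lexicographic order; the invariant covers all earlier rows and the
  -- first `t` entries of the current one.
  refine (Achieves.forLoop (fun t s' => ∀ x y, y < n + m + 1 → (x < s.reg 4 ∨ x = s.reg 4 ∧ y < t) →
    s'.arr 4 (x * (n + m + 1) + y) = capOf n m a x y) initBody.steps
    (by simp) (a := 0) (b := n + m + 1) (by simp) (Nat.zero_le _) ?_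
    ?_ ?_).mono le_rfl ?_
  · intro x y hy hxy
    exact h₄ x (by omega) y hy
  · intro t s' hf _ _
    have := hs.of_frame hf (by simp [initBody, Stmt.forLoop, Stmt.WritesReg, Stmt.WritesArr])
    simp [this.vertices]
  · rintro t s' hf - htN ht hI
    have hL := hs.of_frame hf (by simp [initBody, Stmt.forLoop, Stmt.WritesReg, Stmt.WritesArr])
    have f₄ : s'.reg 4 = s.reg 4 := hf.1 4 (by simp [initBody, Stmt.forLoop, Stmt.WritesReg])
    have f₉ : s'.reg 9 = s.reg 9 := hf.1 9 (by simp [initBody, Stmt.forLoop, Stmt.WritesReg])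
    have f₇ : s'.arr 7 = s.arr 7 := hf.2 7 (by simp [initBody, Stmt.forLoop, Stmt.WritesArr])
    have hidx : Nat.size (s.reg 4 * (n + m + 1)) ≤ B := size_le_of_index hB (by omega) (by omega)
    have hstep : ∀ c, c = capOf n m a (s.reg 4) t → ∀ x y, y ≤ n + m →
        (x < s.reg 4 ∨ x = s.reg 4 ∧ y ≤ t) →
        Function.update (s'.arr 4) (s.reg 4 * (n + m + 1) + t) c (x * (n + m + 1) + y) =
          capOf n m a x y := by
      intro c hc x y hy hxy
      by_cases h : x = s.reg 4 ∧ y = t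
      · rw [h.1, h.2, Function.update_self, hc]
      · rw [Function.update_of_ne (fun h' => h ((index_inj (by omega) htN).1 h'))]
        exact hI x y (by omega) (by omega)
    refine Achieves.of_wp ?_
    simp [initBody, Stmt.wp, ht, hL.projects, hL.input, hL.vertices, f₄, f₉, f₇, h₉]
    refine ⟨fun h₀ => ⟨fun hm => ⟨fun ht₀ => ⟨fun htm => ⟨hidx, ?_⟩,
      fun htm => ⟨⟨?_, ?_⟩, hidx, ?_⟩⟩,
      fun ht₀ => ⟨hidx, ?_⟩⟩, fun hm => ⟨fun ht₀ => ⟨hidx, ?_⟩, fun ht₀ => ⟨hidx, ?_⟩⟩⟩,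
      fun h₀ => ⟨hidx, ?_⟩⟩
    · exact hstep _ (by rw [capOf, if_neg h₀, if_neg (by omega), if_neg ht₀, if_neg (by omega)])
    · exact size_le_of_index hB (by omega) (by omega)
    -- The factor from the input is an indicator, so the product is no longer than the big capacity
    -- itself.
    · have := hB.indicator (s.reg 4 - (m + 1)) (by omega) (t - 1) (by omega)
      exact (Nat.size_le_size ((Nat.mul_le_mul_left _ this).trans (mul_one _).le)).trans hB.big
    · exact hstep _ (by rw [capOf, if_neg h₀, if_neg (by omega), if_neg ht₀, if_pos (by omega)])
    · exact hstep _ (by rw [capOf, if_neg h₀, if_neg (by omega), if_pos ht₀])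
    · exact hstep _ (by rw [capOf, if_neg h₀, if_pos (by omega), if_neg ht₀])
    · exact hstep _ (by rw [h₇ _ (by omega), capOf, if_neg h₀, if_pos (by omega), if_pos ht₀])
    · exact hstep _ (by rw [capOf, if_pos h₀])
  · rintro s' - ⟨-, h⟩ x hx y hy
    exact h x y hy (by omega)

theorem initAll_spec (hB : Fits B n m a) (hs : Loaded n m a s)
    (h₉ : s.reg 9 = bigOf n m a (n + m + 2))
    (h₇ : ∀ u < n + m + 2, s.arr 7 u = scaled n m a u (n + m + 1)) :
    Achieves B initAll s (loopSteps 0 (.var 3) (n + m + 1)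
      (loopSteps 0 (.var 3) (n + m + 1) initBody.steps + initExcess.steps)) fun s' =>
      (∀ x < n + m + 1, ∀ y < n + m + 1, s'.arr 4 (x * (n + m + 1) + y) = capOf n m a x y) ∧
        ∀ x < n + m + 1, s'.arr 2 x = excessOf n m a x := by
  refine (Achieves.forLoop (fun t s' =>
    (∀ x < t, ∀ y < n + m + 1, s'.arr 4 (x * (n + m + 1) + y) = capOf n m a x y) ∧
        ∀ x < t, s'.arr 2 x = excessOf n m a x) _
    (by simp) (a := 0) (b := n + m + 1) (by simp) (Nat.zero_le _) (by simp)
    ?_ ?_).mono le_rfl fun s' _ h => h.2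
  · intro t s' hf _ _
    have := hs.of_frame hf (by simp [initRow, initExcess, initBody, Stmt.forLoop, Stmt.WritesReg,
      Stmt.WritesArr])
    simp [this.vertices]
  · rintro t s₁ hf - htN ht ⟨h₄, h₂⟩
    have hL := hs.of_frame hf (by simp [initRow, initExcess, initBody, Stmt.forLoop,
      Stmt.WritesReg, Stmt.WritesArr])
    have f₉ : s₁.reg 9 = s.reg 9 := hf.1 9 (by simp [initRow, initExcess, initBody, Stmt.forLoop,
      Stmt.WritesReg])
    have f₇ : s₁.arr 7 = s.arr 7 := hf.2 7 (by simp [initRow, initExcess, initBody, Stmt.forLoop,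
      Stmt.WritesArr])
    refine Achieves.seq (initRow_spec hB hL (by omega) (by rw [f₉, h₉])
      (by simpa [f₇] using h₇) (by rw [ht]; exact h₄)) ?_
    intro s₂ hf₂ h₄'
    have hL₂ := hL.of_frame hf₂ (by simp [initRow, initBody, Stmt.forLoop, Stmt.WritesReg,
      Stmt.WritesArr])
    have g₄ : s₂.reg 4 = t := (hf₂.1 4 (by simp [initRow, initBody,
      Stmt.forLoop, Stmt.WritesReg])).trans ht
    have g₇ : s₂.arr 7 = s₁.arr 7 := hf₂.2 7 (by simp [initRow, initBody,
      Stmt.forLoop, Stmt.WritesArr])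
    have g₂ : s₂.arr 2 = s₁.arr 2 := hf₂.2 2 (by simp [initRow, initBody,
      Stmt.forLoop, Stmt.WritesArr])
    refine Achieves.of_wp ?_
    rw [ht] at h₄'
    simp [initExcess, Stmt.wp, g₄, g₇, f₇, g₂, hL₂.projects]
    refine ⟨fun hm => ⟨fun x hx y hy => h₄' x (by omega) y (by omega), update_eq_of_le h₂ ?_⟩,
      fun hm => ⟨fun x hx y hy => h₄' x (by omega) y (by omega), update_eq_of_le h₂ ?_⟩⟩
    · rw [excessOf, if_neg (by omega), h₇ t (by omega)]
    · rw [excessOf, if_pos (by omega)]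

/-! ### The push-relabel loop -/

/-- The preflow stored in a state. -/
def preflow (N : ℕ) (s : State) : Preflow :=
  ⟨s.arr 2, s.arr 3, fun x y => if y < N then s.arr 4 (x * N + y) else 0⟩

@[simp] theorem preflow_setReg (N x c : ℕ) : preflow N (s.setReg x c) = preflow N s := rfl

/-- Push from register `4` to register `5`. -/
def pushBody : Stmt :=
  .ite (distance (.load 3 (.var 4)) (.load 3 (.var 5) + 1)) .skip
    (.seq (.assign 6 (.load 2 (.var 4) - (.load 2 (.var 4) - .load 4 (arc 4 5))))
    (.seq (.store 2 (.var 4) (.load 2 (.var 4) - .var 6))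
    (.seq (.store 2 (.var 5) (.load 2 (.var 5) + .var 6))
    (.seq (.store 4 (arc 4 5) (.load 4 (arc 4 5) - .var 6))
      (.store 4 (arc 5 4) (.load 4 (arc 5 4) + .var 6))))))

/-- Push from register `4` to all vertices. -/
def pushAll : Stmt := .forLoop 5 0 (.var 3) pushBody

/-- Relabel register `4` if it still has positive excess. -/
def relabelBody : Stmt :=
  .ite (.load 2 (.var 4)) (.store 3 (.var 4) (.load 3 (.var 4) + 1)) .skip

/-- Process register `4` if it has positive excess and a small label. -/
def processBody : Stmt :=
  .ite (.load 2 (.var 4))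
    (.ite (.var 3 - .load 3 (.var 4)) (.seq (.assign 7 1) (.seq pushAll relabelBody)) .skip) .skip

/-- Process all vertices. -/
def sweep : Stmt := .seq (.assign 7 0) (.forLoop 4 1 (.var 3) processBody)

/-- The push-relabel method. -/
def mainLoop : Stmt := .seq (.assign 7 1) (.whileLoop (.var 7) sweep)

/-- Equality holds on all naturals because `preflow` masks columns from `N` on, where addresses `x *
N + y` would collide. In the pushing branch the labels differ, so the two vertices are distinct and
the successive stores do not interfere. -/
theorem pushBody_spec {N : ℕ} (h₃ : s.reg 3 = N) (hu : s.reg 4 < N) (hv : s.reg 5 < N)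
    (hN : Nat.size (N * N) ≤ B) :
    Achieves B pushBody s pushBody.steps fun s' =>
      preflow N s' = (preflow N s).pushStep (s.reg 4) (s.reg 5) := by
  have hsu : Nat.size (s.reg 4 * N) ≤ B :=
    (Nat.size_le_size (Nat.mul_le_mul_right N hu.le)).trans hN
  have hsv : Nat.size (s.reg 5 * N) ≤ B :=
    (Nat.size_le_size (Nat.mul_le_mul_right N hv.le)).trans hN
  refine Achieves.of_wp ?_
  simp [pushBody, Stmt.wp, h₃, hsu, hsv]
  refine ⟨fun hd => ?_, fun h₁ h₂ => ?_⟩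
  · rw [Preflow.pushStep, if_neg]
    change s.arr 3 (s.reg 4) ≠ s.arr 3 (s.reg 5) + 1
    omega
  · have hd : s.arr 3 (s.reg 4) = s.arr 3 (s.reg 5) + 1 := by omega
    have hne : s.reg 4 ≠ s.reg 5 := by
      intro h
      rw [h] at hd
      omega
    have hij : s.reg 4 * N + s.reg 5 ≠ s.reg 5 * N + s.reg 4 := fun h =>
      hne ((index_inj hv hu).1 h).1
    rw [Preflow.pushStep, if_pos (by exact hd)]
    have hr : (preflow N s).r (s.reg 4) (s.reg 5) = s.arr 4 (s.reg 4 * N + s.reg 5) := by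
      simp [preflow, hv]
    have hr' : (preflow N s).r (s.reg 5) (s.reg 4) = s.arr 4 (s.reg 5 * N + s.reg 4) := by
      simp [preflow, hu]
    have hx : s.arr 2 (s.reg 4) - (s.arr 2 (s.reg 4) - s.arr 4 (s.reg 4 * N + s.reg 5)) =
        min (s.arr 2 (s.reg 4)) (s.arr 4 (s.reg 4 * N + s.reg 5)) := by omega
    rw [hx]
    ext x y
    · simp only [preflow, Preflow.push, hv, if_true, State.setArr_arr, State.setReg_arr,
        Function.update_apply, hne.symm, if_false]
      simp [Function.update_apply]
    · simp [preflow, Preflow.push]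
    · simp only [Preflow.push, hr, hr']
      by_cases hy : y < N
      · simp [preflow, hy, Function.update_apply, index_inj hy hu, index_inj hy hv, hij.symm]
      · have h₁ : y ≠ s.reg 4 := by omega
        have h₂ : y ≠ s.reg 5 := by omega
        simp [preflow, hy, h₁, h₂]

theorem pushAll_spec {N : ℕ} {Q : Finset ℕ → ℤ} (h₃ : s.reg 3 = N) (hu : s.reg 4 < N)
    (hN : Nat.size (N * N) ≤ B) (hG : (preflow N s).Good N Q) (he : s.arr 2 (s.reg 4) ≠ 0) :
    Achieves B pushAll s (loopSteps 0 (.var 3) N pushBody.steps) fun s' =>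
      (preflow N s').Scanned N Q (preflow N s) (s.reg 4) N := by
  refine (Achieves.forLoop (fun t s' => (preflow N s').Scanned N Q (preflow N s) (s.reg 4) t)
    pushBody.steps (by simp) (a := 0) (b := N) (by simp) (Nat.zero_le _) ?_
    ?_ ?_).mono le_rfl fun s' _ h => h.2
  · refine ⟨hG, rfl, ?_, nofun⟩
    rw [if_neg (by exact he), add_zero, preflow_setReg]
  · intro t s' hf _ _
    have : s'.reg 3 = s.reg 3 := hf.1 3 (by simp [pushBody, Stmt.forLoop, Stmt.WritesReg])
    simp [this, h₃]
  · rintro t s' hf - htN ht hI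
    have f₃ : s'.reg 3 = s.reg 3 := hf.1 3 (by simp [pushBody, Stmt.forLoop, Stmt.WritesReg])
    have f₄ : s'.reg 4 = s.reg 4 := hf.1 4 (by simp [pushBody, Stmt.forLoop, Stmt.WritesReg])
    refine (pushBody_spec (f₃.trans h₃) (f₄ ▸ hu) (ht ▸ htN) hN).mono le_rfl ?_
    intro s'' hf' h
    refine ⟨(hf'.1 5 (by simp [pushBody, Stmt.WritesReg])).trans ht, ?_⟩
    rw [preflow_setReg, h, ht, f₄]
    exact hI.step hu htN

/-- No vertex with a small label has positive excess. -/
def Stuck (G : Preflow) (N t : ℕ) : Prop :=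
  ∀ u < t, u ≠ 0 → 0 < G.e u → N ≤ G.d u

/-- An active vertex is either emptied by its pushes or, if excess remains after the scan,
relabelled; each outcome lowers the potential. An inactive one leaves the state alone. -/
theorem processBody_spec {N : ℕ} {Q : Finset ℕ → ℤ} (h₃ : s.reg 3 = N) (hu : s.reg 4 < N)
    (hu₀ : s.reg 4 ≠ 0) (hN : Nat.size (N * N) ≤ B) (hG : (preflow N s).Good N Q) :
    Achieves B processBody s
      ((Expr.load 2 (.var 4)).steps + ((Expr.var 3 - .load 3 (.var 4)).steps +
        ((Stmt.assign 7 1).steps + (loopSteps 0 (.var 3) N pushBody.steps + relabelBody.steps) + 1)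
        + 1)) fun s' =>
      (preflow N s').Good N Q ∧
        (s' = s ∧ (0 < (preflow N s).e (s.reg 4) → N ≤ (preflow N s).d (s.reg 4)) ∨
          s'.reg 7 = 1 ∧ (preflow N s').potential N + 1 ≤ (preflow N s).potential N) := by
  have hskip : ∀ k, (0 < (preflow N s).e (s.reg 4) → N ≤ (preflow N s).d (s.reg 4)) →
      Achieves B .skip s (k + 1) fun s' => (preflow N s').Good N Q ∧
        (s' = s ∧ (0 < (preflow N s).e (s.reg 4) → N ≤ (preflow N s).d (s.reg 4)) ∨
          s'.reg 7 = 1 ∧ (preflow N s').potential N + 1 ≤ (preflow N s).potential N) :=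
    fun k h => ⟨1, Nat.le_add_left 1 k, s, .skip s, hG, .inl ⟨rfl, h⟩⟩
  refine Achieves.ite (by simp) (fun he => Achieves.ite (by simp) (fun hd => ?_) fun hd => ?_)
    fun he => ?_
  · simp [h₃] at he hd
    refine Achieves.seq (P := fun s' => s' = s.setReg 7 1) (Achieves.of_wp (by simp [Stmt.wp])) ?_
    rintro _ - rfl
    refine Achieves.seq (pushAll_spec (by simpa using h₃) (by simpa using hu) hN hG
      (by simpa using he)) ?_
    intro s₂ hf₂ hsc
    have g₄ : s₂.reg 4 = s.reg 4 := (hf₂.1 4 (by simp [pushAll, pushBody,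
      Stmt.forLoop, Stmt.WritesReg])).trans (by simp)
    have g₇ : s₂.reg 7 = 1 := (hf₂.1 7 (by simp [pushAll, pushBody,
      Stmt.forLoop, Stmt.WritesReg])).trans (by simp)
    rw [preflow_setReg, State.setReg_reg_ne _ _ (by norm_num)] at hsc
    have hlab : s₂.arr 3 = s.arr 3 := hsc.labels
    refine Achieves.of_wp ?_
    simp [relabelBody, Stmt.wp, g₄, g₇]
    refine ⟨fun he₂ => ?_, fun he₂ => ⟨hsc.good, ?_⟩⟩
    · have hrel : preflow N (s₂.setArr 3 (s.reg 4) (s₂.arr 3 (s.reg 4) + 1)) =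
          (preflow N s₂).relabel (s.reg 4) := by
        simp [preflow, Preflow.relabel]
      rw [hrel]
      obtain ⟨h₁, h₂⟩ := hsc.relabel hu hu₀ (by
        change s₂.arr 3 (s.reg 4) < N
        rw [hlab]
        omega) he₂
      exact ⟨h₁, .inr h₂⟩
    · have := hsc.potential
      rw [if_pos (by exact he₂)] at this
      exact .inr this
  · simp [h₃] at hd
    exact hskip _ fun _ => Nat.sub_eq_zero_iff_le.1 hd
  · simp at he
    have hk : ∀ k : ℕ, (Expr.var 3 - .load 3 (.var 4)).steps + (k + 1) =
      ((Expr.var 3 - .load 3 (.var 4)).steps + k) + 1 := fun k => by omega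
    rw [hk]
    refine hskip _ fun h => ?_
    exact absurd he (Nat.pos_iff_ne_zero.1 h)

/-- The number of steps of processing a vertex. -/
def processSteps (N : ℕ) : ℕ :=
  (Expr.load 2 (.var 4)).steps + ((Expr.var 3 - .load 3 (.var 4)).steps +
    ((Stmt.assign 7 1).steps + (loopSteps 0 (.var 3) N pushBody.steps + relabelBody.steps) + 1) + 1)

/-- While the flag in register `7` is `0` the preflow has not changed, so the inactivity of the
vertices already visited is still valid at the end. The sweep starts at `1` to skip the sink. -/
theorem sweep_spec {N : ℕ} {Q : Finset ℕ → ℤ} (h₃ : s.reg 3 = N) (hN₀ : 1 ≤ N)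
    (hN : Nat.size (N * N) ≤ B) (hG : (preflow N s).Good N Q) :
    Achieves B sweep s
      ((Stmt.assign 7 0).steps + loopSteps 1 (.var 3) (N - 1) (processSteps N)) fun s' =>
      (preflow N s').Good N Q ∧
        (s'.reg 7 = 0 ∧ preflow N s' = preflow N s ∧ Stuck (preflow N s') N N ∨
          s'.reg 7 = 1 ∧ (preflow N s').potential N + 1 ≤ (preflow N s).potential N) := by
  refine Achieves.seq (P := fun s' => s' = s.setReg 7 0) (Achieves.of_wp (by simp [Stmt.wp])) ?_
  rintro _ - rfl
  refine (Achieves.forLoop (fun t s' => (preflow N s').Good N Q ∧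
    (s'.reg 7 = 0 ∧ preflow N s' = preflow N s ∧ Stuck (preflow N s') N t ∨
      s'.reg 7 = 1 ∧ (preflow N s').potential N + 1 ≤ (preflow N s).potential N))
    _ (by simp) (a := 1) (b := N) (by simp) hN₀ ?_ ?_ ?_).mono le_rfl fun s' _ h => h.2
  · refine ⟨hG, .inl ⟨by simp, rfl, ?_⟩⟩
    intro u hu hu₀
    omega
  · intro t s' hf _ _
    have : s'.reg 3 = s.reg 3 := (hf.1 3 (by simp [processBody, pushAll, relabelBody, pushBody,
      Stmt.forLoop, Stmt.WritesReg])).trans (by simp)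
    simp [this, h₃]
  · rintro t s' hf h1t htN ht ⟨hG', hI⟩
    have f₃ : s'.reg 3 = s.reg 3 := (hf.1 3 (by simp [processBody, pushAll, relabelBody, pushBody,
      Stmt.forLoop, Stmt.WritesReg])).trans (by simp)
    refine (processBody_spec (f₃.trans h₃) (ht ▸ htN) (by omega) hN hG').mono le_rfl ?_
    rintro s'' hf' ⟨hG'', h⟩
    refine ⟨(hf'.1 4 (by simp [processBody, pushAll, relabelBody, pushBody,
      Stmt.forLoop, Stmt.WritesReg])).trans ht, hG'', ?_⟩
    rw [preflow_setReg, State.setReg_reg_ne _ _ (by norm_num)]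
    rcases h with ⟨rfl, h⟩ | ⟨h₇, hpot⟩
    · rcases hI with ⟨h₇, heq, hst⟩ | hI
      · refine .inl ⟨h₇, heq, fun u hu hu₀ => ?_⟩
        rcases Nat.lt_succ_iff_lt_or_eq.1 hu with hu | rfl
        · exact hst u hu hu₀
        · rwa [ht] at h
      · exact .inr hI
    · refine .inr ⟨h₇, ?_⟩
      rcases hI with ⟨-, heq, -⟩ | ⟨-, hI⟩
      · rwa [heq] at hpot
      · omega

/-- A bound on the number of sweeps. -/
def sweepBound (N : ℕ) : ℕ := N * N * (N * N + 2) + N * N * (2 * N + 1) + 1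

theorem mainLoop_spec {N : ℕ} {Q : Finset ℕ → ℤ} (h₃ : s.reg 3 = N) (hN₀ : 1 ≤ N)
    (hN : Nat.size (N * N) ≤ B) (hG : (preflow N s).Good N Q) (hd : ∀ u < N, s.arr 3 u = 0) :
    Achieves B mainLoop s ((Stmt.assign 7 1).steps + (sweepBound N * ((Expr.var 7).steps +
      ((Stmt.assign 7 0).steps + loopSteps 1 (.var 3) (N - 1) (processSteps N)) + 1) +
        ((Expr.var 7).steps + 1))) fun s' =>
      (preflow N s').Good N Q ∧ Stuck (preflow N s') N N := by
  refine Achieves.seq (P := fun s' => s' = s.setReg 7 1) (Achieves.of_wp (by simp [Stmt.wp])) ?_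
  rintro _ - rfl
  refine (Achieves.whileLoop (e := .var 7) (c := sweep) (s := s.setReg 7 1)
    (fun s' => s'.reg 3 = N ∧ (preflow N s').Good N Q ∧
      (s'.reg 7 = 0 ∧ Stuck (preflow N s') N N ∨ s'.reg 7 = 1))
    -- The last sweep leaves the potential unchanged; adding the flag makes the variant drop there
    -- too, and accounts for the final `+ 1` in `sweepBound`.
    (fun s' => (preflow N s').potential N + s'.reg 7)
    ((Stmt.assign 7 0).steps + loopSteps 1 (.var 3) (N - 1) (processSteps N))
    (fun _ _ => trivial) ?_
    ⟨by simpa using h₃, hG, by simp⟩).mono ?_ ?_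
  · rintro s' ⟨h₃', hG', h₇⟩ hv
    have h₇ : s'.reg 7 = 1 := by
      rcases h₇ with h₇ | h₇
      · exact absurd h₇.1 hv
      · exact h₇
    refine (sweep_spec h₃' hN₀ hN hG').mono le_rfl ?_
    rintro s'' hf ⟨hG'', h⟩
    have f₃ : s''.reg 3 = s'.reg 3 := hf.1 3 (by simp [sweep, processBody, pushAll, relabelBody,
      pushBody, Stmt.forLoop, Stmt.WritesReg])
    refine ⟨⟨f₃.trans h₃', hG'', ?_⟩, ?_⟩
    · rcases h with ⟨h₁, -, h₂⟩ | ⟨h, -⟩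
      · exact .inl ⟨h₁, h₂⟩
      · exact .inr h
    · rcases h with ⟨h₁, h₂, -⟩ | ⟨h₁, h₂⟩
      · rw [h₁, h₂, h₇]
        omega
      · rw [h₁, h₇]
        omega
  · refine Nat.add_le_add_right (Nat.mul_le_mul_right _ ?_) _
    have := Preflow.potential_le (preflow N s) N hd
    simpa [sweepBound] using this
  · rintro s' - ⟨⟨-, hG', h⟩, hv⟩
    refine ⟨hG', ?_⟩
    rcases h with h | h
    · exact h.2
    · simp [h] at hv

end MaxPE

namespace MaxPE

open RAM

variable {B n m : ℕ} {a : ℕ → ℕ} {s : State}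

/-! ### The gap in the labels and the output -/

/-- Set register `7` if some label equals register `11`. -/
def checkLevel : Stmt :=
  .forLoop 4 0 (.var 3) (.ite (distance (.load 3 (.var 4)) (.var 11)) .skip (.assign 7 1))

/-- Store the level in register `11` if it does not occur as a label. -/
def storeGap : Stmt := .ite (.var 7) .skip (.assign 10 (.var 11))

/-- Find a positive number in register `10` that does not occur as a label. -/
def findGap : Stmt :=
  .forLoop 11 1 (.var 3 + 1) (.seq (.assign 7 0) (.seq checkLevel storeGap))

theorem checkLevel_spec {N : ℕ} (h₃ : s.reg 3 = N) (h₇ : s.reg 7 = 0) :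
    Achieves B checkLevel s (loopSteps 0 (.var 3) N
      (Stmt.ite (distance (.load 3 (.var 4)) (.var 11)) .skip (.assign 7 1)).steps) fun s' =>
      s'.reg 7 = 0 ↔ ∀ u < N, s.arr 3 u ≠ s.reg 11 := by
  refine (Achieves.forLoop (fun t s' => s'.reg 7 = 0 ↔ ∀ u < t, s.arr 3 u ≠ s.reg 11) _
    (by simp) (a := 0) (b := N) (by simp) (Nat.zero_le _) (by simp [h₇])
    ?_ ?_).mono le_rfl fun s' _ h => h.2
  · intro t s' hf _ _
    have : s'.reg 3 = s.reg 3 := hf.1 3 (by simp [Stmt.forLoop, Stmt.WritesReg])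
    simp [this, h₃]
  · rintro t s' hf - htN ht hI
    have f₁₁ : s'.reg 11 = s.reg 11 := hf.1 11 (by simp [Stmt.forLoop, Stmt.WritesReg])
    have f₃ : s'.arr 3 = s.arr 3 := hf.2 3 (by simp [Stmt.forLoop, Stmt.WritesArr])
    refine Achieves.of_wp ?_
    simp [Stmt.wp, ht, f₁₁, f₃]
    refine ⟨fun hne => ?_, fun h₁ h₂ => ⟨t, le_rfl, by omega⟩⟩
    rw [hI]
    refine ⟨fun h u hu => ?_, fun h u hu => h u hu.le⟩
    rcases hu.lt_or_eq with hu | rfl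
    · exact h u hu
    · omega

theorem findGap_spec {N : ℕ} (h₃ : s.reg 3 = N) (hN : 1 ≤ N) (h₀ : s.arr 3 0 = 0) :
    Achieves B findGap s (loopSteps 1 (.var 3 + 1) N ((Stmt.assign 7 0).steps +
      (loopSteps 0 (.var 3) N
        (Stmt.ite (distance (.load 3 (.var 4)) (.var 11)) .skip (.assign 7 1)).steps +
          storeGap.steps))) fun s' =>
      1 ≤ s'.reg 10 ∧ s'.reg 10 ≤ N ∧ ∀ u < N, s.arr 3 u ≠ s'.reg 10 := by
  -- Either all levels tried so far occur or a gap is already stored; `Preflow.exists_gap` excludes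
  -- the first case at the end.
  refine (Achieves.forLoop (fun t s' => (∀ l, 1 ≤ l → l < t → ∃ u < N, s.arr 3 u = l) ∨
    (1 ≤ s'.reg 10 ∧ s'.reg 10 ≤ N ∧ ∀ u < N, s.arr 3 u ≠ s'.reg 10)) _
    (by simp) (a := 1) (b := N + 1) (by simp) (Nat.le_add_left 1 N) ?_ ?_ ?_).mono le_rfl ?_
  · left
    intro l h₁ h₂
    omega
  · intro t s' hf _ _
    have : s'.reg 3 = s.reg 3 := hf.1 3 (by simp [checkLevel, storeGap, Stmt.forLoop,
      Stmt.WritesReg])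
    simp [this, h₃]
  · rintro t s₁ hf h1t htN ht hI
    have f₃ : s₁.reg 3 = s.reg 3 := hf.1 3 (by simp [checkLevel, storeGap, Stmt.forLoop,
      Stmt.WritesReg])
    have fd : s₁.arr 3 = s.arr 3 := hf.2 3 (by simp [checkLevel, storeGap, Stmt.forLoop,
      Stmt.WritesArr])
    refine Achieves.seq (P := fun s' => s' = s₁.setReg 7 0) (Achieves.of_wp (by simp [Stmt.wp])) ?_
    rintro _ - rfl
    refine Achieves.seq (checkLevel_spec (by simpa [f₃] using h₃) (by simp)) ?_
    intro s₂ hf₂ h₇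
    have g₁₀ : s₂.reg 10 = s₁.reg 10 := (hf₂.1 10 (by simp [checkLevel,
      Stmt.forLoop, Stmt.WritesReg])).trans (by simp)
    have g₁₁ : s₂.reg 11 = t := (hf₂.1 11 (by simp [checkLevel,
      Stmt.forLoop, Stmt.WritesReg])).trans (by simp [ht])
    simp [fd, ht] at h₇
    refine Achieves.of_wp ?_
    simp only [storeGap, Stmt.wp, Expr.ok_var, Expr.eval_var, true_and]
    refine ⟨fun hne => ⟨g₁₁, ?_⟩, fun heq => ⟨by simp [g₁₁], ?_⟩⟩
    · simp only [State.setReg_reg_ne _ _ (show (10 : ℕ) ≠ 11 by norm_num), g₁₀]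
      rcases hI with hI | hI
      · left
        intro l h₁ h₂
        rcases Nat.lt_succ_iff_lt_or_eq.1 h₂ with h₂ | rfl
        · exact hI l h₁ h₂
        · have := mt h₇.2 hne
          push Not at this
          exact this
      · exact .inr hI
    · right
      simp only [State.setReg_reg_ne _ _ (show (10 : ℕ) ≠ 11 by norm_num), State.setReg_reg_self,
        g₁₁]
      exact ⟨h1t, by omega, h₇.1 heq⟩
  · rintro s' - ⟨-, h | h⟩
    · obtain ⟨g, h₁, h₂, h₃⟩ := Preflow.exists_gap (s.arr 3) h₀ hN
      obtain ⟨u, hu, hd⟩ := h g h₁ (Nat.lt_succ_of_le h₂)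
      exact absurd hd (h₃ u hu)
    · exact h

/-- Sum up the excesses. -/
def sumExcess : Stmt := .forLoop 4 1 (.var 3) (.assign 8 (.var 8 + .load 2 (.var 4)))

/-- Write the indicator list of the projects whose labels are above the gap. -/
def writeBundle : Stmt :=
  .forLoop 4 0 (.var 2) (.store 1 (.var 4 + 2) (1 - (.var 10 - .load 3 (.var 4 + 1))))

/-- Write the fraction in register `8` and the last entry of array `7`. -/
def writeValue : Stmt := .seq (.store 1 0 (.var 8)) (.store 1 1 (.load 7 (.var 3)))

/-- Write the solution. -/
def output : Stmt :=
  .seq (.assign 8 0) (.seq sumExcess (.seq writeValue (.seq writeBundle (.assign 0 (.var 2 + 2)))))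

theorem sumExcess_spec {N : ℕ} (h₃ : s.reg 3 = N) (hN : 1 ≤ N) (h₈ : s.reg 8 = 0) :
    Achieves B sumExcess s (loopSteps 1 (.var 3) (N - 1)
      (Stmt.assign 8 (.var 8 + .load 2 (.var 4))).steps) fun s' =>
      s'.reg 8 = ∑ u ∈ Finset.Ico 1 N, s.arr 2 u := by
  refine (Achieves.forLoop (fun t s' => s'.reg 8 = ∑ u ∈ Finset.Ico 1 t, s.arr 2 u) _
    (by simp) (a := 1) (b := N) (by simp) hN (by simp [h₈])
    ?_ ?_).mono le_rfl fun s' _ h => h.2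
  · intro t s' hf _ _
    have : s'.reg 3 = s.reg 3 := hf.1 3 (by simp [Stmt.forLoop, Stmt.WritesReg])
    simp [this, h₃]
  · rintro t s' hf h1t htN ht hI
    have f₂ : s'.arr 2 = s.arr 2 := hf.2 2 (by simp [Stmt.forLoop, Stmt.WritesArr])
    refine Achieves.of_wp ?_
    simp [Stmt.wp, ht, f₂, hI, Finset.sum_Ico_succ_top h1t]

/-- By truncated subtraction `1 - (g - d)` is the indicator of `g ≤ d`. Two output cells are taken
by the fraction, and project `j` is vertex `j + 1`. -/
theorem writeBundle_spec (h₂ : s.reg 2 = m) :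
    Achieves B writeBundle s (loopSteps 0 (.var 2) m
      (Stmt.store 1 (.var 4 + 2) (1 - (.var 10 - .load 3 (.var 4 + 1)))).steps) fun s' =>
      s'.arr 1 0 = s.arr 1 0 ∧ s'.arr 1 1 = s.arr 1 1 ∧
        ∀ j < m, s'.arr 1 (j + 2) = if s.reg 10 ≤ s.arr 3 (j + 1) then 1 else 0 := by
  refine (Achieves.forLoop (fun t s' => s'.arr 1 0 = s.arr 1 0 ∧ s'.arr 1 1 = s.arr 1 1 ∧
    ∀ j < t, s'.arr 1 (j + 2) = if s.reg 10 ≤ s.arr 3 (j + 1) then 1 else 0) _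
    (by simp) (a := 0) (b := m) (by simp) (Nat.zero_le _) (by simp)
    ?_ ?_).mono le_rfl fun s' _ h => h.2
  · intro t s' hf _ _
    have : s'.reg 2 = s.reg 2 := hf.1 2 (by simp [Stmt.forLoop, Stmt.WritesReg])
    simp [this, h₂]
  · rintro t s' hf - htN ht ⟨h₀, h₁, hI⟩
    have f₁₀ : s'.reg 10 = s.reg 10 := hf.1 10 (by simp [Stmt.forLoop, Stmt.WritesReg])
    have f₃ : s'.arr 3 = s.arr 3 := hf.2 3 (by simp [Stmt.forLoop, Stmt.WritesArr])
    refine Achieves.of_wp ?_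
    simp [Stmt.wp, ht, f₁₀, f₃, h₀, h₁, Function.update_apply]
    intro j hj
    by_cases hjt : j = t
    · subst hjt
      rw [if_pos rfl]
      split_ifs <;> omega
    · rw [if_neg hjt]
      exact hI j (by omega)

/-- A bound on the number of steps of the output. -/
def outputSteps (N : ℕ) : ℕ :=
  (Stmt.assign 8 0).steps + (loopSteps 1 (.var 3) N
    (Stmt.assign 8 (.var 8 + .load 2 (.var 4))).steps + (writeValue.steps +
    (loopSteps 0 (.var 2) N
      (Stmt.store 1 (.var 4 + 2) (1 - (.var 10 - .load 3 (.var 4 + 1)))).steps +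
    (Stmt.assign 0 (.var 2 + 2)).steps)))

theorem loopSteps_mono {lo hi : Expr} {l l' k k' : ℕ} (hl : l ≤ l') (hk : k ≤ k') :
    loopSteps lo hi l k ≤ loopSteps lo hi l' k' := by
  unfold loopSteps
  gcongr

theorem output_spec (hs : Loaded n m a s) :
    Achieves B output s (outputSteps (n + m + 1)) fun s' =>
      s'.reg 0 = m + 2 ∧ s'.arr 1 0 = ∑ u ∈ Finset.Ico 1 (n + m + 1), s.arr 2 u ∧
        s'.arr 1 1 = s.arr 7 (n + m + 1) ∧
        ∀ j < m, s'.arr 1 (j + 2) = if s.reg 10 ≤ s.arr 3 (j + 1) then 1 else 0 := by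
  refine Achieves.seq (P := fun s' => s' = s.setReg 8 0) (Achieves.of_wp (by simp [Stmt.wp])) ?_
  rintro _ - rfl
  refine Achieves.seq ((sumExcess_spec (by simpa using hs.vertices) (Nat.le_add_left 1 _)
    (by simp)).mono (loopSteps_mono (Nat.sub_le _ 1) le_rfl) fun _ _ h => h) ?_
  intro s₁ hf₁ h₈
  have e₁ : ∀ x, x ≠ 4 → x ≠ 8 → s₁.reg x = s.reg x := by
    intro x h₁ h₂
    exact (hf₁.1 x (by simp [sumExcess, Stmt.forLoop, Stmt.WritesReg, h₁, h₂])).trans (by simp [h₂])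
  have e₂ : ∀ x, s₁.arr x = s.arr x := by
    intro x
    exact hf₁.2 x (by simp [sumExcess, Stmt.forLoop, Stmt.WritesArr])
  refine Achieves.seq (P := fun s' => (s'.arr 1 0 = s₁.reg 8 ∧ s'.arr 1 1 = s₁.arr 7 (s₁.reg 3)))
    (Achieves.of_wp ?_) ?_
  · simp [writeValue, Stmt.wp]
  rintro s₂ hf₂ ⟨h₀, h₁⟩
  have e₃ : ∀ x, s₂.reg x = s₁.reg x := by
    intro x
    exact hf₂.1 x (by simp [writeValue, Stmt.WritesReg])
  have e₄ : s₂.arr 3 = s₁.arr 3 := hf₂.2 3 (by simp [writeValue, Stmt.WritesArr])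
  refine Achieves.seq ((writeBundle_spec ((e₃ 2).trans ((e₁ 2 (by norm_num) (by norm_num)).trans
    hs.projects))).mono (loopSteps_mono (by omega) le_rfl) fun _ _ h => h) ?_
  rintro s₃ hf₃ ⟨k₀, k₁, k⟩
  have e₅ : s₃.reg 2 = m := (hf₃.1 2 (by simp [writeBundle, Stmt.forLoop, Stmt.WritesReg])).trans
    ((e₃ 2).trans ((e₁ 2 (by norm_num) (by norm_num)).trans hs.projects))
  refine Achieves.of_wp ?_
  simp only [Stmt.wp, Expr.ok_add, Expr.ok_var, Expr.ok_ofNat, Expr.eval_add, Expr.eval_var,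
    Expr.eval_ofNat, and_self, true_and, State.setReg_reg_self, State.setReg_arr, e₅]
  refine ⟨?_, ?_, ?_⟩
  · rw [k₀, h₀, h₈]
    rfl
  · rw [k₁, h₁, e₂, e₁ 3 (by norm_num) (by norm_num), hs.vertices]
  · intro j hj
    rw [k j hj, e₄, e₂, e₃, e₁ 10 (by norm_num) (by norm_num)]

/-! ### The whole program -/

/-- Read the sizes of the instance. -/
def setup : Stmt :=
  .seq (.assign 1 (.load 0 0)) (.seq (.assign 2 (.load 0 1)) (.assign 3 (.var 1 + .var 2 + 1)))

/-- The program that solves the maximization problem. -/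
def program : Stmt :=
  .seq setup (.seq readAll (.seq scaleAll (.seq initAll (.seq mainLoop (.seq findGap output)))))

/-- A bound on the number of steps of the program. -/
def programSteps (N : ℕ) : ℕ :=
  setup.steps + (loopSteps 0 (.var 3) N readBody.steps +
    (((Stmt.assign 9 1).steps + loopSteps 0 (.var 3 + 1) (N + 1)
      ((Stmt.assign 8 1).steps +
        (loopSteps 0 (.var 3) N scaleBody.steps + storeScaled.steps))) +
    (loopSteps 0 (.var 3) N (loopSteps 0 (.var 3) N initBody.steps + initExcess.steps) +
    (((Stmt.assign 7 1).steps + (sweepBound N * ((Expr.var 7).steps +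
      ((Stmt.assign 7 0).steps + loopSteps 1 (.var 3) N (processSteps N)) + 1) +
        ((Expr.var 7).steps + 1))) +
    (loopSteps 1 (.var 3 + 1) N ((Stmt.assign 7 0).steps +
      (loopSteps 0 (.var 3) N
        (Stmt.ite (distance (.load 3 (.var 4)) (.var 11)) .skip (.assign 7 1)).steps +
          storeGap.steps)) +
    outputSteps N)))))

/-- The initial preflow. -/
def initial (n m : ℕ) (a : ℕ → ℕ) : Preflow := ⟨excessOf n m a, fun _ => 0, capOf n m a⟩

/-- What survives of the run is exactly what optimality needs: a stuck preflow with the initial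
surpluses and a gap in its labels. -/
theorem program_spec (hB : Fits B n m a) (ha : s.arr 0 = a) (hn : a 0 = n) (hm : a 1 = m)
    (h₃ : ∀ u, s.arr 3 u = 0) :
    Achieves B program s (programSteps (n + m + 1)) fun s' =>
      ∃ (G : Preflow) (g : ℕ), G.Good (n + m + 1) ((initial n m a).surplus (n + m + 1)) ∧
        Stuck G (n + m + 1) (n + m + 1) ∧ 1 ≤ g ∧ g ≤ n + m + 1 ∧
        (∀ u < n + m + 1, G.d u ≠ g) ∧ s'.reg 0 = m + 2 ∧
        s'.arr 1 0 = ∑ u ∈ Finset.Ico 1 (n + m + 1), G.e u ∧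
        s'.arr 1 1 = scaled n m a (n + m + 1) (n + m + 1) ∧
        ∀ j < m, s'.arr 1 (j + 2) = if g ≤ G.d (j + 1) then 1 else 0 := by
  refine Achieves.seq (P := Loaded n m a) (Achieves.of_wp ?_) ?_
  · simp [setup, Stmt.wp, ha, hn, hm]
    exact ⟨by simp [ha], by simp, by simp, by simp⟩
  intro s₁ f₁ L₁
  refine Achieves.seq (readAll_spec hB L₁) ?_
  rintro s₂ f₂ ⟨h₅, h₆⟩
  have L₂ := L₁.of_frame f₂ (by simp [readAll, readBody, Stmt.forLoop, Stmt.WritesReg,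
    Stmt.WritesArr])
  refine Achieves.seq (scaleAll_spec hB L₂ h₅ h₆) ?_
  rintro s₃ f₃ ⟨h₉, h₇⟩
  have L₃ := L₂.of_frame f₃ (by simp [scaleAll, scaleOne, scaleBody, storeScaled, Stmt.forLoop,
    Stmt.WritesReg, Stmt.WritesArr])
  refine Achieves.seq (initAll_spec hB L₃ h₉ h₇) ?_
  rintro s₄ f₄ ⟨hr, he⟩
  have L₄ := L₃.of_frame f₄ (by simp [initAll, initRow, initBody, initExcess, Stmt.forLoop,
    Stmt.WritesReg, Stmt.WritesArr])
  have hd : ∀ u, s₄.arr 3 u = 0 := by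
    intro u
    rw [f₄.2 3 (by simp [initAll, initRow, initBody, initExcess, Stmt.forLoop, Stmt.WritesArr]),
      f₃.2 3 (by simp [scaleAll, scaleOne, scaleBody, storeScaled, Stmt.forLoop, Stmt.WritesArr]),
      f₂.2 3 (by simp [readAll, readBody, Stmt.forLoop, Stmt.WritesArr]),
      f₁.2 3 (by simp [setup, Stmt.WritesArr]), h₃]
  have hG : (preflow (n + m + 1) s₄).Good (n + m + 1) ((initial n m a).surplus (n + m + 1)) := by
    refine ⟨⟨hd 0, fun u _ => (hd u).le.trans (Nat.zero_le _), fun u _ v _ _ =>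
      (hd u).le.trans (Nat.zero_le _)⟩, fun S hS => Preflow.surplus_congr he ?_ hS⟩
    intro u hu v hv
    simp only [preflow, initial, hv, if_true]
    exact hr u hu v hv
  refine Achieves.seq ((mainLoop_spec L₄.vertices (Nat.le_add_left 1 _)
    (size_le_of_index hB (by omega) (by omega)) hG fun u _ => hd u).mono
    (Nat.add_le_add_left (Nat.add_le_add_right (Nat.mul_le_mul_left _ (Nat.add_le_add_right
      (Nat.add_le_add_left (Nat.add_le_add_left
        (loopSteps_mono (Nat.sub_le _ 1) le_rfl) _) _) _)) _) _)
    fun _ _ h => h) ?_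
  rintro s₅ f₅ ⟨hG₅, hst⟩
  have L₅ := L₄.of_frame f₅ (by simp [mainLoop, sweep, processBody, pushAll, pushBody, relabelBody,
    Stmt.forLoop, Stmt.WritesReg, Stmt.WritesArr])
  refine Achieves.seq (findGap_spec L₅.vertices (Nat.le_add_left 1 _) hG₅.valid.zero) ?_
  rintro s₆ f₆ ⟨hg₁, hg₂, hg₃⟩
  have L₆ := L₅.of_frame f₆ (by simp [findGap, checkLevel, storeGap, Stmt.forLoop, Stmt.WritesReg,
    Stmt.WritesArr])
  refine (output_spec L₆).mono le_rfl ?_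
  rintro s₇ - ⟨o₁, o₂, o₃, o₄⟩
  have e₂ : s₆.arr 2 = s₅.arr 2 :=
    f₆.2 2 (by simp [findGap, checkLevel, storeGap, Stmt.forLoop, Stmt.WritesArr])
  have e₃ : s₆.arr 3 = s₅.arr 3 :=
    f₆.2 3 (by simp [findGap, checkLevel, storeGap, Stmt.forLoop, Stmt.WritesArr])
  have e₇ : s₆.arr 7 = s₃.arr 7 :=
    (f₆.2 7 (by simp [findGap, checkLevel, storeGap, Stmt.forLoop, Stmt.WritesArr])).trans
    ((f₅.2 7 (by simp [mainLoop, sweep, processBody, pushAll, pushBody, relabelBody,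
      Stmt.forLoop, Stmt.WritesArr])).trans
    (f₄.2 7 (by simp [initAll, initRow, initBody, initExcess, Stmt.forLoop, Stmt.WritesArr])))
  refine ⟨preflow (n + m + 1) s₅, s₆.reg 10, hG₅, hst, hg₁, hg₂, hg₃, o₁, ?_, ?_, ?_⟩
  · rw [o₂, e₂]
    rfl
  · rw [o₃, e₇, h₇ _ (by omega)]
  · intro j hj
    rw [o₄ j hj, e₃]
    rfl

theorem program_below : program.Below 12 := by
  simp only [program, setup, readAll, readBody, scaleAll, scaleOne, scaleBody, storeScaled, initAll,
    initRow, initBody, initExcess, mainLoop, sweep, processBody, pushAll, pushBody, relabelBody,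
    findGap, checkLevel, storeGap, output, sumExcess, writeBundle, writeValue, Stmt.forLoop,
    distance, arc]
  repeat' constructor

/-! ### Polynomial bounds -/

/-- The function is given by a polynomial with natural coefficients. -/
def IsNatPoly (f : ℕ → ℕ) : Prop := ∃ P : Polynomial ℕ, ∀ x, f x = P.eval x

theorem IsNatPoly.const (c : ℕ) : IsNatPoly fun _ => c := ⟨Polynomial.C c, by simp⟩

theorem IsNatPoly.id : IsNatPoly fun x => x := ⟨Polynomial.X, by simp⟩

theorem IsNatPoly.add {f g : ℕ → ℕ} (hf : IsNatPoly f) (hg : IsNatPoly g) :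
    IsNatPoly fun x => f x + g x := by
  obtain ⟨P, hP⟩ := hf
  obtain ⟨R, hR⟩ := hg
  exact ⟨P + R, by simp [hP, hR]⟩

theorem IsNatPoly.mul {f g : ℕ → ℕ} (hf : IsNatPoly f) (hg : IsNatPoly g) :
    IsNatPoly fun x => f x * g x := by
  obtain ⟨P, hP⟩ := hf
  obtain ⟨R, hR⟩ := hg
  exact ⟨P * R, by simp [hP, hR]⟩

theorem IsNatPoly.monotone {f : ℕ → ℕ} (hf : IsNatPoly f) : Monotone f := by
  obtain ⟨P, hP⟩ := hf
  intro x y hxy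
  simp only [hP, Polynomial.eval_eq_sum_range]
  gcongr

theorem IsNatPoly.loopSteps {lo hi : Expr} {f g : ℕ → ℕ} (hf : IsNatPoly f) (hg : IsNatPoly g) :
    IsNatPoly fun x => loopSteps lo hi (f x) (g x) :=
  (const _).add ((hf.mul (((const _).add hg).add (const _))).add (const _))

theorem isNatPoly_programSteps : IsNatPoly programSteps := by
  have hp : IsNatPoly processSteps :=
    (IsNatPoly.const _).add (((IsNatPoly.const _).add (((IsNatPoly.const _).add
      ((IsNatPoly.id.loopSteps (.const _)).add (.const _))).add (.const _))).add (.const _))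
  have hs : IsNatPoly sweepBound :=
    (((IsNatPoly.id.mul .id).mul ((IsNatPoly.id.mul .id).add (.const _))).add
      ((IsNatPoly.id.mul .id).mul (((IsNatPoly.const _).mul .id).add (.const _)))).add (.const _)
  have ho : IsNatPoly outputSteps :=
    (IsNatPoly.const _).add ((IsNatPoly.id.loopSteps (.const _)).add ((IsNatPoly.const _).add
      ((IsNatPoly.id.loopSteps (.const _)).add (.const _))))
  exact (IsNatPoly.const _).add ((IsNatPoly.id.loopSteps (.const _)).add
    (((IsNatPoly.const _).add ((IsNatPoly.id.add (.const _)).loopSteps ((IsNatPoly.const _).add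
      ((IsNatPoly.id.loopSteps (.const _)).add (.const _))))).add
    ((IsNatPoly.id.loopSteps ((IsNatPoly.id.loopSteps (.const _)).add (.const _))).add
    (((IsNatPoly.const _).add ((hs.mul (((IsNatPoly.const _).add ((IsNatPoly.const _).add
      (IsNatPoly.id.loopSteps hp))).add (.const _))).add (.const _))).add
    ((IsNatPoly.id.loopSteps ((IsNatPoly.const _).add ((IsNatPoly.id.loopSteps (.const _)).add
      (.const _)))).add ho)))))

end MaxPE

/-! ### The input array -/

theorem List.length_flatten_ofFn {k : ℕ} : ∀ {n : ℕ} (f : Fin n → List ℕ),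
    (∀ i, (f i).length = k) → (List.ofFn f).flatten.length = n * k
  | 0, f, _ => by simp
  | n + 1, f, hf => by
    rw [List.ofFn_succ, List.flatten_cons, List.length_append, hf,
      List.length_flatten_ofFn _ fun i => hf i.succ]
    ring

theorem List.getD_flatten_ofFn {k c : ℕ} (hc : c < k) : ∀ {n : ℕ} (f : Fin n → List ℕ),
    (∀ i, (f i).length = k) → ∀ i : Fin n,
      (List.ofFn f).flatten.getD (i * k + c) 0 = (f i).getD c 0
  | 0, _, _, i => i.elim0
  | n + 1, f, hf, i => by
    rw [List.ofFn_succ, List.flatten_cons]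
    refine Fin.cases ?_ (fun i => ?_) i
    · rw [Fin.val_zero, zero_mul, zero_add, List.getD_append _ _ _ _ (by rw [hf]; exact hc)]
    · rw [List.getD_append_right _ _ _ _ (by
        rw [hf, Fin.val_succ, add_mul, one_mul, add_assoc, add_comm k c, ← add_assoc]
        exact Nat.le_add_left k _)]
      rw [← List.getD_flatten_ofFn hc (fun i => f i.succ) (fun i => hf i.succ) i, hf]
      congr 1
      rw [Fin.val_succ, add_mul, one_mul]
      omega

namespace SMInput

open RAM MaxPE

variable (I : SMInput)

/-- The input array. -/
def array (x : ℕ) : ℕ := I.encode.getD x 0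

/-- The data of an agent in the encoding. -/
def agentList (i : Fin I.n) : List ℕ :=
  [(I.z i).num, (I.z i).den, (I.b i).num, (I.b i).den] ++ indicatorList (I.D i)

theorem length_agentList (i : Fin I.n) : (I.agentList i).length = I.m + 4 := by
  simp [agentList, indicatorList]

theorem encode_eq : I.encode = I.n :: I.m :: ((List.ofFn I.agentList).flatten ++
    (List.ofFn fun j : Fin I.m => [(I.C j).num, (I.C j).den]).flatten) := rfl

theorem array_add_two (x : ℕ) : I.array (2 + x) = ((List.ofFn I.agentList).flatten ++
    (List.ofFn fun j : Fin I.m => [(I.C j).num, (I.C j).den]).flatten).getD x 0 := by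
  rw [array, encode_eq, Nat.add_comm 2 x]
  rfl

theorem array_agent (i : Fin I.n) {c : ℕ} (hc : c < I.m + 4) :
    I.array (2 + i * (I.m + 4) + c) = (I.agentList i).getD c 0 := by
  have hlt : (i : ℕ) * (I.m + 4) + c < I.n * (I.m + 4) := by
    have : ((i : ℕ) + 1) * (I.m + 4) ≤ I.n * (I.m + 4) := Nat.mul_le_mul_right _ i.2
    rw [add_mul, one_mul] at this
    omega
  rw [add_assoc, array_add_two, List.getD_append _ _ _ _ (by
    rwa [List.length_flatten_ofFn _ I.length_agentList]),
    List.getD_flatten_ofFn hc _ I.length_agentList]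

theorem array_project (j : Fin I.m) {c : ℕ} (hc : c < 2) :
    I.array (2 + I.n * (I.m + 4) + 2 * j + c) = [(I.C j).num, (I.C j).den].getD c 0 := by
  have hlen := List.length_flatten_ofFn _ I.length_agentList
  rw [add_assoc, add_assoc, array_add_two, List.getD_append_right _ _ _ _ (by rw [hlen]; omega),
    hlen,
    Nat.add_sub_cancel_left, mul_comm 2, List.getD_flatten_ofFn hc _ fun _ => rfl]

theorem array_indicator (i : Fin I.n) (j : Fin I.m) :
    I.array (2 + i * (I.m + 4) + (4 + j)) = if j ∈ I.D i then 1 else 0 := by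
  rw [I.array_agent i (by omega), agentList, List.getD_append_right _ _ _ _ (by simp)]
  simp [indicatorList]

theorem length_encode : I.n + I.m + 1 ≤ I.encode.length := by
  rw [encode_eq]
  simp only [List.length_cons, List.length_append, List.length_flatten_ofFn _ I.length_agentList]
  rw [List.length_flatten_ofFn (k := 2) _ fun _ => rfl]
  nlinarith [Nat.zero_le (I.n * I.m)]

end SMInput

/-! ### Bit lengths of the input and of all products -/

theorem RAM.length_le_bitLength (l : List ℕ) : l.length ≤ RAM.bitLength l := by
  induction l with
  | nil => simp
  | cons c l ih =>
    rw [RAM.bitLength, List.map_cons, List.sum_cons, List.length_cons]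
    rw [RAM.bitLength] at ih
    omega

theorem RAM.size_getD_le_bitLength (l : List ℕ) : ∀ x, Nat.size (l.getD x 0) ≤ RAM.bitLength l := by
  induction l with
  | nil => simp
  | cons c l ih =>
    intro x
    rw [RAM.bitLength, List.map_cons, List.sum_cons]
    cases x with
    | zero =>
      rw [List.getD_cons_zero]
      omega
    | succ x =>
      rw [List.getD_cons_succ]
      exact (ih x).trans (Nat.le_add_left _ _)

namespace MaxPE

open RAM

/-- A bound on the bit lengths of all products for inputs of length `L`. -/
def bitBound (L : ℕ) : ℕ := 2 * L * L + 2 * L + 8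

/-- Each weight has numerator and denominator at most `2 ^ (2 * L)`, and a scaled weight is a
product of at most `L` of these, hence at most `2 ^ (2 * L * L)`. The remaining terms of `bitBound`
cover the sum in `bigOf` and the array addresses. -/
theorem fits_of_size_le {n m L : ℕ} {a : ℕ → ℕ} (hL : n + m + 1 ≤ L)
    (ha : ∀ x, Nat.size (a x) ≤ L)
    (hind : ∀ i < n, ∀ j < m, a (2 + i * (m + 4) + (4 + j)) ≤ 1) : Fits (bitBound L) n m a := by
  have ha' : ∀ x, a x ≤ 2 ^ L := fun x => (Nat.size_le.1 (ha x)).le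
  have h₁ : ∀ x y, a x * a y ≤ 2 ^ (2 * L) := by
    intro x y
    rw [two_mul, pow_add]
    exact Nat.mul_le_mul (ha' x) (ha' y)
  have h₂ : ∀ x, a x ≤ 2 ^ (2 * L) := fun x =>
    (ha' x).trans (Nat.pow_le_pow_right (by norm_num) (by omega))
  have hsize : ∀ {x k : ℕ}, x ≤ 2 ^ k → k < bitBound L → Nat.size x ≤ bitBound L := by
    intro x k hx hk
    exact Nat.size_le.2 (hx.trans_lt (Nat.pow_lt_pow_right (by norm_num) hk))
  have hlt : 2 * L < bitBound L := by
    unfold bitBound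
    omega
  have hnum : ∀ u, numOf n m a u ≤ 2 ^ (2 * L) := by
    intro u
    unfold numOf
    split_ifs
    · exact Nat.zero_le _
    · exact h₂ _
    · exact (min_le_left _ _).trans (h₁ _ _)
  have hden : ∀ u, denOf n m a u ≤ 2 ^ (2 * L) := by
    intro u
    unfold denOf
    split_ifs
    · exact Nat.one_le_two_pow
    · exact h₂ _
    · exact h₁ _ _
  have hsc : ∀ u t, t ≤ n + m + 1 → scaled n m a u t ≤ 2 ^ (2 * L * L) := by
    intro u t ht
    have : scaled n m a u t ≤ ∏ _s ∈ Finset.range t, 2 ^ (2 * L) := by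
      refine Finset.prod_le_prod' fun s _ => ?_
      split_ifs
      · exact hnum s
      · exact hden s
    rw [Finset.prod_const, Finset.card_range, ← pow_mul] at this
    exact this.trans (Nat.pow_le_pow_right (by norm_num) (Nat.mul_le_mul_left _ (ht.trans hL)))
  refine ⟨hsize (k := 2 * L + 8) ?_ ?_, fun i _ => hsize (h₁ _ _) hlt,
    fun i _ => hsize (h₁ _ _) hlt, fun i _ => hsize (h₁ _ _) hlt,
    fun u t ht => hsize (hsc u t ht) ?_, hsize (k := 2 * L * L + (L + 2)) ?_ ?_, hind⟩
  · have : n + m + 5 ≤ 2 ^ (L + 4) :=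
      (show n + m + 5 ≤ L + 4 by omega).trans Nat.lt_two_pow_self.le
    calc (n + m + 5) * (n + m + 5) ≤ 2 ^ (L + 4) * 2 ^ (L + 4) := Nat.mul_le_mul this this
      _ = 2 ^ (2 * L + 8) := by rw [← pow_add]; congr 1; ring
  · unfold bitBound
    nlinarith
  · unfold bitBound
    omega
  · have h₃ : bigOf n m a (n + m + 2) ≤ 1 + (n + m + 2) * 2 ^ (2 * L * L) := by
      refine Nat.add_le_add_left ((Finset.sum_le_card_nsmul _ _ (2 ^ (2 * L * L))
        fun u _ => hsc u _ le_rfl).trans ?_) 1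
      simp
    have h₄ : L + 2 ≤ 2 ^ (L + 2) := Nat.lt_two_pow_self.le
    have h₅ : 1 ≤ 2 ^ (2 * L * L) := Nat.one_le_two_pow
    rw [pow_add]
    nlinarith
  · unfold bitBound
    omega

theorem isNatPoly_bitBound : IsNatPoly bitBound :=
  (((IsNatPoly.const _).mul .id).mul .id).add ((IsNatPoly.const _).mul .id) |>.add (.const _)

/-! ### The surplus of the initial preflow -/

/-- The vertex of an agent or a project. -/
def vertex (n m : ℕ) : Fin n ⊕ Fin m → ℕ := Sum.elim (fun i => m + 1 + i) (fun j => j + 1)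

theorem vertex_injective (n m : ℕ) : Function.Injective (vertex n m) := by
  rintro (i | j) (i' | j') h <;> simp only [vertex, Sum.elim_inl, Sum.elim_inr] at h
  · congr 1
    ext
    omega
  · omega
  · omega
  · congr 1
    ext
    omega

theorem sum_range_vertices (n m : ℕ) (f : ℕ → ℝ) : ∑ u ∈ Finset.range (n + m + 1), f u =
    f 0 + (∑ i : Fin n, f (m + 1 + i) + ∑ j : Fin m, f (j + 1)) := by
  rw [Finset.sum_range_succ', Nat.add_comm n m, Finset.sum_range_add, Finset.sum_range,
    Finset.sum_range]
  have : ∀ i : ℕ, m + i + 1 = m + 1 + i := fun i => by omega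
  simp only [this]
  ring

variable {n m : ℕ} {a : ℕ → ℕ}

theorem scaled_le_bigOf {u : ℕ} (hu : u < n + m + 2) :
    scaled n m a u (n + m + 1) ≤ bigOf n m a (n + m + 2) :=
  (Finset.single_le_sum (f := fun u => scaled n m a u (n + m + 1)) (fun _ _ => Nat.zero_le _)
    (Finset.mem_range.2 hu)).trans (Nat.le_add_left _ _)

/-- Since the sink is outside, every project in `S` pays its cost arc, and every agent in `S` pays
the big capacity once for each demanded project that is missing. -/
theorem surplus_initial {S : Finset ℕ} (hS : S ⊆ Finset.range (n + m + 1)) (h₀ : 0 ∉ S) :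
    ((initial n m a).surplus (n + m + 1) S : ℝ) =
      ∑ i : Fin n, (if m + 1 + (i : ℕ) ∈ S then (scaled n m a (m + 1 + i) (n + m + 1) : ℝ) -
        ∑ j : Fin m, (if (j : ℕ) + 1 ∈ S then 0 else
          (bigOf n m a (n + m + 2) : ℝ) * a (2 + i * (m + 4) + (4 + j))) else 0) -
      ∑ j : Fin m, (if (j : ℕ) + 1 ∈ S then (scaled n m a (j + 1) (n + m + 1) : ℝ) else 0) := by
  have h₁ : ((initial n m a).surplus (n + m + 1) S : ℝ) = ∑ u ∈ Finset.range (n + m + 1),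
      if u ∈ S then (excessOf n m a u : ℝ) - ∑ v ∈ Finset.range (n + m + 1),
        (if v ∈ S then 0 else (capOf n m a u v : ℝ)) else 0 := by
    rw [Finset.sum_ite_mem, Finset.inter_eq_right.2 hS, Finset.sum_sub_distrib, Preflow.surplus]
    push_cast
    congr 1
    refine Finset.sum_congr rfl fun u _ => ?_
    rw [Finset.sdiff_eq_filter, Finset.sum_filter]
    refine Finset.sum_congr rfl fun v _ => ?_
    by_cases hv : v ∈ S <;> simp [hv, initial]
  rw [h₁, sum_range_vertices, if_neg h₀, zero_add, sub_eq_add_neg, ← Finset.sum_neg_distrib]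
  congr 1
  · refine Finset.sum_congr rfl fun i _ => ?_
    split_ifs with hi
    · rw [sum_range_vertices, if_neg h₀]
      have e₁ : excessOf n m a (m + 1 + i) = scaled n m a (m + 1 + i) (n + m + 1) := by
        rw [excessOf, if_neg (by omega)]
      have e₂ : capOf n m a (m + 1 + i) 0 = 0 := by
        rw [capOf, if_neg (by omega), if_neg (by omega), if_pos rfl]
      have e₃ : ∀ i' : Fin n, capOf n m a (m + 1 + i) (m + 1 + i') = 0 := by
        intro i'
        rw [capOf, if_neg (by omega), if_neg (by omega), if_neg (by omega), if_neg (by omega)]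
      have e₄ : ∀ j : Fin m, capOf n m a (m + 1 + i) (j + 1) =
          bigOf n m a (n + m + 2) * a (2 + i * (m + 4) + (4 + j)) := by
        intro j
        rw [capOf, if_neg (by omega), if_neg (by omega), if_neg (by omega), if_pos (by omega),
          Nat.add_sub_cancel_left, Nat.add_sub_cancel]
      simp [e₁, e₂, e₃, e₄]
    · rfl
  · refine Finset.sum_congr rfl fun j _ => ?_
    split_ifs with hj
    · rw [sum_range_vertices, if_neg h₀]
      have e₁ : excessOf n m a (j + 1) = 0 := by
        rw [excessOf, if_pos (by omega)]
      have e₂ : capOf n m a (j + 1) 0 = scaled n m a (j + 1) (n + m + 1) := by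
        rw [capOf, if_neg (by omega), if_pos (by omega), if_pos rfl]
      have e₃ : ∀ v, capOf n m a (j + 1) (v + 1) = 0 := by
        intro v
        rw [capOf, if_neg (by omega), if_pos (by omega), if_neg (by omega)]
      have e₄ : ∀ i : Fin n, capOf n m a (j + 1) (m + 1 + i) = 0 := by
        intro i
        rw [capOf, if_neg (by omega), if_pos (by omega), if_neg (by omega)]
      simp [e₁, e₂, e₃, e₄]
    · simp

theorem scaled_eq (n m : ℕ) (a : ℕ → ℕ) (hden : ∀ u < n + m + 1, denOf n m a u ≠ 0) {u : ℕ}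
    (hu : u < n + m + 1) : (scaled n m a u (n + m + 1) : ℝ) =
      scaled n m a (n + m + 1) (n + m + 1) * ((numOf n m a u : ℝ) / denOf n m a u) := by
  have h₁ : scaled n m a (n + m + 1) (n + m + 1) =
      ∏ s ∈ Finset.range (n + m + 1), denOf n m a s := by
    refine Finset.prod_congr rfl fun s hs => if_neg ?_
    exact (Finset.mem_range.1 hs).ne
  have hmem := Finset.mem_range.2 hu
  have h₂ : scaled n m a u (n + m + 1) =
      numOf n m a u * ∏ s ∈ (Finset.range (n + m + 1)).erase u, denOf n m a s := by
    rw [scaled, ← Finset.mul_prod_erase _ _ hmem, if_pos rfl]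
    congr 1
    exact Finset.prod_congr rfl fun s hs => if_neg (Finset.mem_erase.1 hs).1
  have h₃ : (denOf n m a u : ℝ) ≠ 0 := Nat.cast_ne_zero.2 (hden u hu)
  rw [h₁, h₂, ← Finset.mul_prod_erase _ _ hmem]
  push_cast
  field_simp

end MaxPE

/-! ### Scaled weights, surpluses of bundles, optimality and running time -/

namespace SMInput

open RAM MaxPE

variable (I : SMInput)

theorem toPB_isSingleMindedWith : I.toPB.IsSingleMindedWith I.D fun i => ((I.z i : ℚ≥0) : ℝ) :=
  fun i => ⟨by positivity, fun _ => rfl⟩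

theorem array_agent_num₁ (i : Fin I.n) : I.array (2 + i * (I.m + 4)) = (I.z i).num :=
  I.array_agent i (c := 0) (by omega)

theorem array_agent_den₁ (i : Fin I.n) : I.array (2 + i * (I.m + 4) + 1) = (I.z i).den :=
  I.array_agent i (by omega)

theorem array_agent_num₂ (i : Fin I.n) : I.array (2 + i * (I.m + 4) + 2) = (I.b i).num :=
  I.array_agent i (by omega)

theorem array_agent_den₂ (i : Fin I.n) : I.array (2 + i * (I.m + 4) + 3) = (I.b i).den :=
  I.array_agent i (by omega)

theorem denOf_agent (i : Fin I.n) :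
    denOf I.n I.m I.array (I.m + 1 + i) = (I.z i).den * (I.b i).den := by
  rw [denOf, if_neg (by omega), if_neg (by omega), Nat.add_sub_cancel_left, array_agent_den₁,
    array_agent_den₂]

theorem denOf_project (j : Fin I.m) : denOf I.n I.m I.array (j + 1) = (I.C j).den := by
  rw [denOf, if_neg (by omega), if_pos (by omega), Nat.add_sub_cancel]
  exact I.array_project j (by omega)

theorem denOf_ne_zero {u : ℕ} (hu : u < I.n + I.m + 1) : denOf I.n I.m I.array u ≠ 0 := by
  rcases Nat.eq_zero_or_pos u with rfl | h₀
  · simp [denOf]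
  rcases le_or_gt u I.m with hm | hm
  · have := I.denOf_project ⟨u - 1, by omega⟩
    rw [Nat.sub_add_cancel h₀] at this
    rw [this]
    exact NNRat.den_ne_zero _
  · have := I.denOf_agent ⟨u - (I.m + 1), by omega⟩
    rw [Nat.add_sub_cancel' hm] at this
    rw [this]
    exact mul_ne_zero (NNRat.den_ne_zero _) (NNRat.den_ne_zero _)

theorem weight_agent (i : Fin I.n) : (numOf I.n I.m I.array (I.m + 1 + i) : ℝ) /
    denOf I.n I.m I.array (I.m + 1 + i) = min ((I.b i : ℚ≥0) : ℝ) ((I.z i : ℚ≥0) : ℝ) := by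
  have hz : (0 : ℝ) < (I.z i).den := Nat.cast_pos.2 (NNRat.den_pos _)
  have hb : (0 : ℝ) < (I.b i).den := Nat.cast_pos.2 (NNRat.den_pos _)
  rw [denOf_agent, numOf, if_neg (by omega), if_neg (by omega), Nat.add_sub_cancel_left,
    array_agent_num₁, array_agent_den₁, array_agent_num₂, array_agent_den₂, min_comm,
    NNRat.cast_def (I.z i), NNRat.cast_def (I.b i)]
  push_cast
  rw [← min_div_div_right (by positivity)]
  congr 1 <;> field_simp

theorem weight_project (j : Fin I.m) : (numOf I.n I.m I.array (j + 1) : ℝ) /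
    denOf I.n I.m I.array (j + 1) = ((I.C j : ℚ≥0) : ℝ) := by
  rw [denOf_project, numOf, if_neg (by omega), if_pos (by omega), Nat.add_sub_cancel,
    NNRat.cast_def]
  congr 2
  exact I.array_project j (c := 0) (by omega)

/-- The common denominator. -/
def commonDen : ℕ := scaled I.n I.m I.array (I.n + I.m + 1) (I.n + I.m + 1)

theorem commonDen_ne_zero : I.commonDen ≠ 0 := by
  rw [commonDen, scaled, Finset.prod_ne_zero_iff]
  intro s hs
  rw [if_neg (Finset.mem_range.1 hs).ne]
  exact I.denOf_ne_zero (Finset.mem_range.1 hs)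

theorem scaled_agent (i : Fin I.n) : (scaled I.n I.m I.array (I.m + 1 + i) (I.n + I.m + 1) : ℝ) =
    I.commonDen * min ((I.b i : ℚ≥0) : ℝ) ((I.z i : ℚ≥0) : ℝ) := by
  rw [scaled_eq _ _ _ (fun u hu => I.denOf_ne_zero hu) (by omega), weight_agent, commonDen]

theorem scaled_project (j : Fin I.m) : (scaled I.n I.m I.array (j + 1) (I.n + I.m + 1) : ℝ) =
    I.commonDen * ((I.C j : ℚ≥0) : ℝ) := by
  rw [scaled_eq _ _ _ (fun u hu => I.denOf_ne_zero hu) (by omega), weight_project, commonDen]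

theorem commonDen_mul_PE (W : Finset (Fin I.m)) : I.commonDen * I.toPB.PE W =
    ∑ i, (if I.D i ⊆ W then (scaled I.n I.m I.array (I.m + 1 + i) (I.n + I.m + 1) : ℝ) else 0) -
      ∑ j, (if j ∈ W then (scaled I.n I.m I.array (j + 1) (I.n + I.m + 1) : ℝ) else 0) := by
  rw [I.toPB_isSingleMindedWith.PE_eq, mul_sub, Finset.mul_sum, Finset.mul_sum,
    Finset.sum_ite_mem, Finset.univ_inter]
  congr 1
  · refine Finset.sum_congr rfl fun i _ => ?_
    rw [mul_ite, mul_zero, scaled_agent]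
    rfl
  · refine Finset.sum_congr rfl fun j _ => ?_
    rw [scaled_project]
    rfl

/-- The set need not be closed: an agent whose demand is not covered pays at least `bigOf`, which
exceeds its scaled weight, so its net contribution is not positive. -/
theorem surplus_le_PE {S : Finset ℕ} (hS : S ⊆ Finset.range (I.n + I.m + 1)) (h₀ : 0 ∉ S) :
    ((initial I.n I.m I.array).surplus (I.n + I.m + 1) S : ℝ) ≤
      I.commonDen * I.toPB.PE (Finset.univ.filter fun j : Fin I.m => (j : ℕ) + 1 ∈ S) := by
  rw [surplus_initial hS h₀, commonDen_mul_PE]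
  simp only [Finset.mem_filter, Finset.mem_univ, true_and]
  refine sub_le_sub_right (Finset.sum_le_sum fun i _ => ?_) _
  have hterm : ∀ j ∈ (Finset.univ : Finset (Fin I.m)), (0 : ℝ) ≤ if (j : ℕ) + 1 ∈ S then 0 else
      (bigOf I.n I.m I.array (I.n + I.m + 2) : ℝ) *
        I.array (2 + i * (I.m + 4) + (4 + j)) := by
    intro j _
    split_ifs <;> positivity
  split_ifs with h₁ h₂ h₂
  · exact sub_le_self _ (Finset.sum_nonneg hterm)
  · obtain ⟨j, hj, hjS⟩ := Finset.not_subset.1 h₂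
    have hjS : (j : ℕ) + 1 ∉ S := by simpa using hjS
    have hle := Finset.single_le_sum hterm (Finset.mem_univ j)
    rw [if_neg hjS, array_indicator, if_pos hj, Nat.cast_one, mul_one] at hle
    have hbig : (scaled I.n I.m I.array (I.m + 1 + i) (I.n + I.m + 1) : ℝ) ≤
        bigOf I.n I.m I.array (I.n + I.m + 2) := Nat.cast_le.2 (scaled_le_bigOf (by omega))
    linarith
  · positivity
  · exact le_rfl

/-- The vertices of a bundle. -/
def bundleVertices (W : Finset (Fin I.m)) : Finset ℕ :=
  (PBInstance.bundleClosure I.D W).image (vertex I.n I.m)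

theorem agent_mem_bundleVertices {W : Finset (Fin I.m)} {i : Fin I.n} :
    I.m + 1 + (i : ℕ) ∈ I.bundleVertices W ↔ I.D i ⊆ W := by
  have := (vertex_injective I.n I.m).mem_finset_image
    (s := PBInstance.bundleClosure I.D W) (a := Sum.inl i)
  rw [PBInstance.bundleClosure, Finset.inl_mem_disjSum, Finset.mem_filter] at this
  exact this.trans (and_iff_right (Finset.mem_univ i))

theorem project_mem_bundleVertices {W : Finset (Fin I.m)} {j : Fin I.m} :
    (j : ℕ) + 1 ∈ I.bundleVertices W ↔ j ∈ W := by
  have := (vertex_injective I.n I.m).mem_finset_image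
    (s := PBInstance.bundleClosure I.D W) (a := Sum.inr j)
  rw [PBInstance.bundleClosure, Finset.inr_mem_disjSum] at this
  exact this

theorem bundleVertices_subset (W : Finset (Fin I.m)) :
    I.bundleVertices W ⊆ Finset.range (I.n + I.m + 1) := by
  intro u hu
  obtain ⟨i | j, -, rfl⟩ := Finset.mem_image.1 hu <;>
    simp only [vertex, Sum.elim_inl, Sum.elim_inr, Finset.mem_range] <;> omega

theorem zero_notMem_bundleVertices (W : Finset (Fin I.m)) : 0 ∉ I.bundleVertices W := by
  intro hu
  obtain ⟨i | j, -, h⟩ := Finset.mem_image.1 hu <;>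
    simp only [vertex, Sum.elim_inl, Sum.elim_inr] at h <;> omega

theorem surplus_bundleVertices (W : Finset (Fin I.m)) :
    ((initial I.n I.m I.array).surplus (I.n + I.m + 1) (I.bundleVertices W) : ℝ) =
      I.commonDen * I.toPB.PE W := by
  rw [surplus_initial (I.bundleVertices_subset W) (I.zero_notMem_bundleVertices W),
    commonDen_mul_PE]
  simp only [agent_mem_bundleVertices, project_mem_bundleVertices]
  congr 1
  refine Finset.sum_congr rfl fun i _ => ?_
  split_ifs with h
  · rw [Finset.sum_eq_zero, sub_zero]
    intro j _
    split_ifs with hj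
    · rfl
    · rw [array_indicator, if_neg fun hD => hj (h hD), Nat.cast_zero, mul_zero]
  · rfl

/-- A final preflow with a gap in its labels yields an optimal bundle. -/
theorem isMaxPESet_of_preflow {G : Preflow} {g : ℕ}
    (hG : G.Good (I.n + I.m + 1) ((initial I.n I.m I.array).surplus (I.n + I.m + 1)))
    (hst : Stuck G (I.n + I.m + 1) (I.n + I.m + 1)) (h₁ : 1 ≤ g) (h₂ : g ≤ I.n + I.m + 1)
    (hgap : ∀ u < I.n + I.m + 1, G.d u ≠ g) :
    I.toPB.IsMaxPESet (Finset.univ.filter fun j : Fin I.m => g ≤ G.d (j + 1)) ∧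
      I.toPB.PE (Finset.univ.filter fun j : Fin I.m => g ≤ G.d (j + 1)) =
        ((∑ u ∈ Finset.Ico 1 (I.n + I.m + 1), G.e u : ℕ) : ℝ) / (I.commonDen : ℝ) := by
  set N := I.n + I.m + 1 with hN
  set S := (Finset.range N).filter fun u => g ≤ G.d u with hS
  set W := Finset.univ.filter fun j : Fin I.m => g ≤ G.d (j + 1) with hW
  have hpos : (0 : ℝ) < I.commonDen := Nat.cast_pos.2 (Nat.pos_of_ne_zero I.commonDen_ne_zero)
  have hsum : ((∑ u ∈ Finset.Ico 1 N, G.e u : ℕ) : ℝ) =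
      ((∑ u ∈ (Finset.range N).erase 0, (G.e u : ℤ) : ℤ) : ℝ) := by
    have : (Finset.range N).erase 0 = Finset.Ico 1 N := by
      ext u
      simp only [Finset.mem_erase, Finset.mem_range, Finset.mem_Ico]
      omega
    rw [this]
    push_cast
    rfl
  -- Weak duality: the surplus of a bundle's closure never changed, and it is bounded by the excess
  -- outside the sink.
  have hup : ∀ W', I.commonDen * I.toPB.PE W' ≤ ((∑ u ∈ Finset.Ico 1 N, G.e u : ℕ) : ℝ) := by
    intro W'
    rw [← surplus_bundleVertices, hsum, Int.cast_le,
      ← hG.surplus _ (I.bundleVertices_subset W')]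
    exact Preflow.surplus_le (I.bundleVertices_subset W') (I.zero_notMem_bundleVertices W')
  -- The vertices above the gap attain the bound; their initial surplus is at most the scaled value
  -- of their projects.
  have hlow : ((∑ u ∈ Finset.Ico 1 N, G.e u : ℕ) : ℝ) ≤ I.commonDen * I.toPB.PE W := by
    have hsub : S ⊆ Finset.range N := Finset.filter_subset _ _
    have h0 : 0 ∉ S := by
      simp only [hS, Finset.mem_filter, hG.valid.zero]
      omega
    have hWS : W = Finset.univ.filter fun j : Fin I.m => (j : ℕ) + 1 ∈ S := by
      ext j
      simp only [hW, hS, Finset.mem_filter, Finset.mem_univ, true_and, Finset.mem_range]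
      exact ⟨fun h => ⟨by omega, h⟩, fun h => h.2⟩
    rw [hWS, hsum, ← Preflow.surplus_eq_of_gap hG.valid hst h₁ h₂ hgap, hG.surplus S hsub]
    exact I.surplus_le_PE hsub h0
  refine ⟨fun W' => le_of_mul_le_mul_left ((hup W').trans hlow) hpos, ?_⟩
  rw [eq_div_iff hpos.ne', mul_comm]
  exact le_antisymm (hup W) hlow

theorem fits : Fits (bitBound (bitLength I.encode)) I.n I.m I.array := by
  refine fits_of_size_le (I.length_encode.trans (length_le_bitLength _))
    (fun x => size_getD_le_bitLength _ x) fun i hi j hj => ?_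
  have := I.array_indicator ⟨i, hi⟩ ⟨j, hj⟩
  rw [this]
  split_ifs <;> omega

/-- With `k` steps from numbers of at most `K` bits the cost is at most `k * (1 + 2 * (K + k))`;
here `K` is `bitBound L`, which covers both the input and all products, and `k` is at most
`programSteps L`. The program uses registers below `12`, so scratch space starts there. -/
theorem solvableInPolyTime : SolvableInPolyTime encode IsSolution := by
  have hpoly : IsNatPoly fun L => programSteps L * (1 + 2 * (bitBound L + programSteps L)) :=
    isNatPoly_programSteps.mul ((IsNatPoly.const _).add ((IsNatPoly.const _).mul
      (isNatPoly_bitBound.add isNatPoly_programSteps)))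
  obtain ⟨T, hT⟩ := hpoly
  refine ⟨program.compile 12, T, fun I => ?_⟩
  set L := bitLength I.encode with hL
  have hNL : I.n + I.m + 1 ≤ L := I.length_encode.trans (length_le_bitLength _)
  obtain ⟨k, hk, s, hex, G, g, hG, hst, h₁, h₂, hgap, o₀, o₁, o₂, o₃⟩ :=
    program_spec (s := inputState I.encode) I.fits rfl rfl rfl fun _ => rfl
  obtain ⟨σ, ⟨t, ex, hbd⟩, hag⟩ := hex.runs (inputState I.encode) program_below
    ⟨fun _ _ => rfl, rfl⟩
  have hin : (inputState I.encode).Bounded (bitBound L) := by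
    have hle : L ≤ bitBound L := by
      unfold bitBound
      nlinarith
    refine ⟨fun x => ?_, fun x i => ?_⟩
    · simp only [inputState]
      split_ifs
      · exact (size_le_self _).trans ((length_le_bitLength _).trans hle)
      · simp
    · simp only [inputState]
      split_ifs
      · exact (size_getD_le_bitLength _ _).trans hle
      · simp
  have ht := (hbd _ le_rfl hin).2
  have hk' : k ≤ programSteps L := hk.trans (isNatPoly_programSteps.monotone hNL)
  obtain ⟨hmax, hval⟩ := I.isMaxPESet_of_preflow hG hst h₁ h₂ hgap
  refine ⟨t, σ, ex, ?_, _, _, _, ?_, hmax, I.commonDen_ne_zero, hval⟩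
  · rw [← hT]
    refine ht.trans ?_
    change _ ≤ programSteps L * (1 + 2 * (bitBound L + programSteps L))
    gcongr
  · rw [outputList, ← hag.1 0 (by norm_num), ← hag.2, o₀]
    rw [List.range_succ_eq_map, List.range_succ_eq_map, List.map_cons, List.map_cons, List.map_cons,
      List.map_map, List.map_map, o₁]
    congr 1
    rw [Nat.succ_eq_add_one, zero_add, o₂]
    congr 1
    refine List.ext_getElem (by simp [indicatorList]) fun j hj _ => ?_
    have hj' : j < I.m := by simpa using hj
    simp [indicatorList, o₃ j hj']

end SMInput

theorem mainTheorem9 :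
    -- the maximization problem is solvable in polynomial time
    RAM.SolvableInPolyTime SMInput.encode SMInput.IsSolution ∧
    ∀ (n m : ℕ) (I : PBInstance n m) (D : Fin n → Finset (Fin m)) (z : Fin n → ℝ),
      I.IsSingleMindedWith D z →
      -- the integer program describes the problem
      ((∀ W, PBInstance.ILPFeasible D (PBInstance.bundleVector D W) ∧
          I.objective z (PBInstance.bundleVector D W) = I.PE W) ∧
        (∀ W, I.IsMaxPESet W ↔ I.IsILPOptimal D z (PBInstance.bundleVector D W)) ∧
        (∀ u, I.IsILPOptimal D z u →
          I.IsMaxPESet (Finset.univ.filter fun j => u (Sum.inr j) = 1) ∧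
          I.PE (Finset.univ.filter fun j => u (Sum.inr j) = 1) = I.objective z u)) ∧
      -- its linear relaxation has a totally unimodular constraint matrix
      ((∀ u, PBInstance.LPFeasible D u ↔
          Matrix.mulVec (PBInstance.lpMatrix D) u ≤ PBInstance.lpRhs D) ∧
        (PBInstance.lpMatrix D).IsTotallyUnimodular) ∧
      -- it is a maximum-weight closure problem
      ((∀ W, I.IsMaxPESet W ↔ I.IsMaxClosure D z (PBInstance.bundleClosure D W)) ∧
        (∀ S, I.IsMaxClosure D z S →
          I.IsMaxPESet (Finset.univ.filter fun j => Sum.inr j ∈ S) ∧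
          I.PE (Finset.univ.filter fun j => Sum.inr j ∈ S) = ∑ k ∈ S, I.weight z k)) ∧
      -- it is a minimum-cut problem
      ((∀ W, I.IsMaxPESet W ↔ I.IsMinCut D z
          (insert PBInstance.source ((PBInstance.bundleClosure D W).image PBInstance.inner))) ∧
        (∀ S, I.IsMinCut D z S →
          I.IsMaxPESet (Finset.univ.filter fun j => PBInstance.inner (Sum.inr j) ∈ S) ∧
          I.cutCapacity D z S ≠ ⊤ ∧
          I.PE (Finset.univ.filter fun j => PBInstance.inner (Sum.inr j) ∈ S) =
            ∑ i, min (I.b i) (z i) - (I.cutCapacity D z S).toReal)) := by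
  refine ⟨SMInput.solvableInPolyTime, fun n m I D z h => ⟨⟨fun W => ?_, fun W => ?_,
    fun u hu => hu.isMaxPESet h⟩, ⟨PBInstance.lpFeasible_iff D,
    PBInstance.lpMatrix_isTotallyUnimodular D⟩, ⟨PBInstance.isMaxPESet_iff_isMaxClosure h,
    fun S hS => hS.isMaxPESet h⟩, fun W => ?_, fun S hS => hS.isMaxPESet h⟩⟩
  · rw [PBInstance.bundleVector_eq, PBInstance.ilpFeasible_indicatorVector,
      PBInstance.objective_indicatorVector, PBInstance.sum_weight_bundleClosure h]
    exact ⟨PBInstance.isClosure_bundleClosure D W, rfl⟩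
  · rw [PBInstance.bundleVector_eq, PBInstance.isILPOptimal_indicatorVector,
      PBInstance.isMaxPESet_iff_isMaxClosure h]
  · rw [PBInstance.isMaxPESet_iff_isMaxClosure h]
    exact (PBInstance.isMinCut_sourceSide h _).symm
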